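/- Let $\mathcal N=\mathcal V\oplus\mathcal Z$ be a finite-dimensional real Lie algebra, where $\mathcal V,\mathcal Z$ are Euclidean spaces with $[\mathcal V,\mathcal V]\subset\mathcal Z$ and $[\mathcal N,\mathcal Z]=0$, of one of the following two kinds. * *H-type:* $\mathcal V,\mathcal Z\neq 0$ and, for all $A\in\mathcal Z$, $J(A)^2=-|A|^2\,\mathrm{Id}_{\mathcal V}$, where $J(A)\in\operatorname{End}\mathcal V$ is defined by $\langle J(A)X,X'\rangle=\langle A,[X,X']\rangle$. * *Free two-step nilpotent, $\mathcal N=\mathcal N_{v,2}$:* $\mathcal V$ has an orthonormal basis $X_1,\dots,X_v$ such that the brackets $[X_i,X_j]$, $i<j$, form an orthonormal basis of $\mathcal Z$. Put $v=\dim\mathcal V$, $z=\dim\mathcal Z$, $v'=\lfloor v/2\rfloor$ and $Q=v+2z$. Let $N=\exp\mathcal N$ be the connected simply connected Lie group of $\mathcal N$, with dilations $r.\exp(X+A)=\exp(rX+r^2A)$, Korányi norm $|\exp(X+A)|=(|X|^4+|A|^2)^{1/4}$ ($X\in\mathcal V$, $A\in\mathcal Z$), and Haar measure $dn=dX\,dA$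 (Lebesgue measures of the Euclidean spaces $\mathcal V,\mathcal Z$); all $L^p$ norms are with respect to $dn$. Let $\mu$ be the unique Radon measure on the unit sphere $S_1=\{|n|=1\}$ such that $$\int_N g(n)\,dn=\int_0^\infty\int_{S_1}g(r.n)\,d\mu(n)\,r^{Q-1}\,dr\qquad (g\in L^1(N)).$$ For $s>0$ put $f*\mu_s(n)=\int_{S_1}f\big(n\,(s.n')^{-1}\big)\,d\mu(n')$, and define the spherical maximal function and, for $f$ in the Schwartz class $\mathcal S(N)$ and $j\ge 1$, the area functions by $$\mathcal A f=\sup_{s>0}|f*\mu_s|,\qquad S^j(f)=\Big(\int_0^\infty\big|\partial_s^j(f*\mu_s)\big|^2s^{2j-1}\,ds\Big)^{1/2}.$$ **Theorem.** Suppose $v'\ge 2$, and let $h\in\mathbb N$ with $1\le h<(Q-2)/2$. Suppose that the area functions $S^1,\dots,S^h$ are bounded on $L^2$: for every $j=1,\dots,h$ there is $K>0$ such that $\|S^j(f)\|_{L^2}\le K\|f\|_{L^2}$ for all $f\in\mathcal S(N)$. Let $p\in[1,\infty]$ be such that * a) $2\le p\le\infty$, if $h=1$; * b) $\frac{2h}{2h-1}<p\le\infty$,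 if $h>1$. Then there is a constant $C$, depending only on $v,z,p,h$, such that every $f\in L^p(N)$ satisfies $$\|\mathcal A f\|_{L^p}\le C\,\|f\|_{L^p}.$$ Here, for almost every $n$, the integrals defining $f*\mu_s(n)$ converge absolutely for all $s>0$, and $\mathcal A f$ is measurable (up to a null set). -/

import Mathlib

open MeasureTheory Set
open scoped NNReal ENNReal SchwartzMap

noncomputable section

/-- A Lie algebra `𝒩 = V ⊕ Z` (orthogonal direct sum of Euclidean spaces) with `[V, V] ⊆ Z` and
`[𝒩, Z] = 0`. Such a bracket is exactly an alternating bilinear map `V × V → Z`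
(`[X + A, X' + A'] = [X, X']`, and the Jacobi identity is automatic). -/
structure TwoStepLieAlgebra (V Z : Type*) [NormedAddCommGroup V] [InnerProductSpace ℝ V]
    [NormedAddCommGroup Z] [InnerProductSpace ℝ Z] where
  /-- the Lie bracket restricted to `V × V` -/
  bracket : V →ₗ[ℝ] V →ₗ[ℝ] Z
  bracket_self : ∀ X, bracket X X = 0

namespace TwoStepLieAlgebra

variable {V Z : Type*} [NormedAddCommGroup V] [InnerProductSpace ℝ V] [FiniteDimensional ℝ V]
  [NormedAddCommGroup Z] [InnerProductSpace ℝ Z] [FiniteDimensional ℝ Z]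

/-- The map `J : Z → End V` determined by `⟪J(A) X, X'⟫ = ⟪A, [X, X']⟫`. -/
def J (𝔫 : TwoStepLieAlgebra V Z) (A : Z) : V →ₗ[ℝ] V where
  toFun X := LinearMap.adjoint (𝔫.bracket X) A
  map_add' X Y := by simp
  map_smul' c X := by simp

lemma inner_J (𝔫 : TwoStepLieAlgebra V Z) (A : Z) (X X' : V) :
    inner ℝ (𝔫.J A X) X' = inner ℝ A (𝔫.bracket X X') := by
  change inner ℝ (LinearMap.adjoint (𝔫.bracket X) A) X' = _
  rw [LinearMap.adjoint_inner_left]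

/-- Lie algebras of Heisenberg type: `V` and `Z` are non-zero and `J(A)² = -|A|² Id` for all
`A ∈ Z`. -/
def IsHType (𝔫 : TwoStepLieAlgebra V Z) : Prop :=
  Nontrivial V ∧ Nontrivial Z ∧ ∀ A : Z, 𝔫.J A ∘ₗ 𝔫.J A = -(‖A‖ ^ 2) • LinearMap.id

/-- Free two-step nilpotent Lie algebras with canonical Euclidean structure: for some basis
`X₁, …, X_v` of `V` the brackets `[X_i, X_j]`, `i < j`, form a basis of `Z`, and both bases are
orthonormal. -/
def IsFree (𝔫 : TwoStepLieAlgebra V Z) : Prop :=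
  ∃ (e : OrthonormalBasis (Fin (Module.finrank ℝ V)) ℝ V)
    (E : OrthonormalBasis
      {ij : Fin (Module.finrank ℝ V) × Fin (Module.finrank ℝ V) // ij.1 < ij.2} ℝ Z),
    ∀ ij, E ij = 𝔫.bracket (e ij.1.1) (e ij.1.2)

/-- The product of the connected simply connected group `N = exp 𝒩`, where `(X, A) : V × Z` stands
for `exp (X + A)`; by the Baker-Campbell-Hausdorff formula
`exp (X + A) exp (X' + A') = exp (X + X' + A + A' + [X, X'] / 2)`. -/
def mul (𝔫 : TwoStepLieAlgebra V Z) (n n' : V × Z) : V × Z :=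
  (n.1 + n'.1, n.2 + n'.2 + (2⁻¹ : ℝ) • 𝔫.bracket n.1 n'.1)

end TwoStepLieAlgebra

section Homogeneous

variable {V Z : Type*} [NormedAddCommGroup V] [InnerProductSpace ℝ V] [FiniteDimensional ℝ V]
  [MeasurableSpace V] [BorelSpace V]
  [NormedAddCommGroup Z] [InnerProductSpace ℝ Z] [FiniteDimensional ℝ Z]
  [MeasurableSpace Z] [BorelSpace Z]

/-- The dilations `r.exp (X + A) = exp (r X + r² A)`. -/
def dil (r : ℝ) (n : V × Z) : V × Z := (r • n.1, r ^ 2 • n.2)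

/-- The Korányi norm `|exp (X + A)| = (|X|⁴ + |A|²)^(1/4)`. -/
def koranyiNorm (n : V × Z) : ℝ := (‖n.1‖ ^ 4 + ‖n.2‖ ^ 2) ^ (1 / 4 : ℝ)

/-- The homogeneous dimension `Q = dim V + 2 dim Z`. -/
def homDim (V Z : Type*) [NormedAddCommGroup V] [InnerProductSpace ℝ V]
    [NormedAddCommGroup Z] [InnerProductSpace ℝ Z] : ℕ :=
  Module.finrank ℝ V + 2 * Module.finrank ℝ Z

/-- The measure `μ` on the unit Korányi sphere for which integration in polar coordinates holds
(see `lintegral_polar`), as a measure on `N` carried by the sphere: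
`μ(E) = Q |{n : 0 < |n| < 1, |n|⁻¹.n ∈ E}|`. The Haar measure of `N` is the Lebesgue measure of
the Euclidean space `V ⊕ Z`. -/
def sphereMeasure (V Z : Type*) [NormedAddCommGroup V] [InnerProductSpace ℝ V]
    [FiniteDimensional ℝ V] [MeasurableSpace V] [BorelSpace V]
    [NormedAddCommGroup Z] [InnerProductSpace ℝ Z] [FiniteDimensional ℝ Z]
    [MeasurableSpace Z] [BorelSpace Z] : Measure (V × Z) :=
  (homDim V Z : ℝ≥0∞) • Measure.map (fun n => dil (koranyiNorm n)⁻¹ n)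
    (volume.restrict {n : V × Z | 0 < koranyiNorm n ∧ koranyiNorm n < 1})

lemma measurable_koranyiNorm : Measurable (koranyiNorm : V × Z → ℝ) := by
  unfold koranyiNorm; fun_prop

lemma measurable_dil : Measurable fun q : ℝ × (V × Z) => dil q.1 q.2 := by
  unfold dil; fun_prop

lemma koranyiNorm_dil {r : ℝ} (hr : 0 ≤ r) (n : V × Z) :
    koranyiNorm (dil r n) = r * koranyiNorm n := by
  unfold koranyiNorm dil
  have h1 : ‖r • n.1‖ ^ 4 + ‖r ^ 2 • n.2‖ ^ 2 = r ^ 4 * (‖n.1‖ ^ 4 + ‖n.2‖ ^ 2) := by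
    rw [norm_smul, norm_smul, Real.norm_of_nonneg hr, Real.norm_of_nonneg (by positivity)]; ring
  have h2 : (r ^ 4 : ℝ) ^ (1 / 4 : ℝ) = r := by
    rw [← Real.rpow_natCast, ← Real.rpow_mul hr]; norm_num
  rw [h1, Real.mul_rpow (by positivity) (by positivity), h2]

lemma lintegral_dil {t : ℝ} (ht : 0 < t) {g : V × Z → ℝ≥0∞} (hg : Measurable g) :
    ∫⁻ n, g (dil t n) = ENNReal.ofReal ((t ^ homDim V Z)⁻¹) * ∫⁻ n, g n := by
  have hm : Measure.map (fun n : V × Z => dil t n) volume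
      = ENNReal.ofReal ((t ^ homDim V Z)⁻¹) • volume := by
    have h := Measure.map_prod_map (volume : Measure V) (volume : Measure Z)
      (f := fun x => t • x) (g := fun x => t ^ 2 • x) (by fun_prop) (by fun_prop)
    rw [Measure.map_addHaar_smul _ ht.ne', Measure.map_addHaar_smul _ (by positivity),
      Measure.prod_smul_left, Measure.prod_smul_right, smul_smul,
      ← ENNReal.ofReal_mul (by positivity)] at h
    change Measure.map (Prod.map _ _) (volume.prod volume) = _
    rw [← h, abs_of_pos (by positivity), abs_of_pos (by positivity), homDim, pow_add, pow_mul,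
      mul_inv]
    rfl
  have hd : Measurable fun n : V × Z => dil t n := measurable_dil.comp measurable_prodMk_left
  rw [← lintegral_map hg hd, hm, lintegral_smul_measure, smul_eq_mul]

/-- Integration in polar coordinates, which characterizes `μ`. -/
theorem lintegral_polar (hQ : 0 < homDim V Z) {g : V × Z → ℝ≥0∞} (hg : Measurable g) :
    ∫⁻ n, g n = ∫⁻ r in Ioi (0 : ℝ), (∫⁻ n, g (dil r n) ∂(sphereMeasure V Z))
      * ENNReal.ofReal (r ^ (homDim V Z - 1)) := by
  have hρ : Measurable (koranyiNorm : V × Z → ℝ) := measurable_koranyiNorm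
  have hd (r : ℝ) : Measurable fun n : V × Z => dil r n :=
    measurable_dil.comp measurable_prodMk_left
  have hproj : Measurable fun n : V × Z => dil (koranyiNorm n)⁻¹ n :=
    measurable_dil.comp (hρ.inv.prodMk measurable_id)
  have hdd (r c : ℝ) (n : V × Z) : dil r (dil c n) = dil (r * c) n := by
    simp [dil, smul_smul, mul_pow]
  generalize hQe : homDim V Z = Q at *
  set B : Set (V × Z) := {n | 0 < koranyiNorm n ∧ koranyiNorm n < 1} with hB
  have hBm : MeasurableSet B :=
    (measurableSet_lt measurable_const hρ).inter (measurableSet_lt hρ measurable_const)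
  symm
  calc
    _ = ∫⁻ r in Ioi (0 : ℝ), ∫⁻ x in B, (Q : ℝ≥0∞) *
          (g (dil (r * (koranyiNorm x)⁻¹) x) * ENNReal.ofReal (r ^ (Q - 1))) := by
      refine lintegral_congr fun r => ?_
      have hgm : Measurable fun x : V × Z => g (dil (r * (koranyiNorm x)⁻¹) x) :=
        hg.comp (measurable_dil.comp ((measurable_const.mul hρ.inv).prodMk measurable_id))
      rw [sphereMeasure, lintegral_smul_measure, lintegral_map (f := fun a => g (dil r a)) (hg.comp (hd r)) hproj, hQe,
        lintegral_const_mul _ (hgm.mul_const _), lintegral_mul_const _ hgm, smul_eq_mul, mul_assoc]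
      simp only [hdd, ← hB]
    _ = ∫⁻ x in B, ∫⁻ r in Ioi (0 : ℝ), (Q : ℝ≥0∞) *
          (g (dil (r * (koranyiNorm x)⁻¹) x) * ENNReal.ofReal (r ^ (Q - 1))) := by
      refine lintegral_lintegral_swap (Measurable.aemeasurable ?_)
      have : Measurable fun q : ℝ × (V × Z) => g (dil (q.1 * (koranyiNorm q.2)⁻¹) q.2) :=
        hg.comp (measurable_dil.comp
          ((measurable_fst.mul (hρ.comp measurable_snd).inv).prodMk measurable_snd))
      exact measurable_const.mul (this.mul (by fun_prop))
    _ = ∫⁻ x in B, ∫⁻ t in Ioi (0 : ℝ), (Q : ℝ≥0∞) *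
          (ENNReal.ofReal (koranyiNorm x ^ Q) * g (dil t x) * ENNReal.ofReal (t ^ (Q - 1))) := by
      refine setLIntegral_congr_fun hBm fun x hx => ?_
      have hc : 0 < koranyiNorm x := hx.1
      set c := koranyiNorm x
      have hF : Measurable fun r : ℝ => (Ioi (0 : ℝ)).indicator (fun r => (Q : ℝ≥0∞) *
          (g (dil (r * c⁻¹) x) * ENNReal.ofReal (r ^ (Q - 1)))) r := by
        refine Measurable.indicator ?_ measurableSet_Ioi
        have : Measurable fun r : ℝ => g (dil (r * c⁻¹) x) :=
          hg.comp (measurable_dil.comp ((measurable_id.mul_const _).prodMk measurable_const))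
        exact measurable_const.mul (this.mul (by fun_prop))
      rw [← lintegral_indicator measurableSet_Ioi, ← lintegral_indicator measurableSet_Ioi]
      conv_lhs => rw [← Real.smul_map_volume_mul_left hc.ne']
      rw [lintegral_smul_measure, lintegral_map hF (by fun_prop), smul_eq_mul]
      erw [← lintegral_const_mul _ (hF.comp (measurable_const_mul c))]
      refine lintegral_congr fun t => ?_
      simp only [Function.comp_apply]
      by_cases ht : 0 < t
      · rw [indicator_of_mem (mem_Ioi.2 (mul_pos hc ht)), indicator_of_mem (mem_Ioi.2 ht)]
        have e1 : c * t * c⁻¹ = t := by field_simp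
        rw [e1, abs_of_pos hc, mul_pow, ENNReal.ofReal_mul (by positivity)]
        have e2 : ENNReal.ofReal (c ^ Q) = ENNReal.ofReal c * ENNReal.ofReal (c ^ (Q - 1)) := by
          rw [← ENNReal.ofReal_mul hc.le, ← pow_succ', Nat.sub_add_cancel hQ]
        rw [e2]; ring
      · rw [indicator_of_notMem (notMem_Ioi.2 (mul_nonpos_of_nonneg_of_nonpos hc.le (not_lt.1 ht))),
          indicator_of_notMem (notMem_Ioi.2 (not_lt.1 ht)), mul_zero]
    _ = ∫⁻ t in Ioi (0 : ℝ), ∫⁻ x in B, (Q : ℝ≥0∞) *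
          (ENNReal.ofReal (koranyiNorm x ^ Q) * g (dil t x) * ENNReal.ofReal (t ^ (Q - 1))) := by
      refine lintegral_lintegral_swap (Measurable.aemeasurable ?_)
      have : Measurable fun q : (V × Z) × ℝ => g (dil q.2 q.1) :=
        hg.comp (measurable_dil.comp (measurable_snd.prodMk measurable_fst))
      exact measurable_const.mul
        (((((hρ.comp measurable_fst).pow_const Q).ennreal_ofReal).mul this).mul (by fun_prop))
    _ = ∫⁻ t in Ioi (0 : ℝ), ∫⁻ y, {y : V × Z | 0 < koranyiNorm y}.indicator g y *
          (Ioi (koranyiNorm y)).indicator (fun t => ENNReal.ofReal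
            (Q * (koranyiNorm y ^ Q * t ^ (-(Q + 1 : ℝ))))) t := by
      refine setLIntegral_congr_fun measurableSet_Ioi fun t (ht : 0 < t) => ?_
      let Φ : V × Z → ℝ≥0∞ := fun y => {y : V × Z | 0 < koranyiNorm y ∧ koranyiNorm y < t}.indicator
        (fun y => (Q : ℝ≥0∞) * (ENNReal.ofReal ((koranyiNorm y / t) ^ Q) * g y *
          ENNReal.ofReal (t ^ (Q - 1)))) y
      have hΦ : Measurable Φ := by
        refine Measurable.indicator ?_ ((measurableSet_lt measurable_const hρ).inter
          (measurableSet_lt hρ measurable_const))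
        exact measurable_const.mul
          (((((hρ.div_const t).pow_const Q).ennreal_ofReal).mul hg).mul measurable_const)
      have h1 : ∀ x, B.indicator (fun x => (Q : ℝ≥0∞) * (ENNReal.ofReal (koranyiNorm x ^ Q) *
          g (dil t x) * ENNReal.ofReal (t ^ (Q - 1)))) x = Φ (dil t x) := by
        intro x
        simp only [Φ, indicator, mem_ofPred_eq, hB, koranyiNorm_dil ht.le]
        have e1 : 0 < t * koranyiNorm x ↔ 0 < koranyiNorm x := by simp [ht]
        have e2 : t * koranyiNorm x < t ↔ koranyiNorm x < 1 := by
          constructor <;> intro h <;> nlinarith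
        have e3 : t * koranyiNorm x / t = koranyiNorm x := by field_simp
        simp only [e1, e2, e3]
      rw [← lintegral_indicator hBm]
      simp only [h1]
      rw [lintegral_dil ht hΦ, hQe, ← lintegral_const_mul _ hΦ]
      refine lintegral_congr fun y => ?_
      simp only [Φ, indicator, mem_ofPred_eq, mem_Ioi]
      by_cases h0 : 0 < koranyiNorm y
      · by_cases h2 : koranyiNorm y < t
        · simp only [h0, h2, and_self, if_true]
          have e : (Q : ℝ) * (koranyiNorm y ^ Q * t ^ (-(Q + 1 : ℝ)))
              = (t ^ Q)⁻¹ * (Q * ((koranyiNorm y / t) ^ Q * t ^ (Q - 1))) := by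
            have e4 : t ^ (-(Q + 1 : ℝ)) = (t ^ (Q + 1))⁻¹ := by
              rw [Real.rpow_neg ht.le]; norm_cast
            obtain ⟨q, rfl⟩ : ∃ q, Q = q + 1 := ⟨Q - 1, by omega⟩
            rw [e4, Nat.add_sub_cancel, div_pow]
            field_simp
            ring
          rw [e, ENNReal.ofReal_mul (by positivity), ENNReal.ofReal_mul (by positivity),
            ENNReal.ofReal_mul (by positivity), ENNReal.ofReal_natCast]
          ring
        · simp [h2]
      · simp [h0]
    _ = ∫⁻ y, ∫⁻ t in Ioi (0 : ℝ), {y : V × Z | 0 < koranyiNorm y}.indicator g y *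
          (Ioi (koranyiNorm y)).indicator (fun t => ENNReal.ofReal
            (Q * (koranyiNorm y ^ Q * t ^ (-(Q + 1 : ℝ))))) t := by
      refine lintegral_lintegral_swap (Measurable.aemeasurable ?_)
      refine Measurable.mul ((hg.indicator (measurableSet_lt measurable_const hρ)).comp
        measurable_snd) ?_
      exact Measurable.indicator (s := {q : ℝ × (V × Z) | koranyiNorm q.2 < q.1})
        (f := fun q => ENNReal.ofReal (Q * (koranyiNorm q.2 ^ Q * q.1 ^ (-(Q + 1 : ℝ)))))
        (Measurable.ennreal_ofReal (measurable_const.mul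
          (((hρ.comp measurable_snd).pow_const Q).mul (measurable_fst.pow_const _))))
        (measurableSet_lt (hρ.comp measurable_snd) measurable_fst)
    _ = ∫⁻ y, {y : V × Z | 0 < koranyiNorm y}.indicator g y := by
      refine lintegral_congr fun y => ?_
      by_cases hy : 0 < koranyiNorm y
      · set c := koranyiNorm y
        have hQ' : (0 : ℝ) < Q := by exact_mod_cast hQ
        have hmt : Measurable fun t : ℝ =>
            ENNReal.ofReal (Q * (c ^ Q * t ^ (-(Q + 1 : ℝ)))) := by fun_prop
        have hint : IntegrableOn (fun t : ℝ => Q * (c ^ Q * t ^ (-(Q + 1 : ℝ)))) (Ioi c) :=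
          ((integrableOn_Ioi_rpow_of_lt (by linarith) hy).const_mul _).const_mul _
        have hI : ∫⁻ t in Ioi c, ENNReal.ofReal (Q * (c ^ Q * t ^ (-(Q + 1 : ℝ)))) = 1 := by
          rw [← ofReal_integral_eq_lintegral_ofReal hint, integral_const_mul, integral_const_mul,
            integral_Ioi_rpow_of_lt (by linarith) hy]
          · have e : (-(Q + 1 : ℝ) + 1) = -(Q : ℝ) := by ring
            rw [e, Real.rpow_neg hy.le, Real.rpow_natCast]
            rw [← ENNReal.ofReal_one]; congr 1; field_simp
          · refine (ae_restrict_iff' measurableSet_Ioi).2 (Filter.Eventually.of_forall fun t ht => ?_)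
            have : (0 : ℝ) < t := hy.trans ht
            simp only [Pi.zero_apply]
            positivity
        rw [lintegral_const_mul _ (hmt.indicator measurableSet_Ioi),
          setLIntegral_indicator measurableSet_Ioi,
          inter_eq_left.2 (Ioi_subset_Ioi hy.le), hI, mul_one]
      · simp [hy]
    _ = ∫⁻ n, g n := by
      have hpos : 0 < Module.finrank ℝ (V × Z) := by
        rw [Module.finrank_prod]; unfold homDim at hQe; omega
      have : Nontrivial (V × Z) := Module.finrank_pos_iff.1 hpos
      have : (volume : Measure (V × Z)).IsAddHaarMeasure :=
        inferInstanceAs (Measure.IsAddHaarMeasure ((volume : Measure V).prod (volume : Measure Z)))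
      refine lintegral_congr_ae ?_
      filter_upwards [Measure.ae_ne (volume : Measure (V × Z)) 0] with y hy
      refine indicator_of_mem (s := {y : V × Z | 0 < koranyiNorm y}) ?_ g
      change 0 < koranyiNorm y
      refine Real.rpow_pos_of_pos ?_ _
      by_contra hcon
      have h1 : ‖y.1‖ = 0 := by
        by_contra hne; have := (norm_nonneg y.1).lt_of_ne' hne; exact hcon (by positivity)
      have h2 : ‖y.2‖ = 0 := by
        by_contra hne; have := (norm_nonneg y.2).lt_of_ne' hne; exact hcon (by positivity)
      exact hy (Prod.ext (norm_eq_zero.1 h1) (norm_eq_zero.1 h2))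

namespace TwoStepLieAlgebra

/-- The function `n' ↦ f (n (s.n')⁻¹)`, whose `μ`-integral is `(f * μ_s)(n)`. The inverse
of `exp (X + A)` is `exp (-X - A)`. -/
def translate (𝔫 : TwoStepLieAlgebra V Z) (f : V × Z → ℂ) (s : ℝ) (n n' : V × Z) : ℂ :=
  f (𝔫.mul n (-dil s n'))

/-- The spherical mean `(f * μ_s)(n) = ∫ f (n (s.n')⁻¹) dμ(n')`. -/
def sphericalMean (𝔫 : TwoStepLieAlgebra V Z) (f : V × Z → ℂ) (s : ℝ) (n : V × Z) : ℂ :=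
  ∫ n', 𝔫.translate f s n n' ∂(sphereMeasure V Z)

/-- The spherical maximal function `𝒜 f = sup_{s > 0} |f * μ_s|`. -/
def sphericalMaximal (𝔫 : TwoStepLieAlgebra V Z) (f : V × Z → ℂ) (n : V × Z) : ℝ≥0∞ :=
  ⨆ s : ℝ, ⨆ _ : 0 < s, ‖𝔫.sphericalMean f s n‖ₑ

/-- The area function `S^j f = (∫_0^∞ |∂_s^j (f * μ_s)|² s^(2j-1) ds)^(1/2)`, for `j ≥ 1`. -/
def areaFunction (𝔫 : TwoStepLieAlgebra V Z) (j : ℕ) (f : V × Z → ℂ) (n : V × Z) : ℝ≥0∞ :=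
  (∫⁻ s in Ioi (0 : ℝ), ‖iteratedDeriv j (fun t => 𝔫.sphericalMean f t n) s‖ₑ ^ 2
    * ENNReal.ofReal (s ^ (2 * j - 1))) ^ (1 / 2 : ℝ)

end TwoStepLieAlgebra

end Homogeneous

end

noncomputable section

set_option linter.unusedSectionVars false

/-! Only the area function of top order `h` is used. For fixed `n` put F(s) = (f * μ_s)(n). Taking
an h-th order difference of F with step u, isolating F(s), and averaging over 0 < u ≤ δs gives
|F(s)| ≤ C (δs)⁻¹ ∫_{s/2}^s |F| dr + C δ^(h-1/2) S^h f(n) for small δ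
(`enorm_le_mean_add_squareFunction`). In polar coordinates the first term is at most Cδ⁻¹ Mf(n) when
f ≥ 0, with M the Hardy-Littlewood maximal function of the gauge balls, which is of weak type (1,1)
by Vitali covering (`exists_volume_maximal_le`).

For f close to the indicator of E, with values in [0, 1], both ‖f‖₁ and ‖f‖₂² are about |E|, so |{𝒜f
> t}| ≤ C|E| ((tδ)⁻¹ + t⁻² δ^(2h-1)). The choice δ = κ t^(1/(2h)) equalizes the two terms, and δ
stays small because t may be assumed less than the mass of μ. This is a restricted weak type
estimate of exponent q = 1 + 1/(2h) (`exists_volume_posMaximal_indicator_le`). Interpolation with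
the trivial L^∞ bound gives L^p for all p > q (`exists_lintegral_rpow_le_of_restricted_weak_type`).
Since q < 2h/(2h-1) and q < 2, every exponent of the theorem is covered.

The maximal function is a supremum over uncountably many radii, so estimates are first proved for
non-negative functions, with outer measure and measurable majorants. Applied to null sets they show
that the means of an L^p class are well defined for almost every n and all s at once; approximation
by continuous functions then gives measurability.

The constant so obtained depends on the algebra and on the bound of its area function. It becomes
uniform because, for fixed dimensions, there are finitely many algebras up to isometric isomorphism
(`exists_finset_structureConstants`), and isometries transport the whole conclusion. In the H-type
case finiteness is rigidity of Clifford representations: nearby ones are equivalent, and the set of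
all of them is compact. -/

lemma TwoStepLieAlgebra.bracket_swap {V Z : Type*} [NormedAddCommGroup V] [InnerProductSpace ℝ V]
    [NormedAddCommGroup Z] [InnerProductSpace ℝ Z] (𝔫 : TwoStepLieAlgebra V Z) (X Y : V) :
    𝔫.bracket X Y = -𝔫.bracket Y X := by
  have h := 𝔫.bracket_self (X + Y)
  simp only [map_add, LinearMap.add_apply, 𝔫.bracket_self, zero_add, add_zero] at h
  exact eq_neg_of_add_eq_zero_right h

/-! ### The group law, the Korányi gauge and the Hardy-Littlewood maximal inequality. -/

section Geometry

variable {V Z : Type*} [NormedAddCommGroup V] [InnerProductSpace ℝ V] [FiniteDimensional ℝ V]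
  [MeasurableSpace V] [BorelSpace V]
  [NormedAddCommGroup Z] [InnerProductSpace ℝ Z] [FiniteDimensional ℝ Z]
  [MeasurableSpace Z] [BorelSpace Z]

instance isAddHaarMeasure_volume_prod : (volume : Measure (V × Z)).IsAddHaarMeasure :=
  inferInstanceAs (Measure.IsAddHaarMeasure ((volume : Measure V).prod (volume : Measure Z)))

lemma continuous_koranyiNorm : Continuous (koranyiNorm : V × Z → ℝ) := by
  unfold koranyiNorm
  exact Continuous.rpow_const (by fun_prop) fun _ => Or.inr (by norm_num)

lemma koranyiNorm_nonneg (n : V × Z) : 0 ≤ koranyiNorm n := by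
  unfold koranyiNorm; positivity

lemma koranyiNorm_pow_four (n : V × Z) : koranyiNorm n ^ 4 = ‖n.1‖ ^ 4 + ‖n.2‖ ^ 2 := by
  unfold koranyiNorm
  rw [← Real.rpow_natCast, ← Real.rpow_mul (by positivity)]; norm_num

lemma koranyiNorm_neg (n : V × Z) : koranyiNorm (-n) = koranyiNorm n := by
  simp [koranyiNorm]

lemma koranyiNorm_zero : koranyiNorm (0 : V × Z) = 0 := by
  simp [koranyiNorm]

lemma norm_fst_le_koranyiNorm (n : V × Z) : ‖n.1‖ ≤ koranyiNorm n := by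
  have h := koranyiNorm_pow_four n
  refine le_of_pow_le_pow_left₀ (n := 4) (by norm_num) (koranyiNorm_nonneg n) ?_
  rw [h]; nlinarith [sq_nonneg ‖n.2‖]

lemma norm_snd_le_koranyiNorm (n : V × Z) : ‖n.2‖ ≤ koranyiNorm n ^ 2 := by
  have h := koranyiNorm_pow_four n
  refine le_of_pow_le_pow_left₀ (n := 2) (by norm_num) (by positivity) ?_
  rw [← pow_mul, h]; nlinarith [pow_nonneg (norm_nonneg n.1) 4]

lemma koranyiNorm_le_of_norm_le {n : V × Z} {R : ℝ} (h1 : ‖n.1‖ ≤ R) (h2 : ‖n.2‖ ≤ R ^ 2) :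
    koranyiNorm n ≤ 2 * R := by
  have hR : 0 ≤ R := (norm_nonneg _).trans h1
  refine le_of_pow_le_pow_left₀ (n := 4) (by norm_num) (by positivity) ?_
  rw [koranyiNorm_pow_four]
  have := pow_le_pow_left₀ (norm_nonneg _) h1 4
  have := pow_le_pow_left₀ (norm_nonneg _) h2 2
  nlinarith [pow_nonneg hR 4]

namespace TwoStepLieAlgebra

variable (𝔫 : TwoStepLieAlgebra V Z)

lemma mul_assoc' (a b c : V × Z) : 𝔫.mul (𝔫.mul a b) c = 𝔫.mul a (𝔫.mul b c) := by
  ext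
  · simp [mul, add_assoc]
  · simp only [mul, map_add, LinearMap.add_apply, smul_add]; abel

lemma neg_mul_self (a : V × Z) : 𝔫.mul (-a) a = 0 := by
  ext <;> simp [mul, 𝔫.bracket_self]

lemma mul_neg_self (a : V × Z) : 𝔫.mul a (-a) = 0 := by
  ext <;> simp [mul, 𝔫.bracket_self]

lemma zero_mul' (a : V × Z) : 𝔫.mul 0 a = a := by
  ext <;> simp [mul]

lemma neg_mul' (a b : V × Z) : -𝔫.mul a b = 𝔫.mul (-b) (-a) := by
  ext
  · simp [mul, add_comm]
  · simp only [mul, Prod.snd_neg, Prod.fst_neg, map_neg, LinearMap.neg_apply, neg_neg,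
      𝔫.bracket_swap b.1 a.1, neg_add, smul_neg]
    abel

lemma exists_norm_bracket_le : ∃ b : ℝ, 0 ≤ b ∧ ∀ X Y, ‖𝔫.bracket X Y‖ ≤ b * ‖X‖ * ‖Y‖ := by
  let T : V →ₗ[ℝ] V →L[ℝ] Z := (LinearMap.toContinuousLinearMap :
    (V →ₗ[ℝ] Z) ≃ₗ[ℝ] (V →L[ℝ] Z)).toLinearMap ∘ₗ 𝔫.bracket
  let T' : V →L[ℝ] V →L[ℝ] Z := LinearMap.toContinuousLinearMap T
  exact ⟨‖T'‖, norm_nonneg T', fun X Y => T'.le_opNorm₂ X Y⟩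

lemma contDiff_bracket {E : Type*} [NormedAddCommGroup E] [NormedSpace ℝ E] {k : WithTop ℕ∞}
    {f g : E → V} (hf : ContDiff ℝ k f) (hg : ContDiff ℝ k g) :
    ContDiff ℝ k fun x => 𝔫.bracket (f x) (g x) := by
  let T : V →ₗ[ℝ] V →L[ℝ] Z := (LinearMap.toContinuousLinearMap :
    (V →ₗ[ℝ] Z) ≃ₗ[ℝ] (V →L[ℝ] Z)).toLinearMap ∘ₗ 𝔫.bracket
  let T' : V →L[ℝ] V →L[ℝ] Z := LinearMap.toContinuousLinearMap T
  exact (T'.contDiff.comp hf).clm_apply hg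

lemma contDiff_mul {E : Type*} [NormedAddCommGroup E] [NormedSpace ℝ E] {k : WithTop ℕ∞}
    {f g : E → V × Z} (hf : ContDiff ℝ k f) (hg : ContDiff ℝ k g) :
    ContDiff ℝ k fun x => 𝔫.mul (f x) (g x) := by
  unfold mul
  exact (hf.fst.add hg.fst).prodMk ((hf.snd.add hg.snd).add
    (contDiff_const.smul (𝔫.contDiff_bracket hf.fst hg.fst)))

lemma continuous_mul' : Continuous fun q : (V × Z) × (V × Z) => 𝔫.mul q.1 q.2 :=
  (𝔫.contDiff_mul (k := 0) contDiff_fst contDiff_snd).continuous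

/-- The bracket is bilinear in the V-components, so its norm is at most c|a||b|, which has the same
homogeneity as the other Z-terms. A quasi-triangle inequality is enough for the covering argument.
-/
lemma exists_koranyiNorm_mul_le :
    ∃ γ : ℝ, 1 ≤ γ ∧ ∀ a b, koranyiNorm (𝔫.mul a b) ≤ γ * (koranyiNorm a + koranyiNorm b) := by
  obtain ⟨c, hc, hb⟩ := 𝔫.exists_norm_bracket_le
  refine ⟨2 * (1 + c), by linarith, fun x y => ?_⟩
  have h0x := koranyiNorm_nonneg x
  have h0y := koranyiNorm_nonneg y
  have h1x := norm_fst_le_koranyiNorm x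
  have h1y := norm_fst_le_koranyiNorm y
  have h2x := norm_snd_le_koranyiNorm x
  have h2y := norm_snd_le_koranyiNorm y
  rw [mul_assoc]
  refine koranyiNorm_le_of_norm_le ?_ ?_
  · calc ‖x.1 + y.1‖ ≤ ‖x.1‖ + ‖y.1‖ := norm_add_le _ _
      _ ≤ 1 * (koranyiNorm x + koranyiNorm y) := by linarith
      _ ≤ _ := by gcongr; linarith
  · have h3 : ‖𝔫.bracket x.1 y.1‖ ≤ c * koranyiNorm x * koranyiNorm y :=
      (hb _ _).trans (by gcongr)
    have h4 : ‖(2⁻¹ : ℝ) • 𝔫.bracket x.1 y.1‖ ≤ c * koranyiNorm x * koranyiNorm y := by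
      rw [norm_smul]; norm_num
      have : 0 ≤ ‖𝔫.bracket x.1 y.1‖ := norm_nonneg _
      linarith
    calc ‖x.2 + y.2 + (2⁻¹ : ℝ) • 𝔫.bracket x.1 y.1‖
        ≤ ‖x.2‖ + ‖y.2‖ + ‖(2⁻¹ : ℝ) • 𝔫.bracket x.1 y.1‖ := norm_add₃_le
      _ ≤ koranyiNorm x ^ 2 + koranyiNorm y ^ 2 + c * koranyiNorm x * koranyiNorm y := by gcongr
      _ ≤ (1 + c) * (koranyiNorm x + koranyiNorm y) ^ 2 := by
        nlinarith [mul_nonneg h0x h0y, mul_nonneg hc (mul_nonneg h0x h0y),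
          mul_nonneg hc (sq_nonneg (koranyiNorm x)), mul_nonneg hc (sq_nonneg (koranyiNorm y))]
      _ ≤ ((1 + c) * (koranyiNorm x + koranyiNorm y)) ^ 2 := by
        rw [mul_pow]; gcongr; nlinarith

/-- Left translation is a skew product: a translation of V and, over each point of V, a translation
of Z. -/
lemma measurePreserving_mul_left (a : V × Z) :
    MeasurePreserving (fun n => 𝔫.mul a n) volume volume := by
  have h : MeasurePreserving (fun p : V × Z => (a.1 + p.1,
      (a.2 + (2⁻¹ : ℝ) • 𝔫.bracket a.1 p.1) + p.2)) (volume.prod volume) (volume.prod volume) := by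
    refine MeasurePreserving.skew_product (f := fun x : V => a.1 + x)
      (g := fun x y => (a.2 + (2⁻¹ : ℝ) • 𝔫.bracket a.1 x) + y)
      (measurePreserving_add_left volume a.1) ?_ ?_
    · have : Continuous (𝔫.bracket a.1) := LinearMap.continuous_of_finiteDimensional _
      refine Continuous.measurable ?_
      unfold Function.uncurry
      fun_prop
    · exact Filter.Eventually.of_forall fun x => map_add_left_eq_self _ _
  have e : (fun n => 𝔫.mul a n) = fun p : V × Z => (a.1 + p.1,
      (a.2 + (2⁻¹ : ℝ) • 𝔫.bracket a.1 p.1) + p.2) := by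
    funext n
    simp only [mul, add_right_comm]
  rw [e]
  exact h

lemma measurePreserving_mul_neg (a : V × Z) :
    MeasurePreserving (fun n => 𝔫.mul a (-n)) volume volume :=
  (𝔫.measurePreserving_mul_left a).comp (Measure.measurePreserving_neg volume)

/-- The ball of radius `r` about `a` for the left-invariant quasi-distance `|m⁻¹ a|`. -/
def gaugeBall (a : V × Z) (r : ℝ) : Set (V × Z) := {m | koranyiNorm (𝔫.mul (-m) a) < r}

lemma isOpen_gaugeBall (a : V × Z) (r : ℝ) : IsOpen (𝔫.gaugeBall a r) :=
  isOpen_lt (continuous_koranyiNorm.comp (𝔫.continuous_mul'.comp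
    (continuous_neg.prodMk continuous_const))) continuous_const

lemma self_mem_gaugeBall (a : V × Z) {r : ℝ} (hr : 0 < r) : a ∈ 𝔫.gaugeBall a r := by
  simpa [gaugeBall, neg_mul_self, koranyiNorm_zero] using hr

lemma koranyiNorm_neg_mul_comm (a b : V × Z) :
    koranyiNorm (𝔫.mul (-a) b) = koranyiNorm (𝔫.mul (-b) a) := by
  rw [← koranyiNorm_neg, neg_mul', neg_neg]

lemma neg_mul_mul_neg_mul (a b c : V × Z) :
    𝔫.mul (𝔫.mul (-a) b) (𝔫.mul (-b) c) = 𝔫.mul (-a) c := by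
  rw [mul_assoc', ← 𝔫.mul_assoc' b, mul_neg_self, zero_mul']

end TwoStepLieAlgebra

lemma volume_koranyiNorm_lt (r : ℝ) (hr : 0 < r) :
    volume {n : V × Z | koranyiNorm n < r}
      = ENNReal.ofReal (r ^ homDim V Z) * volume {n : V × Z | koranyiNorm n < 1} := by
  have hm : MeasurableSet {n : V × Z | koranyiNorm n < 1} :=
    measurableSet_lt measurable_koranyiNorm measurable_const
  have hm' : MeasurableSet {n : V × Z | koranyiNorm n < r} :=
    measurableSet_lt measurable_koranyiNorm measurable_const
  have h := lintegral_dil (V := V) (Z := Z) (inv_pos.2 hr)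
    (g := {n : V × Z | koranyiNorm n < 1}.indicator 1) (measurable_one.indicator hm)
  rw [lintegral_indicator_one hm, inv_pow, inv_inv] at h
  rw [← h, ← lintegral_indicator_one hm']
  refine lintegral_congr fun n => ?_
  simp only [indicator, mem_ofPred_eq, koranyiNorm_dil (inv_pos.2 hr).le]
  have : r⁻¹ * koranyiNorm n < 1 ↔ koranyiNorm n < r := by
    rw [inv_mul_lt_iff₀ hr, mul_one]
  simp [this]

lemma volume_koranyiNorm_lt_one_lt_top : volume {n : V × Z | koranyiNorm n < 1} < ∞ := by
  refine (measure_mono ?_).trans_lt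
    (Metric.isBounded_closedBall (x := (0 : V × Z)) (r := 1)).measure_lt_top
  intro n (hn : koranyiNorm n < 1)
  have h1 := norm_fst_le_koranyiNorm n
  have h2 := norm_snd_le_koranyiNorm n
  have h0 := koranyiNorm_nonneg n
  rw [mem_closedBall_zero_iff, Prod.norm_def]
  exact max_le (by linarith) (by nlinarith)

namespace TwoStepLieAlgebra

variable (𝔫 : TwoStepLieAlgebra V Z)

lemma volume_gaugeBall (a : V × Z) {r : ℝ} (hr : 0 < r) :
    volume (𝔫.gaugeBall a r)
      = ENNReal.ofReal (r ^ homDim V Z) * volume {n : V × Z | koranyiNorm n < 1} := by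
  rw [← volume_koranyiNorm_lt r hr, ← (𝔫.measurePreserving_mul_left (-a)).measure_preimage
    (measurableSet_lt measurable_koranyiNorm measurable_const).nullMeasurableSet]
  congr 1
  ext m
  simp [gaugeBall, 𝔫.koranyiNorm_neg_mul_comm m a]

/-- The weak type `(1, 1)` inequality for the Hardy-Littlewood maximal function of the gauge
balls. -/
theorem exists_volume_maximal_le : ∃ C : ℝ≥0, ∀ (f : V × Z → ℝ≥0∞) (t : ℝ≥0∞), t ≠ 0 →
    volume {n | ∃ r : ℝ, 0 < r ∧
      t * ENNReal.ofReal (r ^ homDim V Z) < ∫⁻ m in 𝔫.gaugeBall n r, f m}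
      ≤ C * t⁻¹ * ∫⁻ m, f m := by
  obtain ⟨γ, hγ, htri⟩ := 𝔫.exists_koranyiNorm_mul_le
  set β := volume {n : V × Z | koranyiNorm n < 1} with hβ
  have hβt : β < ∞ := volume_koranyiNorm_lt_one_lt_top
  set κ : ℝ := 5 * γ ^ 2 with hκ
  have hκ0 : 0 < κ := by positivity
  refine ⟨(ENNReal.ofReal (κ ^ homDim V Z) * β).toNNReal + 1, fun f t ht => ?_⟩
  have hC : ENNReal.ofReal (κ ^ homDim V Z) * β ≠ ∞ := ENNReal.mul_ne_top (by simp) hβt.ne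
  rcases eq_or_ne t ∞ with rfl | htt
  · have : {n : V × Z | ∃ r : ℝ, 0 < r ∧
      ∞ * ENNReal.ofReal (r ^ homDim V Z) < ∫⁻ m in 𝔫.gaugeBall n r, f m} = ∅ := by
      ext n
      simp only [mem_ofPred_eq, mem_empty_iff_false, iff_false, not_exists, not_and, not_lt]
      intro r hr
      rw [ENNReal.top_mul (by simp; positivity)]
      exact le_top
    rw [this]; simp
  rcases eq_or_ne (∫⁻ m, f m) ∞ with hf | hf
  · rw [hf, ENNReal.mul_top]
    · exact le_top
    · simp [htt]
  push_cast
  rw [ENNReal.coe_toNNReal hC]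
  -- If Q = 0, the factor r^Q is 1 and puts no bound on the radii; the space is then a single point
  -- and is treated directly.
  rcases Nat.eq_zero_or_pos (homDim V Z) with hQ | hQ
  · have : Subsingleton (V × Z) := by
      refine (Module.finrank_zero_iff (R := ℝ)).1 ?_
      rw [Module.finrank_prod]; unfold homDim at hQ; omega
    have hβ1 : β = volume (univ : Set (V × Z)) := by
      rw [hβ]; congr 1; ext n
      simp [Subsingleton.elim n 0, koranyiNorm_zero]
    rw [hQ]
    by_cases hS : {n : V × Z | ∃ r : ℝ, 0 < r ∧
      t * ENNReal.ofReal (r ^ 0) < ∫⁻ m in 𝔫.gaugeBall n r, f m} = ∅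
    · rw [hS]; simp
    · obtain ⟨n, r, hr, hn⟩ := nonempty_iff_ne_empty.2 hS
      have h1 : t ≤ ∫⁻ m, f m := by
        simpa using hn.le.trans (setLIntegral_le_lintegral _ _)
      calc _ ≤ β := by rw [hβ1]; exact measure_mono (subset_univ _)
        _ ≤ β * (t⁻¹ * ∫⁻ m, f m) := by
          refine le_mul_of_one_le_right' ?_
          rw [← ENNReal.inv_mul_cancel ht htt]
          gcongr
        _ ≤ _ := by
          rw [mul_assoc]; gcongr; simp
  let S : Set (V × Z) := {n | ∃ r : ℝ, 0 < r ∧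
      t * ENNReal.ofReal (r ^ homDim V Z) < ∫⁻ m in 𝔫.gaugeBall n r, f m}
  choose! ρ hρ0 hρ using fun n (hn : n ∈ S) => hn
  -- Vitali covering needs bounded radii. They are bounded because t ρ^Q < ∫ f < ∞, and ρ ≤ ρ^Q once
  -- ρ > 1.
  obtain ⟨R, hR⟩ : ∃ R : ℝ, ∀ n ∈ S, ρ n ≤ R := by
    refine ⟨max 1 ((∫⁻ m, f m) / t).toReal, fun n hn => ?_⟩
    by_contra! hcon
    have h1 : 1 < ρ n := (le_max_left _ _).trans_lt hcon
    have h2 : ρ n ≤ ρ n ^ homDim V Z := le_self_pow₀ h1.le hQ.ne'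
    have h3 : t * ENNReal.ofReal (ρ n) < ∫⁻ m, f m :=
      lt_of_le_of_lt (by gcongr) ((hρ n hn).trans_le (setLIntegral_le_lintegral _ _))
    have h4 : ENNReal.ofReal (ρ n) ≤ (∫⁻ m, f m) / t := by
      rw [ENNReal.le_div_iff_mul_le (Or.inl ht) (Or.inl htt), mul_comm]; exact h3.le
    have h5 := (ENNReal.ofReal_le_iff_le_toReal (ENNReal.div_ne_top hf ht)).1 h4
    exact absurd ((le_max_right 1 _).trans_lt hcon) (not_lt.2 h5)
  obtain ⟨u, huS, hdisj, hcov⟩ := Vitali.exists_disjoint_subfamily_covering_enlargement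
    (fun n => 𝔫.gaugeBall n (ρ n)) S ρ 2 (by norm_num) (fun n hn => (hρ0 n hn).le) R hR
    (fun n hn => ⟨n, 𝔫.self_mem_gaugeBall n (hρ0 n hn)⟩)
  have hucount : u.Countable := hdisj.countable_of_isOpen
    (fun n _ => 𝔫.isOpen_gaugeBall n _)
    (fun n hn => ⟨n, 𝔫.self_mem_gaugeBall n (hρ0 n (huS hn))⟩)
  -- Only the centres have to be covered. If the balls of a and b meet and ρ a ≤ 2 ρ b, one
  -- quasi-triangle inequality gives |a⁻¹b| < 3γ ρ b, and κ = 5γ² exceeds 3γ since γ ≥ 1.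
  have hsub : S ⊆ ⋃ b ∈ u, 𝔫.gaugeBall b (κ * ρ b) := by
    intro a ha
    obtain ⟨b, hb, ⟨x, hxa, hxb⟩, hab⟩ := hcov a ha
    refine mem_biUnion hb ?_
    have hxa' : koranyiNorm (𝔫.mul (-a) x) < ρ a := by
      rw [koranyiNorm_neg_mul_comm]; exact hxa
    have hxb' : koranyiNorm (𝔫.mul (-x) b) < ρ b := hxb
    have h1 := htri (𝔫.mul (-a) x) (𝔫.mul (-x) b)
    rw [neg_mul_mul_neg_mul] at h1
    change koranyiNorm (𝔫.mul (-a) b) < κ * ρ b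
    have hb0 := hρ0 b (huS hb)
    have h2 : koranyiNorm (𝔫.mul (-a) x) + koranyiNorm (𝔫.mul (-x) b) < 3 * ρ b := by linarith
    calc _ ≤ γ * (koranyiNorm (𝔫.mul (-a) x) + koranyiNorm (𝔫.mul (-x) b)) := h1
      _ < γ * (3 * ρ b) := by gcongr
      _ ≤ 5 * γ ^ 2 * ρ b := by nlinarith [mul_pos (by linarith : 0 < γ) hb0]
  calc volume S ≤ volume (⋃ b ∈ u, 𝔫.gaugeBall b (κ * ρ b)) := measure_mono hsub
    _ ≤ ∑' b : u, volume (𝔫.gaugeBall b (κ * ρ b)) := measure_biUnion_le _ hucount _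
    _ ≤ ∑' b : u, (ENNReal.ofReal (κ ^ homDim V Z) * β) * t⁻¹ *
          ∫⁻ m in 𝔫.gaugeBall b (ρ b), f m := by
      refine ENNReal.tsum_le_tsum fun b => ?_
      have hb0 := hρ0 b (huS b.2)
      rw [𝔫.volume_gaugeBall _ (by positivity), mul_pow, ENNReal.ofReal_mul (by positivity)]
      have h1 : ENNReal.ofReal (ρ b ^ homDim V Z) ≤ t⁻¹ * ∫⁻ m in 𝔫.gaugeBall b (ρ b), f m := by
        rw [mul_comm, ← div_eq_mul_inv, ENNReal.le_div_iff_mul_le (Or.inl ht) (Or.inl htt),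
          mul_comm]
        exact (hρ b (huS b.2)).le
      calc _ = (ENNReal.ofReal (κ ^ homDim V Z) * β) * ENNReal.ofReal (ρ b ^ homDim V Z) := by ring
        _ ≤ (ENNReal.ofReal (κ ^ homDim V Z) * β) *
            (t⁻¹ * ∫⁻ m in 𝔫.gaugeBall b (ρ b), f m) := by gcongr
        _ = _ := by ring
    _ = (ENNReal.ofReal (κ ^ homDim V Z) * β) * t⁻¹ *
          ∫⁻ m in ⋃ b ∈ u, 𝔫.gaugeBall b (ρ b), f m := by
      rw [ENNReal.tsum_mul_left, lintegral_biUnion hucount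
        (fun b _ => (𝔫.isOpen_gaugeBall b _).measurableSet) hdisj]
    _ ≤ _ := by
      gcongr
      · simp
      · exact Measure.restrict_le_self

end TwoStepLieAlgebra

end Geometry

/-! ### Differentiation under an integral over a compactly carried measure. -/

section ParametricIntegral

open scoped ContDiff Topology

variable {E Y F : Type*} [NormedAddCommGroup E] [NormedSpace ℝ E]
  [NormedAddCommGroup Y] [NormedSpace ℝ Y] [MeasurableSpace Y] [BorelSpace Y]
  [SecondCountableTopology Y]
  [NormedAddCommGroup F] [NormedSpace ℝ F]
  {μ : Measure Y} [IsFiniteMeasure μ] {K : Set Y}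

lemma hasDerivAt_integral_of_contDiff (hK : IsCompact K) (hμ : ∀ᵐ y ∂μ, y ∈ K)
    {Ψ : ℝ × E × Y → F} (hΨ : ContDiff ℝ ∞ Ψ) (e : E) (t : ℝ) :
    HasDerivAt (fun t => ∫ y, Ψ (t, e, y) ∂μ) (∫ y, fderiv ℝ Ψ (t, e, y) (1, 0, 0) ∂μ) t := by
  have hΨ' : Continuous fun q : ℝ × E × Y => fderiv ℝ Ψ q (1, 0, 0) :=
    (hΨ.continuous_fderiv (by simp)).clm_apply continuous_const
  have hemb (t : ℝ) : Continuous fun y : Y => (t, e, y) := by fun_prop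
  have hcpt : IsCompact (Icc (t - 1) (t + 1) ×ˢ ({e} : Set E) ×ˢ K) :=
    isCompact_Icc.prod (isCompact_singleton.prod hK)
  obtain ⟨B, hB⟩ := hcpt.exists_bound_of_continuousOn hΨ'.continuousOn
  obtain ⟨B', hB'⟩ := hcpt.exists_bound_of_continuousOn hΨ.continuous.continuousOn
  have ht : Icc (t - 1) (t + 1) ∈ 𝓝 t := Icc_mem_nhds (by linarith) (by linarith)
  refine (hasDerivAt_integral_of_dominated_loc_of_deriv_le (s := Icc (t - 1) (t + 1))
    (F := fun t y => Ψ (t, e, y)) (F' := fun t y => fderiv ℝ Ψ (t, e, y) (1, 0, 0))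
    (bound := fun _ => B) ht ?_ ?_ ?_ ?_ (integrable_const _) ?_).2
  · exact Filter.Eventually.of_forall fun t =>
      (hΨ.continuous.comp (hemb t)).aestronglyMeasurable
  · refine Integrable.of_bound (hΨ.continuous.comp (hemb t)).aestronglyMeasurable B' ?_
    filter_upwards [hμ] with y hy
    exact hB' _ ⟨mem_of_mem_nhds ht, rfl, hy⟩
  · exact (hΨ'.comp (hemb t)).aestronglyMeasurable
  · filter_upwards [hμ] with y hy x hx
    exact hB _ ⟨hx, rfl, hy⟩
  · refine Filter.Eventually.of_forall fun y x _ => ?_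
    have h1 : HasDerivAt (fun x : ℝ => (x, e, y)) ((1 : ℝ), (0 : E), (0 : Y)) x :=
      (hasDerivAt_id x).prodMk ((hasDerivAt_const x e).prodMk (hasDerivAt_const x y))
    exact ((hΨ.differentiable (by simp) _).hasFDerivAt).comp_hasDerivAt x h1

/-- The t-derivative of such an integral is an integral of the same form, with ∂_tΨ in place of Ψ,
so the induction runs over all Ψ. Since Ψj is jointly smooth and does not depend on the parameter e,
the derivatives are jointly continuous in (e, t); this yields the measurability of the area
functions. -/
lemma exists_iteratedDeriv_integral_eq (hK : IsCompact K) (hμ : ∀ᵐ y ∂μ, y ∈ K) (j : ℕ)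
    {Ψ : ℝ × E × Y → F} (hΨ : ContDiff ℝ ∞ Ψ) :
    ∃ Ψj : ℝ × E × Y → F, ContDiff ℝ ∞ Ψj ∧ ∀ e t,
      iteratedDeriv j (fun t => ∫ y, Ψ (t, e, y) ∂μ) t = ∫ y, Ψj (t, e, y) ∂μ := by
  induction j generalizing Ψ with
  | zero => exact ⟨Ψ, hΨ, fun e t => by simp⟩
  | succ j ih =>
    have h1 : ContDiff ℝ ∞ fun q => fderiv ℝ Ψ q (1, 0, 0) :=
      (hΨ.fderiv_right (m := ∞) (by simp)).clm_apply contDiff_const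
    obtain ⟨Ψj, h2, h3⟩ := ih h1
    refine ⟨Ψj, h2, fun e t => ?_⟩
    rw [iteratedDeriv_succ', ← h3]
    congr 1
    funext t
    exact (hasDerivAt_integral_of_contDiff hK hμ hΨ e t).deriv

lemma contDiff_integral_of_contDiff (hK : IsCompact K) (hμ : ∀ᵐ y ∂μ, y ∈ K)
    {Ψ : ℝ × E × Y → F} (hΨ : ContDiff ℝ ∞ Ψ) (e : E) :
    ContDiff ℝ ∞ fun t => ∫ y, Ψ (t, e, y) ∂μ := by
  refine contDiff_of_differentiable_iteratedDeriv fun m _ => ?_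
  obtain ⟨Ψm, h1, h2⟩ := exists_iteratedDeriv_integral_eq hK hμ m hΨ
  rw [funext (h2 e)]
  exact fun t => (hasDerivAt_integral_of_contDiff hK hμ h1 e t).differentiableAt

lemma continuous_integral_of_continuous {X : Type*} [TopologicalSpace X]
    [FirstCountableTopology X] [LocallyCompactSpace X]
    (hK : IsCompact K) (hμ : ∀ᵐ y ∂μ, y ∈ K)
    {Φ : X → Y → F} (hΦ : Continuous Φ.uncurry) :
    Continuous fun x => ∫ y, Φ x y ∂μ := by
  have h := continuous_parametric_integral_of_continuous (μ := μ) hΦ hK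
  rwa [Measure.restrict_eq_self_of_ae_mem hμ] at h

end ParametricIntegral

/-! ### The sphere measure and spherical means. -/

section SphereMeasure

variable {V Z : Type*} [NormedAddCommGroup V] [InnerProductSpace ℝ V] [FiniteDimensional ℝ V]
  [MeasurableSpace V] [BorelSpace V]
  [NormedAddCommGroup Z] [InnerProductSpace ℝ Z] [FiniteDimensional ℝ Z]
  [MeasurableSpace Z] [BorelSpace Z]

open scoped ContDiff

instance isFiniteMeasure_sphereMeasure : IsFiniteMeasure (sphereMeasure V Z) := by
  have : IsFiniteMeasure (volume.restrict
      {n : V × Z | 0 < koranyiNorm n ∧ koranyiNorm n < 1}) :=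
    ⟨by
      rw [Measure.restrict_apply_univ]
      exact (measure_mono fun n hn => hn.2).trans_lt volume_koranyiNorm_lt_one_lt_top⟩
  unfold sphereMeasure
  exact Measure.smul_finite _ (ENNReal.natCast_ne_top _)

lemma ae_koranyiNorm_eq_one : ∀ᵐ n ∂(sphereMeasure V Z), koranyiNorm n = 1 := by
  unfold sphereMeasure
  refine Measure.ae_smul_measure ?_ _
  have hproj : Measurable fun n : V × Z => dil (koranyiNorm n)⁻¹ n :=
    measurable_dil.comp (measurable_koranyiNorm.inv.prodMk measurable_id)
  rw [ae_map_iff hproj.aemeasurable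
    (measurableSet_eq_fun measurable_koranyiNorm measurable_const)]
  refine ae_restrict_of_forall_mem ((measurableSet_lt measurable_const
    measurable_koranyiNorm).inter (measurableSet_lt measurable_koranyiNorm measurable_const)) ?_
  intro n hn
  rw [koranyiNorm_dil (inv_pos.2 hn.1).le, inv_mul_cancel₀ hn.1.ne']

lemma ae_mem_closedBall_sphereMeasure :
    ∀ᵐ n ∂(sphereMeasure V Z), n ∈ Metric.closedBall (0 : V × Z) 1 := by
  filter_upwards [ae_koranyiNorm_eq_one (V := V) (Z := Z)] with n hn
  have h1 := norm_fst_le_koranyiNorm n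
  have h2 := norm_snd_le_koranyiNorm n
  rw [mem_closedBall_zero_iff, Prod.norm_def]
  rw [hn] at h1 h2
  exact max_le h1 (by simpa using h2)

lemma contDiff_dil {E : Type*} [NormedAddCommGroup E] [NormedSpace ℝ E] {k : WithTop ℕ∞}
    {f : E → ℝ} {g : E → V × Z} (hf : ContDiff ℝ k f) (hg : ContDiff ℝ k g) :
    ContDiff ℝ k fun x => dil (f x) (g x) :=
  (hf.smul hg.fst).prodMk ((hf.pow 2).smul hg.snd)

namespace TwoStepLieAlgebra

variable (𝔫 : TwoStepLieAlgebra V Z)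

lemma contDiff_mul_neg_dil {k : WithTop ℕ∞} : ContDiff ℝ k
    fun q : ℝ × (V × Z) × (V × Z) => 𝔫.mul q.2.1 (-dil q.1 q.2.2) :=
  𝔫.contDiff_mul contDiff_snd.fst (contDiff_dil contDiff_fst contDiff_snd.snd).neg

lemma continuous_mul_neg_dil :
    Continuous fun q : ℝ × (V × Z) × (V × Z) => 𝔫.mul q.2.1 (-dil q.1 q.2.2) :=
  (𝔫.contDiff_mul_neg_dil (k := 0)).continuous

lemma measurable_mul_neg_dil (s : ℝ) (n : V × Z) :
    Measurable fun n' : V × Z => 𝔫.mul n (-dil s n') :=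
  (𝔫.continuous_mul_neg_dil.comp (by fun_prop : Continuous fun n' => (s, n, n'))).measurable

lemma contDiff_sphericalMean {f : V × Z → ℂ} (hf : ContDiff ℝ ∞ f) (n : V × Z) :
    ContDiff ℝ ∞ fun t => 𝔫.sphericalMean f t n :=
  contDiff_integral_of_contDiff (isCompact_closedBall (0 : V × Z) 1)
    ae_mem_closedBall_sphereMeasure (hf.comp 𝔫.contDiff_mul_neg_dil) n

lemma measurable_areaFunction {f : V × Z → ℂ} (hf : ContDiff ℝ ∞ f) (j : ℕ) :
    Measurable (𝔫.areaFunction j f) := by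
  obtain ⟨Ψ, h1, h2⟩ := exists_iteratedDeriv_integral_eq (isCompact_closedBall (0 : V × Z) 1)
    ae_mem_closedBall_sphereMeasure j (hf.comp 𝔫.contDiff_mul_neg_dil)
  have h3 : Continuous fun x : (V × Z) × ℝ => ∫ y, Ψ (x.2, x.1, y) ∂(sphereMeasure V Z) :=
    continuous_integral_of_continuous (isCompact_closedBall (0 : V × Z) 1)
      ae_mem_closedBall_sphereMeasure (Φ := fun (x : (V × Z) × ℝ) y => Ψ (x.2, x.1, y))
      (h1.continuous.comp (by fun_prop))
  have h4 (n : V × Z) (s : ℝ) : iteratedDeriv j (fun t => 𝔫.sphericalMean f t n) s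
      = ∫ y, Ψ (s, n, y) ∂(sphereMeasure V Z) := h2 n s
  unfold areaFunction
  simp only [h4]
  refine Measurable.pow_const (Measurable.lintegral_prod_right' (f := fun x : (V × Z) × ℝ =>
    ‖∫ y, Ψ (x.2, x.1, y) ∂(sphereMeasure V Z)‖ₑ ^ 2 * ENNReal.ofReal (x.2 ^ (2 * j - 1))) ?_) _
  exact (h3.measurable.enorm.pow_const 2).mul (by fun_prop)

/-- The spherical mean of a non-negative function, as a Lebesgue integral. -/
def posMean (f : V × Z → ℝ≥0∞) (s : ℝ) (n : V × Z) : ℝ≥0∞ :=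
  ∫⁻ n', f (𝔫.mul n (-dil s n')) ∂(sphereMeasure V Z)

/-- The spherical maximal function of a non-negative function. -/
def posMaximal (f : V × Z → ℝ≥0∞) (n : V × Z) : ℝ≥0∞ := ⨆ s : ℝ, ⨆ _ : 0 < s, 𝔫.posMean f s n

lemma posMean_le_posMaximal (f : V × Z → ℝ≥0∞) {s : ℝ} (hs : 0 < s) (n : V × Z) :
    𝔫.posMean f s n ≤ 𝔫.posMaximal f n :=
  le_iSup₂ (f := fun s (_ : 0 < s) => 𝔫.posMean f s n) s hs

/-- Polar coordinates about n: the spheres of radii in (s/2, s] lie in the ball of radius 2s, and on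
them r^(Q-1) ≥ (s/2)^(Q-1). The radius 2s leaves room, since the gauge ball is open and r = s
occurs. -/
lemma mul_lintegral_posMean_le (hQ : 0 < homDim V Z) {f : V × Z → ℝ≥0∞} (hf : Measurable f)
    {s : ℝ} (hs : 0 < s) (n : V × Z) :
    ENNReal.ofReal ((s / 2) ^ (homDim V Z - 1)) * ∫⁻ r in Ioc (s / 2) s, 𝔫.posMean f r n
      ≤ ∫⁻ m in 𝔫.gaugeBall n (2 * s), f m := by
  have hmp := 𝔫.measurePreserving_mul_neg n
  have hbm : MeasurableSet (𝔫.gaugeBall n (2 * s)) := (𝔫.isOpen_gaugeBall n _).measurableSet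
  have hgm : Measurable ((𝔫.gaugeBall n (2 * s)).indicator f) := hf.indicator hbm
  have hmem (n' : V × Z) : 𝔫.mul n (-n') ∈ 𝔫.gaugeBall n (2 * s) ↔ koranyiNorm n' < 2 * s := by
    simp only [gaugeBall, mem_ofPred_eq, neg_mul', neg_neg, mul_assoc', neg_mul_self]
    simp [mul]
  rw [← lintegral_indicator hbm, ← hmp.lintegral_comp hgm,
    lintegral_polar hQ (g := fun n' => (𝔫.gaugeBall n (2 * s)).indicator f (𝔫.mul n (-n')))
      (hgm.comp hmp.measurable)]
  calc _ = ∫⁻ r in Ioc (s / 2) s, 𝔫.posMean f r n *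
        ENNReal.ofReal ((s / 2) ^ (homDim V Z - 1)) := by
        rw [lintegral_mul_const', mul_comm]; simp
    _ ≤ ∫⁻ r in Ioc (s / 2) s, (∫⁻ n', (𝔫.gaugeBall n (2 * s)).indicator f
          (𝔫.mul n (-dil r n')) ∂(sphereMeasure V Z)) * ENNReal.ofReal (r ^ (homDim V Z - 1)) := by
        refine setLIntegral_mono' measurableSet_Ioc fun r hr => ?_
        have hr0 : 0 < r := by linarith [hr.1]
        refine mul_le_mul' (lintegral_mono_ae ?_) (ENNReal.ofReal_le_ofReal (by
          gcongr; exact hr.1.le))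
        filter_upwards [ae_koranyiNorm_eq_one (V := V) (Z := Z)] with n' hn'
        rw [indicator_of_mem]
        rw [hmem, koranyiNorm_dil hr0.le, hn']
        linarith [hr.2]
    _ ≤ _ := lintegral_mono_set fun r hr => lt_trans (by positivity) hr.1

end TwoStepLieAlgebra

end SphereMeasure

/-! ### Pointwise control of a function by its mean and a square function. -/

section FiniteDifferences

open scoped ContDiff

variable {F : ℝ → ℂ}

lemma hasDerivAt_fwdDiff_iterate (hF : ContDiff ℝ ∞ F) (u : ℝ) (k : ℕ) (x : ℝ) :
    HasDerivAt ((fwdDiff u)^[k] F) ((fwdDiff u)^[k] (deriv F) x) x := by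
  induction k generalizing x with
  | zero => exact (hF.differentiable (by simp) x).hasDerivAt
  | succ k ih =>
    rw [Function.iterate_succ_apply', Function.iterate_succ_apply']
    exact ((ih (x + u)).comp_add_const x u).sub (ih x)

/-- Differences commute with differentiation, so one further difference costs a factor u times the
supremum over [x, x + u] of the differences of F'. For base points there, the integration windows
stay inside [x, x + (k + 2)u]. -/
lemma norm_fwdDiff_iterate_le (k : ℕ) (hF : ContDiff ℝ ∞ F) {u : ℝ} (hu : 0 ≤ u) (x : ℝ) :
    ‖(fwdDiff u)^[k + 1] F x‖ ≤
      u ^ k * ∫ y in x..x + (k + 1) * u, ‖iteratedDeriv (k + 1) F y‖ := by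
  induction k generalizing F x with
  | zero =>
    have h1 : ∫ y in x..x + u, deriv F y = F (x + u) - F x :=
      intervalIntegral.integral_deriv_eq_sub (fun y _ => hF.differentiable (by simp) y)
        ((hF.continuous_deriv (by simp)).intervalIntegrable _ _)
    simp only [zero_add, Function.iterate_one, pow_zero, one_mul, iteratedDeriv_one, fwdDiff,
      Nat.cast_zero]
    rw [← h1]
    exact intervalIntegral.norm_integral_le_integral_norm (by linarith)
  | succ k ih =>
    have hF' : ContDiff ℝ ∞ (deriv F) := (contDiff_infty_iff_deriv.1 hF).2
    have hc : Continuous fun y => ‖iteratedDeriv (k + 1 + 1) F y‖ :=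
      (hF.continuous_iteratedDeriv _ (by exact_mod_cast le_top)).norm
    set B := u ^ k * ∫ y in x..x + ((k + 1 : ℕ) + 1) * u, ‖iteratedDeriv (k + 1 + 1) F y‖ with hB
    have h1 : ∀ y ∈ Icc x (x + u), ‖(fwdDiff u)^[k + 1] (deriv F) y‖ ≤ B := by
      intro y hy
      refine (ih hF' y).trans ?_
      rw [← iteratedDeriv_succ', hB]
      gcongr
      refine intervalIntegral.integral_mono_interval hy.1 (by nlinarith) ?_
        (Filter.Eventually.of_forall fun _ => norm_nonneg _) (hc.intervalIntegrable _ _)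
      push_cast
      nlinarith [hy.2]
    have h2 := norm_image_sub_le_of_norm_deriv_le_segment'
      (f := (fwdDiff u)^[k + 1] F) (f' := fun y => (fwdDiff u)^[k + 1] (deriv F) y) (a := x) (b := x + u)
      (fun y _ => (hasDerivAt_fwdDiff_iterate hF u (k + 1) y).hasDerivWithinAt)
      (fun y hy => h1 y ⟨hy.1, hy.2.le⟩) (x + u) ⟨by linarith, le_rfl⟩
    rw [Function.iterate_succ_apply']
    refine h2.trans (le_of_eq ?_)
    rw [hB]; ring

/-- The difference of order k + 1 is based at s - (k + 1)u, so that F(s) is its last term, with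
coefficient 1. The other nodes lie to the left of s at distances u, …, (k + 1)u, and can therefore
be averaged in u. -/
lemma enorm_le_sum_add_lintegral (k : ℕ) (hF : ContDiff ℝ ∞ F) {u : ℝ} (hu : 0 ≤ u) (s : ℝ) :
    ‖F s‖ₑ ≤ ∑ i ∈ Finset.range (k + 1), ((k + 1).choose i : ℝ≥0∞) *
        ‖F (s - ((k + 1 : ℕ) - i) * u)‖ₑ
      + ENNReal.ofReal (u ^ k) *
        ∫⁻ y in Ioc (s - (k + 1 : ℕ) * u) s, ‖iteratedDeriv (k + 1) F y‖ₑ := by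
  have hc : Continuous fun y => iteratedDeriv (k + 1) F y :=
    hF.continuous_iteratedDeriv _ (by exact_mod_cast le_top)
  set x := s - (k + 1 : ℕ) * u with hx
  have h1 := norm_fwdDiff_iterate_le k hF hu x
  have h2 := fwdDiff_iter_eq_sum_shift u F (k + 1) x
  rw [Finset.sum_range_succ] at h2
  have hs : x + (k + 1 : ℕ) • u = s := by rw [hx, nsmul_eq_mul]; ring
  rw [hs] at h2
  simp only [Nat.sub_self, pow_zero, Nat.choose_self, Nat.cast_one, mul_one, one_smul] at h2
  have h3 : F s = (fwdDiff u)^[k + 1] F x - ∑ i ∈ Finset.range (k + 1),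
      ((-1 : ℤ) ^ (k + 1 - i) * (k + 1).choose i) • F (x + i • u) := by
    rw [h2]; ring
  rw [h3]
  refine (enorm_sub_le).trans ((add_le_add ?_ ?_).trans_eq (add_comm _ _))
  · rw [← ofReal_norm]
    refine (ENNReal.ofReal_le_ofReal h1).trans (le_of_eq ?_)
    rw [ENNReal.ofReal_mul (by positivity)]
    congr 1
    have hxs : x + (k + 1) * u = s := by rw [hx]; push_cast; ring
    have hle : x ≤ s := by rw [← hxs]; nlinarith
    rw [hxs, intervalIntegral.integral_of_le hle, ofReal_integral_norm_eq_lintegral_enorm]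
    exact hc.integrableOn_Ioc
  · refine (enorm_sum_le _ _).trans (Finset.sum_le_sum fun i _ => ?_)
    have hxi : x + i • u = s - ((k + 1 : ℕ) - i) * u := by rw [hx, nsmul_eq_mul]; ring
    rw [hxi, zsmul_eq_mul, enorm_mul]
    refine mul_le_mul' (le_of_eq ?_) le_rfl
    rw [← ofReal_norm]
    push_cast
    simp

/-- The substitution r = s - cu has Jacobian 1/c ≤ 1 and stays in (s/2, s]. -/
lemma lintegral_Ioc_comp_sub_mul_le {g : ℝ → ℝ≥0∞} (hg : Measurable g) {s δ c : ℝ}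
    (hc : 1 ≤ c) (hδ : c * δ < s / 2) :
    ∫⁻ u in Ioc 0 δ, g (s - c * u) ≤ ∫⁻ r in Ioc (s / 2) s, g r := by
  have hc0 : 0 < c := by linarith
  set G := (Ioc (s / 2) s).indicator g with hG
  have hGm : Measurable G := hg.indicator measurableSet_Ioc
  have hm : Measurable fun y => G (s - y) := by fun_prop
  calc ∫⁻ u in Ioc 0 δ, g (s - c * u) ≤ ∫⁻ u in Ioc 0 δ, G (s - c * u) := by
        refine setLIntegral_mono' measurableSet_Ioc fun u hu => ?_
        rw [hG, indicator_of_mem]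
        constructor <;> nlinarith [hu.1, hu.2]
    _ ≤ ∫⁻ u, G (s - c * u) := setLIntegral_le_lintegral _ _
    _ = ENNReal.ofReal |c⁻¹| * ∫⁻ r, G r := by
        rw [← lintegral_sub_left_eq_self G s, ← smul_eq_mul, ← lintegral_smul_measure,
          ← Real.map_volume_mul_left hc0.ne', lintegral_map hm (by fun_prop)]
    _ ≤ 1 * ∫⁻ r, G r := by
        gcongr
        rw [abs_of_pos (by positivity)]
        simpa using inv_le_one_of_one_le₀ hc
    _ = _ := by rw [one_mul, hG, lintegral_indicator measurableSet_Ioc]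

lemma sq_lintegral_le_volume_mul {g : ℝ → ℝ≥0∞} (hg : Measurable g) (I : Set ℝ) :
    (∫⁻ r in I, g r) ^ 2 ≤ volume I * ∫⁻ r in I, g r ^ 2 := by
  have h := ENNReal.lintegral_mul_le_Lp_mul_Lq (volume.restrict I)
    Real.HolderConjugate.two_two (f := fun _ => 1) (g := g) aemeasurable_const hg.aemeasurable
  simp only [Pi.mul_apply, one_mul, ENNReal.one_rpow, lintegral_const,
    Measure.restrict_apply_univ] at h
  calc _ ≤ (volume I ^ (1 / 2 : ℝ) * (∫⁻ r in I, g r ^ (2 : ℝ)) ^ (1 / 2 : ℝ)) ^ 2 := by gcongr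
    _ = _ := by
      rw [mul_pow, ← ENNReal.rpow_natCast, ← ENNReal.rpow_natCast, ← ENNReal.rpow_mul,
        ← ENNReal.rpow_mul]
      norm_num

/-- A smooth function is controlled by its mean over `(s / 2, s]` and a weighted square function
of its derivative of order `h`; the parameter `δ` balances the two terms. -/
lemma enorm_le_mean_add_squareFunction {h : ℕ} (hh : 1 ≤ h) (hF : ContDiff ℝ ∞ F) {s δ : ℝ}
    (hs : 0 < s) (hδ : 0 < δ) (hhδ : h * δ < 1 / 2) :
    ‖F s‖ₑ ≤ ENNReal.ofReal (2 ^ h / (δ * s)) * (∫⁻ r in Ioc (s / 2) s, ‖F r‖ₑ)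
      + (ENNReal.ofReal (h * (2 * δ) ^ (2 * h - 1)) *
        ∫⁻ r in Ioi (0 : ℝ), ‖iteratedDeriv h F r‖ₑ ^ 2 * ENNReal.ofReal (r ^ (2 * h - 1)))
          ^ (1 / 2 : ℝ) := by
  obtain ⟨k, rfl⟩ : ∃ k, h = k + 1 := ⟨h - 1, by omega⟩
  have hc : Continuous fun y => iteratedDeriv (k + 1) F y :=
    hF.continuous_iteratedDeriv _ (by exact_mod_cast le_top)
  have hFm : Measurable fun r => ‖F r‖ₑ := hF.continuous.measurable.enorm
  have hδs : 0 < δ * s := by positivity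
  have hkδ : ((k + 1 : ℕ) : ℝ) * (δ * s) < s / 2 := by nlinarith
  set X := ENNReal.ofReal ((δ * s) ^ k) *
    ∫⁻ y in Ioc (s - (k + 1 : ℕ) * (δ * s)) s, ‖iteratedDeriv (k + 1) F y‖ₑ with hX
  set I := ∫⁻ r in Ioi (0 : ℝ), ‖iteratedDeriv (k + 1) F r‖ₑ ^ 2 *
    ENNReal.ofReal (r ^ (2 * (k + 1) - 1)) with hI
  set A := ∫⁻ r in Ioc (s / 2) s, ‖F r‖ₑ with hA
  -- Cauchy-Schwarz on an interval of length hδs, on which r ≥ s/2. The powers of s cancel: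
  -- (δs)^(2h-2) · hδs · (s/2)^(-(2h-1)) = h(2δ)^(2h-1).
  have hXI : X ≤ (ENNReal.ofReal ((k + 1 : ℕ) * (2 * δ) ^ (2 * (k + 1) - 1)) * I)
      ^ (1 / 2 : ℝ) := by
    rw [← ENNReal.rpow_inv_le_iff (by norm_num)]
    norm_num
    have h1 : ∫⁻ y in Ioc (s - (k + 1 : ℕ) * (δ * s)) s, ‖iteratedDeriv (k + 1) F y‖ₑ ^ 2
        ≤ ENNReal.ofReal (((s / 2) ^ (2 * (k + 1) - 1))⁻¹) * I := by
      rw [hI, ← lintegral_const_mul' _ _ (by simp)]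
      refine (lintegral_mono_set (s := Ioc (s - (k + 1 : ℕ) * (δ * s)) s) (t := Ioi 0)
        fun r hr => ?_).trans' ?_
      · exact lt_of_le_of_lt (by linarith) hr.1
      · refine setLIntegral_mono' measurableSet_Ioc fun r hr => ?_
        have hr' : s / 2 ≤ r := by linarith [hr.1]
        rw [mul_left_comm, ← ENNReal.ofReal_mul (by positivity)]
        refine le_mul_of_one_le_right' ?_
        rw [← ENNReal.ofReal_one]
        refine ENNReal.ofReal_le_ofReal ?_
        rw [le_inv_mul_iff₀ (by positivity), mul_one]
        gcongr
    rw [hX, mul_pow]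
    calc _ ≤ ENNReal.ofReal ((δ * s) ^ k) ^ 2 * (ENNReal.ofReal ((k + 1 : ℕ) * (δ * s)) *
          (ENNReal.ofReal (((s / 2) ^ (2 * (k + 1) - 1))⁻¹) * I)) := by
          gcongr
          refine (sq_lintegral_le_volume_mul hc.measurable.enorm _).trans ?_
          gcongr
          rw [Real.volume_Ioc]
          simp
      _ = _ := by
          rw [← mul_assoc, ← mul_assoc, ← ENNReal.ofReal_pow (by positivity),
            ← ENNReal.ofReal_mul (by positivity), ← ENNReal.ofReal_mul (by positivity)]
          congr 2
          have e : 2 * (k + 1) - 1 = 2 * k + 1 := by omega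
          rw [e, div_pow]
          push_cast
          field_simp
          ring
  -- Integration over the step u in (0, δs]. The remainder is largest at u = δs, and the binomial
  -- coefficients add up to at most 2^h.
  have hmain : ENNReal.ofReal (δ * s) * ‖F s‖ₑ
      ≤ 2 ^ (k + 1) * A + ENNReal.ofReal (δ * s) * X := by
    calc ENNReal.ofReal (δ * s) * ‖F s‖ₑ = ∫⁻ u in Ioc 0 (δ * s), ‖F s‖ₑ := by
          rw [lintegral_const, Measure.restrict_apply_univ, Real.volume_Ioc, sub_zero, mul_comm]
      _ ≤ ∫⁻ u in Ioc 0 (δ * s), (∑ i ∈ Finset.range (k + 1), ((k + 1).choose i : ℝ≥0∞) *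
            ‖F (s - ((k + 1 : ℕ) - i) * u)‖ₑ + X) := by
          refine setLIntegral_mono' measurableSet_Ioc fun u hu => ?_
          refine (enorm_le_sum_add_lintegral k hF hu.1.le s).trans (add_le_add le_rfl ?_)
          rw [hX]
          refine mul_le_mul' (ENNReal.ofReal_le_ofReal ?_) (lintegral_mono_set ?_)
          · have := hu.1.le; have := hu.2
            gcongr
          · refine Ioc_subset_Ioc_left ?_
            have := hu.2
            gcongr
      _ = ∑ i ∈ Finset.range (k + 1), ((k + 1).choose i : ℝ≥0∞) *
            (∫⁻ u in Ioc 0 (δ * s), ‖F (s - ((k + 1 : ℕ) - i) * u)‖ₑ)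
            + ENNReal.ofReal (δ * s) * X := by
          have hmi (i : ℕ) : Measurable fun u : ℝ => ‖F (s - ((k + 1 : ℕ) - i) * u)‖ₑ :=
            hFm.comp (by fun_prop)
          rw [lintegral_add_right _ measurable_const, lintegral_finsetSum _
            (fun i _ => (hmi i).const_mul _), lintegral_const, Measure.restrict_apply_univ,
            Real.volume_Ioc, sub_zero, mul_comm X]
          simp only [lintegral_const_mul _ (hmi _)]
      _ ≤ ∑ i ∈ Finset.range (k + 1), ((k + 1).choose i : ℝ≥0∞) * A
            + ENNReal.ofReal (δ * s) * X := by
          gcongr with i hi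
          have hi' : (i : ℝ) + 1 ≤ (k + 1 : ℕ) := by
            exact_mod_cast Finset.mem_range.1 hi
          have hi0 : (0 : ℝ) ≤ i := by positivity
          exact lintegral_Ioc_comp_sub_mul_le hFm (by linarith) (by nlinarith)
      _ ≤ 2 ^ (k + 1) * A + ENNReal.ofReal (δ * s) * X := by
          rw [← Finset.sum_mul]
          gcongr
          have h1 := Nat.sum_range_choose (k + 1)
          rw [Finset.sum_range_succ] at h1
          have h2 : ∑ i ∈ Finset.range (k + 1), (k + 1).choose i ≤ 2 ^ (k + 1) := by omega
          exact_mod_cast h2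
  have h0 : ENNReal.ofReal (δ * s) ≠ 0 := by simpa using hδs
  calc ‖F s‖ₑ = (ENNReal.ofReal (δ * s))⁻¹ * (ENNReal.ofReal (δ * s) * ‖F s‖ₑ) := by
        rw [← mul_assoc, ENNReal.inv_mul_cancel h0 (by simp), one_mul]
    _ ≤ (ENNReal.ofReal (δ * s))⁻¹ * (2 ^ (k + 1) * A + ENNReal.ofReal (δ * s) * X) := by gcongr
    _ = ENNReal.ofReal (2 ^ (k + 1) / (δ * s)) * A + X := by
        rw [mul_add, ← mul_assoc, ← mul_assoc, ENNReal.inv_mul_cancel h0 (by simp), one_mul,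
          ENNReal.ofReal_div_of_pos hδs, ENNReal.ofReal_pow (by norm_num), div_eq_mul_inv,
          mul_comm (ENNReal.ofReal (δ * s))⁻¹]
        norm_num
    _ ≤ _ := add_le_add (le_refl (ENNReal.ofReal (2 ^ (k + 1) / (δ * s)) * A)) hXI

end FiniteDifferences

/-! ### The restricted weak type estimate. -/

section RestrictedWeakType

open scoped ContDiff

variable {V Z : Type*} [NormedAddCommGroup V] [InnerProductSpace ℝ V] [FiniteDimensional ℝ V]
  [MeasurableSpace V] [BorelSpace V]
  [NormedAddCommGroup Z] [InnerProductSpace ℝ Z] [FiniteDimensional ℝ Z]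
  [MeasurableSpace Z] [BorelSpace Z]

namespace TwoStepLieAlgebra

variable (𝔫 : TwoStepLieAlgebra V Z)

lemma enorm_sphericalMean_le_posMean (f : V × Z → ℂ) (s : ℝ) (n : V × Z) :
    ‖𝔫.sphericalMean f s n‖ₑ ≤ 𝔫.posMean (fun m => ‖f m‖ₑ) s n :=
  enorm_integral_le_lintegral_enorm _

lemma posMean_mono {f g : V × Z → ℝ≥0∞} (h : ∀ m, f m ≤ g m) (s : ℝ) (n : V × Z) :
    𝔫.posMean f s n ≤ 𝔫.posMean g s n :=
  lintegral_mono fun _ => h _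

lemma posMaximal_mono {f g : V × Z → ℝ≥0∞} (h : ∀ m, f m ≤ g m) (n : V × Z) :
    𝔫.posMaximal f n ≤ 𝔫.posMaximal g n :=
  iSup₂_mono fun s _ => 𝔫.posMean_mono h s n

lemma posMaximal_const (c : ℝ≥0∞) (n : V × Z) :
    𝔫.posMaximal (fun _ => c) n ≤ c * sphereMeasure V Z univ :=
  iSup₂_le fun s _ => by simp [posMean]

lemma posMean_ofReal_eq_enorm {φ : V × Z → ℝ} (hc : Continuous φ) (h0 : ∀ m, 0 ≤ φ m)
    (s : ℝ) (n : V × Z) :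
    𝔫.posMean (fun m => ENNReal.ofReal (φ m)) s n
      = ‖𝔫.sphericalMean (fun m => (φ m : ℂ)) s n‖ₑ := by
  have hcont : Continuous fun n' => φ (𝔫.mul n (-dil s n')) :=
    hc.comp (𝔫.continuous_mul_neg_dil.comp (by fun_prop : Continuous fun n' => (s, n, n')))
  have hint : Integrable (fun n' => φ (𝔫.mul n (-dil s n'))) (sphereMeasure V Z) := by
    obtain ⟨B, hB⟩ := (isCompact_closedBall (0 : V × Z) 1).exists_bound_of_continuousOn
      hcont.continuousOn
    refine Integrable.of_bound hcont.aestronglyMeasurable B ?_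
    filter_upwards [ae_mem_closedBall_sphereMeasure (V := V) (Z := Z)] with y hy using hB y hy
  have h1 : 𝔫.sphericalMean (fun m => (φ m : ℂ)) s n
      = ((∫ n', φ (𝔫.mul n (-dil s n')) ∂(sphereMeasure V Z) : ℝ) : ℂ) := by
    rw [sphericalMean]
    exact integral_ofReal
  rw [h1, ← ofReal_norm, Complex.norm_real,
    Real.norm_of_nonneg (integral_nonneg fun _ => h0 _),
    ofReal_integral_eq_lintegral_ofReal hint (Filter.Eventually.of_forall fun _ => h0 _)]
  rfl

/-- The spherical maximal function of a smooth function with values in `[0, 1]` satisfies the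
weak type estimate of exponent `1 + 1 / (2h)` if the area function `S^h` is bounded on `L²`. -/
lemma exists_volume_posMaximal_le_of_contDiff (hQ : 0 < homDim V Z) {h : ℕ} (hh : 1 ≤ h)
    {K : ℝ≥0} (hK : ∀ f : 𝓢(V × Z, ℂ),
      eLpNorm (𝔫.areaFunction h f) 2 volume ≤ K * eLpNorm f 2 volume) :
    ∃ C : ℝ≥0, ∀ (φ : V × Z → ℝ), ContDiff ℝ ∞ φ → HasCompactSupport φ → (∀ m, 0 ≤ φ m) →
      (∀ m, φ m ≤ 1) → ∀ t : ℝ, 0 < t →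
      volume {n | ENNReal.ofReal t < 𝔫.posMaximal (fun m => ENNReal.ofReal (φ m)) n}
        ≤ C * ENNReal.ofReal (t ^ (-(1 + 1 / (2 * h) : ℝ))) * ∫⁻ m, ENNReal.ofReal (φ m) := by
  obtain ⟨CM, hCM⟩ := 𝔫.exists_volume_maximal_le
  set c₀ : ℝ := (sphereMeasure V Z univ).toReal with hc₀
  set Q := homDim V Z with hQdef
  have hh' : (1 : ℝ) ≤ h := by exact_mod_cast hh
  -- Makes δ = κ t^(1/(2h)) at most 1/(4h) for t < c₀, as the difference argument requires hδ < 1/2.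
  set κ : ℝ := (4 * h : ℝ)⁻¹ / c₀ ^ (1 / (2 * h) : ℝ) with hκ
  set C₁ : ℝ := CM * (4 ^ Q * 2 ^ h) / κ with hC₁
  set C₂ : ℝ := K ^ 2 * (4 * (h * (2 * κ) ^ (2 * h - 1))) with hC₂
  refine ⟨C₁.toNNReal + C₂.toNNReal, fun φ hφ hφc h0 h1 t ht => ?_⟩
  have hle : ∀ n, 𝔫.posMaximal (fun m => ENNReal.ofReal (φ m)) n ≤ ENNReal.ofReal c₀ := by
    intro n
    rw [hc₀, ENNReal.ofReal_toReal (measure_ne_top _ _)]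
    refine (𝔫.posMaximal_mono (g := fun _ => 1) (fun m => ?_) n).trans ?_
    · simpa using h1 m
    · simpa using 𝔫.posMaximal_const 1 n
  -- Means of a function bounded by 1 do not exceed the mass c₀ of μ, so larger t give the empty
  -- set.
  rcases le_or_gt c₀ t with hct | hct
  · have : {n | ENNReal.ofReal t < 𝔫.posMaximal (fun m => ENNReal.ofReal (φ m)) n} = ∅ := by
      ext n
      simpa using (hle n).trans (ENNReal.ofReal_le_ofReal hct)
    rw [this]; simp
  have hc0 : 0 < c₀ := ht.trans hct
  have hκ0 : 0 < κ := by positivity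
  set a : ℝ := t ^ (1 / (2 * h) : ℝ) with ha
  have ha0 : 0 < a := by positivity
  have hapow : a ^ (2 * h) = t := by
    rw [ha, ← Real.rpow_natCast, ← Real.rpow_mul ht.le]
    push_cast
    rw [one_div_mul_cancel (by positivity), Real.rpow_one]
  have hweight : t ^ (-(1 + 1 / (2 * h) : ℝ)) = (t * a)⁻¹ := by
    rw [Real.rpow_neg ht.le, Real.rpow_add ht, Real.rpow_one]
  -- The balancing choice: with a^(2h) = t, both (tδ)⁻¹ and t⁻² δ^(2h-1) are multiples of (ta)⁻¹ =
  -- t^(-(1 + 1/(2h))).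
  set δ : ℝ := κ * a with hδ
  have hδ0 : 0 < δ := by positivity
  have hhδ : h * δ < 1 / 2 := by
    have h2 : a ≤ c₀ ^ (1 / (2 * h) : ℝ) :=
      Real.rpow_le_rpow ht.le hct.le (by positivity)
    have h3 : δ ≤ (4 * h : ℝ)⁻¹ := by
      rw [hδ, hκ, div_mul_eq_mul_div, div_le_iff₀ (by positivity)]
      gcongr
    have h4 : (h : ℝ) * (4 * h : ℝ)⁻¹ = 1 / 4 := by field_simp
    nlinarith
  set f : 𝓢(V × Z, ℂ) := HasCompactSupport.toSchwartzMap (f := fun m => (φ m : ℂ))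
    (hφc.comp_left (g := fun x : ℝ => (x : ℂ)) (by simp))
    (Complex.ofRealCLM.contDiff.comp hφ) with hfdef
  have hf : (f : V × Z → ℂ) = fun m => (φ m : ℂ) := rfl
  have hfsm : ContDiff ℝ ∞ (f : V × Z → ℂ) := Complex.ofRealCLM.contDiff.comp hφ
  set m₀ := ∫⁻ m, ENNReal.ofReal (φ m) with hm₀
  have hφm : Measurable fun m => ENNReal.ofReal (φ m) := hφ.continuous.measurable.ennreal_ofReal
  have hSm := 𝔫.measurable_areaFunction hfsm h
  -- Here 0 ≤ φ ≤ 1 is used in the form φ² ≤ φ, which replaces the squared L² norm by the L¹ norm.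
  have hS : ∫⁻ n, 𝔫.areaFunction h f n ^ 2 ≤ K ^ 2 * m₀ := by
    have hL (E : Type _) [ENorm E] (g : V × Z → E) :
        (eLpNorm g 2 volume) ^ 2 = ∫⁻ n, ‖g n‖ₑ ^ 2 := by
      rw [eLpNorm_eq_lintegral_rpow_enorm_toReal (by norm_num) (by norm_num),
        ← ENNReal.rpow_natCast, ← ENNReal.rpow_mul]
      norm_num
    have h2 : (eLpNorm (𝔫.areaFunction h f) 2 volume) ^ 2
        ≤ (K * eLpNorm f 2 volume) ^ 2 := by gcongr; exact hK f
    rw [mul_pow, hL, hL] at h2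
    simp only [enorm_eq_self] at h2
    refine h2.trans ?_
    refine mul_le_mul' le_rfl (lintegral_mono fun n => ?_)
    change ‖(φ n : ℂ)‖ₑ ^ 2 ≤ ENNReal.ofReal (φ n)
    rw [← ofReal_norm, Complex.norm_real, Real.norm_of_nonneg (h0 n),
      ← ENNReal.ofReal_pow (h0 n)]
    exact ENNReal.ofReal_le_ofReal (by nlinarith [h0 n, h1 n])
  -- The height of the Hardy-Littlewood function at which the mean term equals t/2: 2^h/(δs) ·
  -- τ(2s)^Q/(s/2)^(Q-1) = t/2.
  set τ : ℝ := t * δ / (4 ^ Q * 2 ^ h) with hτ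
  have hτ0 : 0 < τ := by positivity
  set S₁ : Set (V × Z) := {n | ∃ r : ℝ, 0 < r ∧ ENNReal.ofReal τ * ENNReal.ofReal (r ^ Q) <
    ∫⁻ m in 𝔫.gaugeBall n r, ENNReal.ofReal (φ m)} with hS₁
  set S₂ : Set (V × Z) := {n | ENNReal.ofReal ((t / 2) ^ 2) ≤
    ENNReal.ofReal (h * (2 * δ) ^ (2 * h - 1)) * 𝔫.areaFunction h f n ^ 2} with hS₂
  have hsub : {n | ENNReal.ofReal t < 𝔫.posMaximal (fun m => ENNReal.ofReal (φ m)) n}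
      ⊆ S₁ ∪ S₂ := by
    intro n hn
    obtain ⟨s, hs⟩ := lt_iSup_iff.1 (mem_ofPred_eq ▸ hn)
    obtain ⟨hs0, hs⟩ := lt_iSup_iff.1 hs
    by_contra hcon
    rw [mem_union, not_or] at hcon
    obtain ⟨hn1, hn2⟩ := hcon
    refine absurd hs (not_lt.2 ?_)
    have hmean (r : ℝ) : ‖𝔫.sphericalMean f r n‖ₑ
        = 𝔫.posMean (fun m => ENNReal.ofReal (φ m)) r n :=
      (𝔫.posMean_ofReal_eq_enorm hφ.continuous h0 r n).symm
    have hD := enorm_le_mean_add_squareFunction hh (𝔫.contDiff_sphericalMean hfsm n) hs0 hδ0 hhδ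
    simp only [hmean] at hD
    refine hD.trans ?_
    have hhalf : ENNReal.ofReal t = ENNReal.ofReal (t / 2) + ENNReal.ofReal (t / 2) := by
      rw [← ENNReal.ofReal_add (by positivity) (by positivity)]; congr 1; ring
    rw [hhalf]
    refine add_le_add ?_ ?_
    · simp only [hS₁, mem_ofPred_eq, not_exists, not_and, not_lt] at hn1
      have h2 := (𝔫.mul_lintegral_posMean_le hQ hφm hs0 n).trans (hn1 (2 * s) (by positivity))
      have h3 : ENNReal.ofReal ((s / 2) ^ (Q - 1)) ≠ 0 := by simpa using by positivity
      rw [← ENNReal.ofReal_mul hτ0.le, mul_comm,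
        ← ENNReal.le_div_iff_mul_le (Or.inl h3) (Or.inl (by simp)),
        ← ENNReal.ofReal_div_of_pos (by positivity)] at h2
      refine (mul_le_mul' le_rfl h2).trans ?_
      rw [← ENNReal.ofReal_mul (by positivity)]
      refine ENNReal.ofReal_le_ofReal (le_of_eq ?_)
      obtain ⟨q, hq⟩ : ∃ q, Q = q + 1 := ⟨Q - 1, by omega⟩
      rw [hτ, hq, Nat.add_sub_cancel, div_pow, mul_pow]
      have h4 : (4 : ℝ) ^ (q + 1) = 4 * (2 ^ q * 2 ^ q) := by
        rw [← mul_pow, pow_succ]; norm_num; ring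
      rw [h4]
      field_simp
      ring
    · simp only [hS₂, mem_ofPred_eq, not_le] at hn2
      have h2 : 𝔫.areaFunction h f n ^ 2 = ∫⁻ s in Ioi (0 : ℝ),
          ‖iteratedDeriv h (fun t => 𝔫.sphericalMean f t n) s‖ₑ ^ 2
            * ENNReal.ofReal (s ^ (2 * h - 1)) := by
        rw [areaFunction, ← ENNReal.rpow_natCast, ← ENNReal.rpow_mul]
        norm_num
      rw [← h2]
      refine (ENNReal.rpow_le_rpow hn2.le (by norm_num)).trans (le_of_eq ?_)
      rw [ENNReal.ofReal_rpow_of_nonneg (by positivity) (by norm_num), ← Real.rpow_natCast,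
        ← Real.rpow_mul (by positivity)]
      norm_num
  have hv1 : volume S₁ ≤ ENNReal.ofReal C₁ * ENNReal.ofReal ((t * a)⁻¹) * m₀ := by
    refine (hCM _ _ (by simpa using hτ0)).trans (le_of_eq ?_)
    congr 1
    rw [← ENNReal.ofReal_inv_of_pos hτ0, ← ENNReal.ofReal_coe_nnreal,
      ← ENNReal.ofReal_mul (by positivity), ← ENNReal.ofReal_mul (by positivity)]
    congr 1
    rw [hC₁, hτ, hδ]
    field_simp
  have hv2 : volume S₂ ≤ ENNReal.ofReal C₂ * ENNReal.ofReal ((t * a)⁻¹) * m₀ := by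
    have h2 := meas_ge_le_lintegral_div (μ := volume)
      (f := fun n => ENNReal.ofReal (h * (2 * δ) ^ (2 * h - 1)) * 𝔫.areaFunction h f n ^ 2)
      ((hSm.pow_const 2).const_mul _).aemeasurable (ε := ENNReal.ofReal ((t / 2) ^ 2))
      (by simpa using by positivity) (by simp)
    refine h2.trans ?_
    rw [lintegral_const_mul _ (hSm.pow_const 2), div_eq_mul_inv,
      ← ENNReal.ofReal_inv_of_pos (by positivity)]
    calc _ ≤ ENNReal.ofReal (h * (2 * δ) ^ (2 * h - 1)) * (K ^ 2 * m₀) *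
          ENNReal.ofReal (((t / 2) ^ 2)⁻¹) := by gcongr
      _ = ENNReal.ofReal (h * (2 * δ) ^ (2 * h - 1)) * ENNReal.ofReal (K ^ 2) *
          ENNReal.ofReal (((t / 2) ^ 2)⁻¹) * m₀ := by
            rw [ENNReal.ofReal_pow (by positivity), ENNReal.ofReal_coe_nnreal]; ring
      _ = _ := by
        rw [← ENNReal.ofReal_mul (by positivity), ← ENNReal.ofReal_mul (by positivity),
          ← ENNReal.ofReal_mul (by positivity)]
        congr 2
        obtain ⟨q, hq⟩ : ∃ q, 2 * h = q + 1 := ⟨2 * h - 1, by omega⟩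
        rw [hC₂, hδ]
        rw [hq] at hapow ⊢
        rw [Nat.add_sub_cancel, ← hapow]
        field_simp
        ring
  refine (measure_mono hsub).trans ((measure_union_le _ _).trans ((add_le_add hv1 hv2).trans_eq ?_))
  rw [hweight]
  push_cast
  rw [add_mul, add_mul]
  rfl

/-- Monotone convergence for each radius, followed by an exchange of suprema. It carries the
estimate from smooth functions to indicators of open sets. -/
lemma posMaximal_iSup_of_monotone {g : ℕ → V × Z → ℝ≥0∞} (hg : ∀ j, Measurable (g j))
    (hmono : Monotone g) (n : V × Z) :
    𝔫.posMaximal (fun m => ⨆ j, g j m) n = ⨆ j, 𝔫.posMaximal (g j) n := by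
  have h (s : ℝ) : 𝔫.posMean (fun m => ⨆ j, g j m) s n = ⨆ j, 𝔫.posMean (g j) s n :=
    lintegral_iSup (fun j => (hg j).comp (𝔫.measurable_mul_neg_dil s n))
      fun i j hij m => hmono hij _
  simp only [posMaximal, h]
  rw [iSup_comm]
  refine iSup_congr fun s => ?_
  rw [iSup_comm]

end TwoStepLieAlgebra

/-- The indicator function of an open set is an increasing limit of smooth functions of compact
support with values in `[0, 1]`. -/
lemma exists_contDiff_iSup_eq_indicator {U : Set (V × Z)} (hU : IsOpen U) :
    ∃ φ : ℕ → V × Z → ℝ, (∀ j, ContDiff ℝ ∞ (φ j)) ∧ (∀ j, HasCompactSupport (φ j)) ∧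
      (∀ j m, 0 ≤ φ j m) ∧ (∀ j m, φ j m ≤ 1) ∧ Monotone φ ∧
      ∀ m, ⨆ j, ENNReal.ofReal (φ j m) = U.indicator 1 m := by
  obtain ⟨f, hfs, hf, hfr⟩ := hU.exists_contDiff_support_eq (n := ⊤)
  have hf0 (m : V × Z) : 0 ≤ f m := (hfr (mem_range_self m)).1
  have hsm : Monotone Real.smoothTransition := Real.smoothTransition.monotone
  -- With f > 0 exactly on U, the first factor increases to the indicator of U; the second is a
  -- compact cutoff increasing to 1. The Euclidean square norm is used there because it is smooth.
  refine ⟨fun j m => Real.smoothTransition (j * f m) *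
    Real.smoothTransition (j - (‖m.1‖ ^ 2 + ‖m.2‖ ^ 2)), fun j => ?_, fun j => ?_, fun j m => ?_,
    fun j m => ?_, fun i j hij m => ?_, fun m => ?_⟩
  · refine (Real.smoothTransition.contDiff.comp (contDiff_const.mul hf)).mul
      (Real.smoothTransition.contDiff.comp (contDiff_const.sub ?_))
    exact ((contDiff_norm_sq ℝ).comp contDiff_fst).add ((contDiff_norm_sq ℝ).comp contDiff_snd)
  · refine HasCompactSupport.intro (isCompact_closedBall (0 : V × Z) (j + 1)) fun m hm => ?_
    rw [mem_closedBall_zero_iff, Prod.norm_def, max_le_iff, not_and_or, not_le, not_le] at hm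
    beta_reduce
    rw [Real.smoothTransition.zero_of_nonpos (x := j - _), mul_zero]
    have hj : (0 : ℝ) ≤ j := by positivity
    rcases hm with hm | hm <;>
      nlinarith [sq_nonneg ‖m.1‖, sq_nonneg ‖m.2‖, norm_nonneg m.1, norm_nonneg m.2]
  · exact mul_nonneg (Real.smoothTransition.nonneg _) (Real.smoothTransition.nonneg _)
  · exact mul_le_one₀ (Real.smoothTransition.le_one _) (Real.smoothTransition.nonneg _)
      (Real.smoothTransition.le_one _)
  · have hij' : (i : ℝ) ≤ j := by exact_mod_cast hij
    refine mul_le_mul (hsm ?_) (hsm ?_) (Real.smoothTransition.nonneg _)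
      (Real.smoothTransition.nonneg _)
    · exact mul_le_mul_of_nonneg_right hij' (hf0 m)
    · linarith
  · by_cases hm : m ∈ U
    · rw [indicator_of_mem hm, Pi.one_apply]
      refine le_antisymm (iSup_le fun j => ?_) ?_
      · rw [← ENNReal.ofReal_one]
        exact ENNReal.ofReal_le_ofReal (mul_le_one₀ (Real.smoothTransition.le_one _)
          (Real.smoothTransition.nonneg _) (Real.smoothTransition.le_one _))
      · have hfm : 0 < f m := (hf0 m).lt_of_ne' (by rw [← hfs] at hm; exact hm)
        obtain ⟨j, hj⟩ := exists_nat_ge (max (f m)⁻¹ (1 + (‖m.1‖ ^ 2 + ‖m.2‖ ^ 2)))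
        refine le_iSup_of_le j ?_
        have h1 : 1 ≤ j * f m := by
          have := (le_max_left _ _).trans hj
          rwa [inv_le_iff_one_le_mul₀ hfm] at this
        have h2 : 1 ≤ j - (‖m.1‖ ^ 2 + ‖m.2‖ ^ 2) := by
          have := (le_max_right _ _).trans hj
          linarith
        beta_reduce
        rw [Real.smoothTransition.one_of_one_le h1, Real.smoothTransition.one_of_one_le h2]
        simp
    · have hfm : f m = 0 := by
        rw [← hfs] at hm; simpa using hm
      simp [hm, hfm, Real.smoothTransition.zero]

namespace TwoStepLieAlgebra

variable (𝔫 : TwoStepLieAlgebra V Z)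

/-- The restricted weak type estimate of exponent `1 + 1 / (2h)` for the spherical maximal
function. -/
theorem exists_volume_posMaximal_indicator_le (hQ : 0 < homDim V Z) {h : ℕ} (hh : 1 ≤ h)
    {K : ℝ≥0} (hK : ∀ f : 𝓢(V × Z, ℂ),
      eLpNorm (𝔫.areaFunction h f) 2 volume ≤ K * eLpNorm f 2 volume) :
    ∃ C : ℝ≥0, ∀ (E : Set (V × Z)) (t : ℝ), 0 < t →
      volume {n | ENNReal.ofReal t < 𝔫.posMaximal (E.indicator 1) n}
        ≤ C * ENNReal.ofReal (t ^ (-(1 + 1 / (2 * h) : ℝ))) * volume E := by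
  obtain ⟨C, hC⟩ := 𝔫.exists_volume_posMaximal_le_of_contDiff hQ hh hK
  refine ⟨C + 1, fun E t ht => ?_⟩
  set w := ENNReal.ofReal (t ^ (-(1 + 1 / (2 * h) : ℝ))) with hw
  have hw0 : w ≠ 0 := by simpa [hw] using Real.rpow_pos_of_pos ht _
  have hopen : ∀ U : Set (V × Z), IsOpen U →
      volume {n | ENNReal.ofReal t < 𝔫.posMaximal (U.indicator 1) n} ≤ C * w * volume U := by
    intro U hU
    obtain ⟨φ, h1, h2, h3, h4, h5, h6⟩ := exists_contDiff_iSup_eq_indicator hU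
    have hmono : Monotone fun j m => ENNReal.ofReal (φ j m) :=
      fun i j hij m => ENNReal.ofReal_le_ofReal (h5 hij m)
    have h7 : {n | ENNReal.ofReal t < 𝔫.posMaximal (U.indicator 1) n}
        = ⋃ j, {n | ENNReal.ofReal t < 𝔫.posMaximal (fun m => ENNReal.ofReal (φ j m)) n} := by
      ext n
      rw [← funext h6, mem_ofPred_eq, 𝔫.posMaximal_iSup_of_monotone
        (fun j => (h1 j).continuous.measurable.ennreal_ofReal) hmono, lt_iSup_iff, mem_iUnion]
      rfl
    have h8 : Monotone fun j =>
        {n | ENNReal.ofReal t < 𝔫.posMaximal (fun m => ENNReal.ofReal (φ j m)) n} :=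
      fun i j hij n hn => lt_of_lt_of_le hn (𝔫.posMaximal_mono (hmono hij) n)
    rw [h7, h8.measure_iUnion]
    refine iSup_le fun j => (hC (φ j) (h1 j) (h2 j) (h3 j) (h4 j) t ht).trans ?_
    gcongr
    rw [← lintegral_indicator_one hU.measurableSet]
    refine lintegral_mono fun m => ?_
    rw [← h6 m]
    exact le_iSup (fun j => ENNReal.ofReal (φ j m)) j
  push_cast
  have hc0 : ((C : ℝ≥0∞) + 1) * w ≠ 0 := mul_ne_zero (by simp) hw0
  have hct : ((C : ℝ≥0∞) + 1) * w ≠ ⊤ := ENNReal.mul_ne_top (by simp) (by simp [hw])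
  rw [mul_comm, ← ENNReal.div_le_iff_le_mul (Or.inl hc0) (Or.inl hct)]
  -- Outer regularity: every r above the measure of E admits an open U containing E of measure below
  -- r, and the maximal function is monotone. The constant C + 1 is positive, which permits the
  -- division.
  refine le_of_forall_gt_imp_ge_of_dense fun r hr => ?_
  obtain ⟨U, hEU, hU, hUr⟩ := E.exists_isOpen_lt_of_lt r hr
  rw [ENNReal.div_le_iff_le_mul (Or.inl hc0) (Or.inl hct)]
  calc _ ≤ volume {n | ENNReal.ofReal t < 𝔫.posMaximal (U.indicator 1) n} :=
        measure_mono fun n hn => lt_of_lt_of_le hn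
          (𝔫.posMaximal_mono (fun m => indicator_le_indicator_of_subset hEU (fun _ => zero_le) m) n)
    _ ≤ C * w * volume U := hopen U hU
    _ ≤ (C + 1) * w * r := by gcongr; simp
    _ = _ := mul_comm _ _

end TwoStepLieAlgebra

end RestrictedWeakType

/-! ### Interpolation of restricted weak type with L^∞. -/

section Interpolation

variable {α : Type*} [MeasurableSpace α] {μ : Measure α}

/-- The dyadic level sets of a function. -/
def dyadicLevel (f : α → ℝ≥0∞) (i : ℤ) : Set α := {x | (2 : ℝ≥0∞) ^ i ≤ f x ∧ f x < 2 ^ (i + 1)}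

lemma measurableSet_dyadicLevel {f : α → ℝ≥0∞} (hf : Measurable f) (i : ℤ) :
    MeasurableSet (dyadicLevel f i) :=
  (measurableSet_le measurable_const hf).inter (measurableSet_lt hf measurable_const)

lemma two_zpow_le_two_zpow {i j : ℤ} (h : i ≤ j) : (2 : ℝ≥0∞) ^ i ≤ 2 ^ j :=
  ENNReal.zpow_le_of_le (by norm_num) h

lemma dyadicLevel_unique {f : α → ℝ≥0∞} {x : α} {i j : ℤ} (hi : x ∈ dyadicLevel f i)
    (hj : x ∈ dyadicLevel f j) : i = j := by
  by_contra hne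
  rcases lt_or_gt_of_ne hne with h | h
  · exact absurd (hi.2.trans_le (two_zpow_le_two_zpow (by omega))) (not_lt.2 hj.1)
  · exact absurd (hj.2.trans_le (two_zpow_le_two_zpow (by omega))) (not_lt.2 hi.1)

lemma two_zpow_rpow (i : ℤ) (p : ℝ) : ((2 : ℝ≥0∞) ^ i) ^ p = 2 ^ ((i : ℝ) * p) := by
  rw [← ENNReal.rpow_intCast, ← ENNReal.rpow_mul]

lemma tsum_dyadicLevel_le {f : α → ℝ≥0∞} (hf : Measurable f) {p : ℝ} (hp : 0 < p) :
    ∑' i : ℤ, (2 : ℝ≥0∞) ^ ((i : ℝ) * p) * μ (dyadicLevel f i) ≤ ∫⁻ x, f x ^ p ∂μ := by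
  have h1 (i : ℤ) : (2 : ℝ≥0∞) ^ ((i : ℝ) * p) * μ (dyadicLevel f i)
      = ∫⁻ x, (dyadicLevel f i).indicator (fun _ => (2 : ℝ≥0∞) ^ ((i : ℝ) * p)) x ∂μ := by
    rw [lintegral_indicator_const (measurableSet_dyadicLevel hf i)]
  simp only [h1]
  rw [← lintegral_tsum fun i =>
    (measurable_const.indicator (measurableSet_dyadicLevel hf i)).aemeasurable]
  refine lintegral_mono fun x => ?_
  by_cases hx : ∃ i, x ∈ dyadicLevel f i
  · obtain ⟨i, hi⟩ := hx
    rw [tsum_eq_single i fun j hj => indicator_of_notMem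
      (fun hmem => hj (dyadicLevel_unique hmem hi)) _, indicator_of_mem hi, ← two_zpow_rpow]
    exact ENNReal.rpow_le_rpow hi.1 hp.le
  · push Not at hx
    simp [hx]

/-- Prepares the interpolation: the bounded part goes to the L^∞ estimate, each dyadic level to the
restricted weak type estimate, and the infinite part lives on a null set when f^p is integrable. -/
lemma le_const_add_tsum_dyadicLevel (f : α → ℝ≥0∞) (i : ℤ) (x : α) :
    f x ≤ (2 ^ i + ∑' l : ℕ, 2 ^ (i + l + 1) * (dyadicLevel f (i + l)).indicator 1 x)
      + ∞ * {x | f x = ∞}.indicator 1 x := by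
  rcases eq_or_ne (f x) ∞ with htop | htop
  · rw [indicator_of_mem (by exact htop)]; simp
  refine le_add_right ?_
  rcases le_or_gt (f x) (2 ^ i) with hle | hlt
  · exact le_add_right hle
  refine le_add_left ?_
  have h0 : f x ≠ 0 := (lt_of_le_of_lt zero_le hlt).ne'
  obtain ⟨k, hk⟩ := ENNReal.exists_mem_Ico_zpow h0 htop (y := 2) (by norm_num) (by norm_num)
  have hik : i ≤ k := by
    by_contra! h
    exact absurd (hk.2.trans_le (two_zpow_le_two_zpow (by omega))) (not_lt.2 hlt.le)
  obtain ⟨l, rfl⟩ := Int.le.dest hik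
  refine le_trans ?_ (ENNReal.le_tsum l)
  rw [indicator_of_mem (by exact hk)]
  simpa using hk.2.le

/-- Interpolation between a restricted weak type estimate of exponent `q` and an `L^∞` estimate,
for a countably sublinear operator on non-negative functions. -/
theorem exists_lintegral_rpow_le_of_restricted_weak_type
    {T : (α → ℝ≥0∞) → α → ℝ≥0∞}
    (hmono : ∀ f g : α → ℝ≥0∞, (∀ x, f x ≤ g x) → ∀ x, T f x ≤ T g x)
    (hadd : ∀ f g : α → ℝ≥0∞, Measurable f → Measurable g → ∀ x,
      T (fun y => f y + g y) x ≤ T f x + T g x)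
    (hsum : ∀ f : ℕ → α → ℝ≥0∞, (∀ l, Measurable (f l)) → ∀ x,
      T (fun y => ∑' l, f l y) x ≤ ∑' l, T (f l) x)
    (hsmul : ∀ (c : ℝ≥0∞) (f : α → ℝ≥0∞), Measurable f → ∀ x,
      T (fun y => c * f y) x ≤ c * T f x)
    {B : ℝ≥0} (hconst : ∀ (c : ℝ≥0∞) x, T (fun _ => c) x ≤ c * B)
    {q p : ℝ} (hq : 0 < q) (hqp : q < p) {C : ℝ≥0}
    (hweak : ∀ E : Set α, MeasurableSet E → ∀ t : ℝ, 0 < t →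
      μ {x | ENNReal.ofReal t < T (E.indicator 1) x} ≤ C * ENNReal.ofReal (t ^ (-q)) * μ E) :
    ∃ C' : ℝ≥0, ∀ f : α → ℝ≥0∞, Measurable f → ∃ g : α → ℝ≥0∞, Measurable g ∧
      (∀ x, T f x ≤ g x) ∧ ∫⁻ x, g x ^ p ∂μ ≤ C' * ∫⁻ x, f x ^ p ∂μ := by
  have hp : 0 < p := hq.trans hqp
  -- θ < 1 lets the height be distributed over the levels in geometric proportion (1 - θ)θ^l; θ >
  -- 2^(1 - p/q) makes r = (2/θ)^q 2^(-p) less than 1, so the resulting measures are summable. Both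
  -- are possible since q < p.
  obtain ⟨θ, hθ1, hθ2⟩ : ∃ θ : ℝ, (2 : ℝ) ^ (1 - p / q) < θ ∧ θ < 1 := by
    refine exists_between (Real.rpow_lt_one_of_one_lt_of_neg (by norm_num) ?_)
    rw [sub_neg, one_lt_div hq]; exact hqp
  have hθ0 : 0 < θ := lt_trans (by positivity) hθ1
  -- Cutting f at height 2^(j-a) makes the bounded part contribute at most 2^j / 2 to T f.
  obtain ⟨a, ha⟩ : ∃ a : ℕ, (B : ℝ≥0∞) * 2 ≤ 2 ^ a := by
    obtain ⟨a, ha⟩ := pow_unbounded_of_one_lt (B * 2) (one_lt_two (α := ℝ≥0))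
    exact ⟨a, by exact_mod_cast ha.le⟩
  -- Determined by 2^(j-a+l+1) · t₀(θ/2)^l = 2^j/2 · (1 - θ)θ^l.
  set t₀ : ℝ := 2 ^ a * (1 - θ) / 4 with ht₀
  have ht₀0 : 0 < t₀ := by have : 0 < 1 - θ := by linarith
                           positivity
  set ρ : ℝ := (θ / 2) ^ (-q) with hρ
  have hρ0 : 0 < ρ := by positivity
  set r : ℝ := ρ * 2 ^ (-p) with hr
  have hr0 : 0 < r := by positivity
  have hr1 : r < 1 := by
    have h1 : ((2 : ℝ) ^ (1 - p / q)) ^ q < θ ^ q := Real.rpow_lt_rpow (by positivity) hθ1 hq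
    rw [← Real.rpow_mul (by norm_num)] at h1
    have h2 : (1 - p / q) * q = q + -p := by field_simp; ring
    rw [h2, Real.rpow_add (by norm_num)] at h1
    rw [hr, hρ, Real.rpow_neg (by positivity), Real.div_rpow hθ0.le (by norm_num), inv_div,
      div_mul_eq_mul_div, div_lt_one (by positivity)]
    exact h1
  set c : ℝ≥0∞ := C * ENNReal.ofReal (t₀ ^ (-q)) with hc
  set D : ℝ≥0∞ := c * 2 ^ (((a : ℝ) + 1) * p) * (1 - ENNReal.ofReal r)⁻¹ with hD
  have hDt : D ≠ ∞ := by
    refine ENNReal.mul_ne_top (ENNReal.mul_ne_top (ENNReal.mul_ne_top (by simp) (by simp))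
      (ENNReal.rpow_ne_top_of_nonneg (by positivity) (by norm_num))) ?_
    rw [ENNReal.inv_ne_top, ne_eq, tsub_eq_zero_iff_le, not_le, ← ENNReal.ofReal_one]
    exact (ENNReal.ofReal_lt_ofReal_iff (by norm_num)).2 hr1
  refine ⟨D.toNNReal + 1, fun f hf => ?_⟩
  rcases eq_or_ne (∫⁻ x, f x ^ p ∂μ) ∞ with hfi | hfi
  · refine ⟨fun _ => ∞, measurable_const, fun _ => le_top, ?_⟩
    rw [hfi, ENNReal.mul_top (by simp)]
    exact le_top
  have hinf : μ {x | f x = ∞} = 0 := by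
    have h1 := ae_lt_top (hf.pow_const p) hfi
    rw [ae_iff] at h1
    refine measure_mono_null (fun x hx => ?_) h1
    simp [show f x = ∞ from hx, hp]
  have hinfm : MeasurableSet {x | f x = ∞} := hf (measurableSet_singleton _)
  have hnull : μ {x | T ({x | f x = ∞}.indicator 1) x ≠ 0} = 0 := by
    have h1 : {x | T ({x | f x = ∞}.indicator 1) x ≠ 0}
        ⊆ ⋃ k : ℕ, {x | ENNReal.ofReal (1 / (k + 1)) < T ({x | f x = ∞}.indicator 1) x} := by
      intro x hx
      obtain ⟨k, hk⟩ := ENNReal.exists_inv_nat_lt (a := T ({x | f x = ∞}.indicator 1) x) hx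
      refine mem_iUnion.2 ⟨k, lt_of_le_of_lt ?_ hk⟩
      rw [one_div, ENNReal.ofReal_inv_of_pos (by positivity), ENNReal.inv_le_inv]
      rw [← ENNReal.ofReal_natCast]
      exact ENNReal.ofReal_le_ofReal (by linarith)
    refine measure_mono_null h1 (measure_iUnion_null fun k => ?_)
    have h2 := hweak _ hinfm (1 / (k + 1)) (by positivity)
    rw [hinf, mul_zero] at h2
    exact le_antisymm h2 zero_le
  -- If every level l contributes at most its share (1 - θ)θ^l of 2^j/2, and the infinite part
  -- contributes nothing, then T f ≤ 2^j. Hence one of these fails wherever T f > 2^j.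
  have hlevel (j : ℤ) : μ {x | 2 ^ j < T f x}
      ≤ ∑' l : ℕ, c * ENNReal.ofReal ρ ^ l * μ (dyadicLevel f (j - a + l)) := by
    set τ : ℕ → ℝ := fun l => t₀ * (θ / 2) ^ l with hτ
    have hτ0 (l : ℕ) : 0 < τ l := by positivity
    have h1 : {x | 2 ^ j < T f x} ⊆ {x | T ({x | f x = ∞}.indicator 1) x ≠ 0} ∪
        ⋃ l : ℕ, {x | ENNReal.ofReal (τ l) <
          T ((dyadicLevel f (j - a + l)).indicator 1) x} := by
      intro x hx
      by_contra hcon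
      simp only [mem_union, mem_iUnion, mem_ofPred_eq, not_or, not_exists, not_lt, ne_eq,
        not_not] at hcon
      obtain ⟨hx0, hxl⟩ := hcon
      refine absurd (show 2 ^ j < T f x from hx) (not_lt.2 ?_)
      have hm (i : ℤ) : Measurable ((dyadicLevel f i).indicator (1 : α → ℝ≥0∞)) :=
        measurable_one.indicator (measurableSet_dyadicLevel hf i)
      have hminf : Measurable ({x | f x = ∞}.indicator (1 : α → ℝ≥0∞)) :=
        measurable_one.indicator hinfm
      have hms : Measurable fun y => ∑' l : ℕ, 2 ^ (j - a + l + 1) *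
          (dyadicLevel f (j - a + l)).indicator (1 : α → ℝ≥0∞) y :=
        Measurable.tsum fun l => (hm _).const_mul _
      have hj : (2 : ℝ≥0∞) ^ (j - a) = 2 ^ j * (2 ^ a)⁻¹ := by
        rw [ENNReal.zpow_sub (by norm_num) (by norm_num), zpow_natCast]
      calc T f x ≤ T (fun y => (2 ^ (j - a) + ∑' l : ℕ, 2 ^ (j - a + l + 1) *
              (dyadicLevel f (j - a + l)).indicator 1 y) + ∞ * {x | f x = ∞}.indicator 1 y) x :=
            hmono _ _ (le_const_add_tsum_dyadicLevel f (j - a)) x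
        _ ≤ (T (fun _ => 2 ^ (j - a)) x + T (fun y => ∑' l : ℕ, 2 ^ (j - a + l + 1) *
              (dyadicLevel f (j - a + l)).indicator 1 y) x)
              + ∞ * T ({x | f x = ∞}.indicator 1) x :=
            (hadd _ _ (measurable_const.add hms) (hminf.const_mul _) x).trans
              (add_le_add (hadd _ _ measurable_const hms x) (hsmul _ _ hminf x))
        _ ≤ (2 ^ (j - a) * B + ∑' l : ℕ, 2 ^ (j - a + l + 1) *
              T ((dyadicLevel f (j - a + l)).indicator 1) x) + 0 := by
            rw [hx0, mul_zero]
            refine add_le_add (add_le_add (hconst _ x) ((hsum _ (fun l => (hm _).const_mul _)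
              x).trans (ENNReal.tsum_le_tsum fun l => hsmul _ _ (hm _) x))) le_rfl
        _ ≤ (2 ^ j * 2⁻¹ + ∑' l : ℕ, 2 ^ j * (2⁻¹ * (ENNReal.ofReal (1 - θ) *
              ENNReal.ofReal θ ^ l))) + 0 := by
            refine add_le_add (add_le_add ?_ (ENNReal.tsum_le_tsum fun l => ?_)) le_rfl
            · rw [hj, mul_assoc]
              gcongr
              rw [← ENNReal.div_eq_inv_mul, ENNReal.div_le_iff (by simp) (by simp), mul_comm,
                ← div_eq_mul_inv,
                ENNReal.le_div_iff_mul_le (Or.inl (by norm_num)) (Or.inl (by norm_num))]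
              exact ha
            · have e1 : (2 : ℝ≥0∞) ^ (j - a + l + 1) = 2 ^ j * ((2 ^ a)⁻¹ * (2 ^ l * 2)) := by
                rw [ENNReal.zpow_add (by norm_num) (by norm_num), ENNReal.zpow_add (by norm_num)
                  (by norm_num), hj, zpow_natCast, zpow_one]
                ring
              rw [e1, mul_assoc]
              refine mul_le_mul' le_rfl ?_
              refine (mul_le_mul' le_rfl (hxl l)).trans (le_of_eq ?_)
              have e2 : ((2 ^ a)⁻¹ * (2 ^ l * 2) : ℝ≥0∞)
                  = ENNReal.ofReal ((2 ^ a)⁻¹ * (2 ^ l * 2)) := by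
                rw [ENNReal.ofReal_mul (by positivity), ENNReal.ofReal_mul (by positivity),
                  ENNReal.ofReal_inv_of_pos (by positivity), ENNReal.ofReal_pow (by norm_num),
                  ENNReal.ofReal_pow (by norm_num)]
                norm_num
              have e3 : (2⁻¹ : ℝ≥0∞) = ENNReal.ofReal 2⁻¹ := by
                rw [ENNReal.ofReal_inv_of_pos (by norm_num)]; norm_num
              rw [e2, e3, ← ENNReal.ofReal_pow hθ0.le,
                ← ENNReal.ofReal_mul (p := (2 ^ a)⁻¹ * (2 ^ l * 2)) (by positivity),
                ← ENNReal.ofReal_mul (p := 1 - θ) (by linarith),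
                ← ENNReal.ofReal_mul (p := 2⁻¹) (by norm_num)]
              congr 1
              rw [hτ, ht₀]
              simp only [div_pow]
              field_simp
              ring
        _ = 2 ^ j := by
            rw [ENNReal.tsum_mul_left, ENNReal.tsum_mul_left, ENNReal.tsum_mul_left,
              ENNReal.tsum_geometric, ENNReal.ofReal_sub _ hθ0.le, ENNReal.ofReal_one,
              ENNReal.mul_inv_cancel, mul_one, add_zero, ← mul_add, ENNReal.inv_two_add_inv_two,
              mul_one]
            · rw [ne_eq, tsub_eq_zero_iff_le, not_le, ← ENNReal.ofReal_one]
              exact (ENNReal.ofReal_lt_ofReal_iff (by norm_num)).2 hθ2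
            · exact (tsub_le_self.trans_lt ENNReal.one_lt_top).ne
    refine (measure_mono h1).trans ((measure_union_le _ _).trans ?_)
    rw [hnull, zero_add]
    refine (measure_iUnion_le _).trans (ENNReal.tsum_le_tsum fun l => ?_)
    refine (hweak _ (measurableSet_dyadicLevel hf _) _ (hτ0 l)).trans (le_of_eq ?_)
    rw [hc, mul_assoc (C : ℝ≥0∞) (ENNReal.ofReal (t₀ ^ (-q))), ← ENNReal.ofReal_pow hρ0.le,
      ← ENNReal.ofReal_mul (by positivity)]
    congr 3
    rw [hτ, hρ, Real.mul_rpow ht₀0.le (by positivity), ← Real.rpow_natCast, ← Real.rpow_natCast,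
      ← Real.rpow_mul (by positivity), ← Real.rpow_mul (by positivity), mul_comm (l : ℝ)]
  -- T f need not be measurable; measurable hulls of its superlevel sets have the same measure and
  -- give a measurable majorant G^(1/p).
  set W : ℤ → Set α := fun j => toMeasurable μ {x | 2 ^ j < T f x} with hW
  have hWm (j : ℤ) : MeasurableSet (W j) := measurableSet_toMeasurable _ _
  set G : α → ℝ≥0∞ := fun x => ∑' j : ℤ,
    (W j).indicator (fun _ => (2 : ℝ≥0∞) ^ (((j + 1 : ℤ) : ℝ) * p)) x with hG
  have hGm : Measurable G := Measurable.tsum fun j => measurable_const.indicator (hWm j)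
  refine ⟨fun x => G x ^ (1 / p), hGm.pow_const _, fun x => ?_, ?_⟩
  · refine le_of_forall_lt_imp_le_of_dense fun y hy => ?_
    rcases eq_or_ne y 0 with rfl | hy0
    · exact zero_le
    obtain ⟨j, hj⟩ := ENNReal.exists_mem_Ioc_zpow hy0 hy.ne_top (y := 2) (by norm_num) (by norm_num)
    have hx : x ∈ W j := subset_toMeasurable _ _ (show 2 ^ j < T f x from hj.1.trans hy)
    calc y ≤ 2 ^ (j + 1) := hj.2
      _ = ((2 : ℝ≥0∞) ^ (((j + 1 : ℤ) : ℝ) * p)) ^ (1 / p) := by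
        rw [← ENNReal.rpow_mul, mul_assoc, mul_one_div_cancel hp.ne', mul_one,
          ENNReal.rpow_intCast]
      _ ≤ G x ^ (1 / p) := by
        refine ENNReal.rpow_le_rpow ?_ (by positivity)
        refine le_trans (le_of_eq ?_) (ENNReal.le_tsum j)
        rw [indicator_of_mem hx]
  · have h1 (x : α) : (G x ^ (1 / p)) ^ p = G x := by
      rw [← ENNReal.rpow_mul, one_div_mul_cancel hp.ne', ENNReal.rpow_one]
    simp only [h1]
    -- The substitution j = i + a - l separates the double sum into a geometric series of ratio r in
    -- l and the dyadic sum for ∫ f^p in i.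
    have hterm (l : ℕ) (i : ℤ) : (2 : ℝ≥0∞) ^ (((i + (a - l) + 1 : ℤ) : ℝ) * p) *
        (c * ENNReal.ofReal ρ ^ l * μ (dyadicLevel f (i + (a - l) - a + l)))
        = (c * 2 ^ (((a : ℝ) + 1) * p) * ENNReal.ofReal r ^ l) *
          (2 ^ ((i : ℝ) * p) * μ (dyadicLevel f i)) := by
      have e1 : i + ((a : ℤ) - l) - a + l = i := by ring
      have e2 : (((i + (a - l) + 1 : ℤ) : ℝ) * p)
          = (i : ℝ) * p + ((a : ℝ) + 1) * p + (-p) * l := by push_cast; ring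
      have e3 : (2 : ℝ≥0∞) ^ (-p) = ENNReal.ofReal (2 ^ (-p)) := by
        rw [← ENNReal.ofReal_rpow_of_pos (by norm_num)]; norm_num
      rw [e1, e2, ENNReal.rpow_add _ _ (by norm_num) (by norm_num),
        ENNReal.rpow_add _ _ (by norm_num) (by norm_num), ENNReal.rpow_mul _ (-p),
        ENNReal.rpow_natCast, hr, ENNReal.ofReal_mul hρ0.le, ← e3, mul_pow]
      ring
    calc ∫⁻ x, G x ∂μ
        = ∑' j : ℤ, (2 : ℝ≥0∞) ^ (((j + 1 : ℤ) : ℝ) * p) * μ {x | 2 ^ j < T f x} := by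
          rw [hG, lintegral_tsum fun j => (measurable_const.indicator (hWm j)).aemeasurable]
          refine tsum_congr fun j => ?_
          rw [lintegral_indicator_const (hWm j), hW, measure_toMeasurable]
      _ ≤ ∑' (j : ℤ) (l : ℕ), (2 : ℝ≥0∞) ^ (((j + 1 : ℤ) : ℝ) * p) *
            (c * ENNReal.ofReal ρ ^ l * μ (dyadicLevel f (j - a + l))) := by
          refine ENNReal.tsum_le_tsum fun j => ?_
          rw [ENNReal.tsum_mul_left]
          exact mul_le_mul' le_rfl (hlevel j)
      _ = ∑' (l : ℕ) (j : ℤ), (2 : ℝ≥0∞) ^ (((j + 1 : ℤ) : ℝ) * p) *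
            (c * ENNReal.ofReal ρ ^ l * μ (dyadicLevel f (j - a + l))) := ENNReal.tsum_comm
      _ = ∑' (l : ℕ) (i : ℤ), (c * 2 ^ (((a : ℝ) + 1) * p) * ENNReal.ofReal r ^ l) *
            (2 ^ ((i : ℝ) * p) * μ (dyadicLevel f i)) := by
          refine tsum_congr fun l => ?_
          rw [← (Equiv.addRight ((a : ℤ) - l)).tsum_eq]
          exact tsum_congr fun i => hterm l i
      _ = D * ∑' i : ℤ, 2 ^ ((i : ℝ) * p) * μ (dyadicLevel f i) := by
          simp only [ENNReal.tsum_mul_left, ENNReal.tsum_mul_right, ENNReal.tsum_geometric, hD]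
      _ ≤ (D + 1) * ∫⁻ x, f x ^ p ∂μ :=
          mul_le_mul' le_self_add (tsum_dyadicLevel_le hf hp)
      _ = _ := by
          push_cast
          rw [ENNReal.coe_toNNReal hDt]

end Interpolation

/-! ### Strong type bounds, well-definedness and measurability on L^p. -/

section StrongType

open Filter Topology

variable {V Z : Type*} [NormedAddCommGroup V] [InnerProductSpace ℝ V] [FiniteDimensional ℝ V]
  [MeasurableSpace V] [BorelSpace V]
  [NormedAddCommGroup Z] [InnerProductSpace ℝ Z] [FiniteDimensional ℝ Z]
  [MeasurableSpace Z] [BorelSpace Z]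

namespace TwoStepLieAlgebra

variable (𝔫 : TwoStepLieAlgebra V Z)

lemma measurable_comp_mul_neg_dil {f : V × Z → ℝ≥0∞} (hf : Measurable f) (s : ℝ) (n : V × Z) :
    Measurable fun n' => f (𝔫.mul n (-dil s n')) :=
  hf.comp (𝔫.measurable_mul_neg_dil s n)

/-- The operator `posMaximal` is bounded on `L^p` with `p`-th power norm bound `C`, with a
measurable majorant. -/
def PosMaximalBound (p : ℝ) (C : ℝ≥0) : Prop :=
  ∀ f : V × Z → ℝ≥0∞, Measurable f → ∃ g : V × Z → ℝ≥0∞, Measurable g ∧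
    (∀ n, 𝔫.posMaximal f n ≤ g n) ∧ ∫⁻ n, g n ^ p ≤ C * ∫⁻ n, f n ^ p

lemma exists_posMaximalBound (hQ : 0 < homDim V Z) {h : ℕ} (hh : 1 ≤ h)
    {K : ℝ≥0} (hK : ∀ f : 𝓢(V × Z, ℂ),
      eLpNorm (𝔫.areaFunction h f) 2 volume ≤ K * eLpNorm f 2 volume)
    {p : ℝ} (hp : 1 + 1 / (2 * h) < p) : ∃ C : ℝ≥0, 𝔫.PosMaximalBound p C := by
  obtain ⟨C, hC⟩ := 𝔫.exists_volume_posMaximal_indicator_le hQ hh hK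
  have hB : ((sphereMeasure V Z univ).toNNReal : ℝ≥0∞) = sphereMeasure V Z univ :=
    ENNReal.coe_toNNReal (measure_ne_top _ _)
  refine exists_lintegral_rpow_le_of_restricted_weak_type (T := 𝔫.posMaximal)
    (B := (sphereMeasure V Z univ).toNNReal) (q := 1 + 1 / (2 * h)) (C := C)
    (fun f g hfg n => 𝔫.posMaximal_mono hfg n) (fun f g hf _ n => ?_) (fun f hf n => ?_)
    (fun c f hf n => ?_) (fun c n => by rw [hB]; exact 𝔫.posMaximal_const c n) (by positivity) hp
    (fun E _ t ht => hC E t ht)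
  · refine iSup₂_le fun s hs => ?_
    rw [posMean, lintegral_add_left (𝔫.measurable_comp_mul_neg_dil hf s n)]
    exact add_le_add (𝔫.posMean_le_posMaximal f hs n) (𝔫.posMean_le_posMaximal g hs n)
  · refine iSup₂_le fun s hs => ?_
    rw [posMean, lintegral_tsum fun l =>
      (𝔫.measurable_comp_mul_neg_dil (hf l) s n).aemeasurable]
    exact ENNReal.tsum_le_tsum fun l => 𝔫.posMean_le_posMaximal (f l) hs n
  · refine iSup₂_le fun s hs => ?_
    rw [posMean, lintegral_const_mul _ (𝔫.measurable_comp_mul_neg_dil hf s n)]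
    exact mul_le_mul' le_rfl (𝔫.posMean_le_posMaximal f hs n)

variable {𝔫}

/-- The L^p bound applied to the indicator of a null set forces its maximal function to vanish
almost everywhere. Thus for almost every n all spheres about n meet the null set in μ-measure zero,
although there are uncountably many of them. -/
lemma PosMaximalBound.ae_forall_ae {p : ℝ} (hp : 0 < p) {C : ℝ≥0} (hb : 𝔫.PosMaximalBound p C)
    {P : V × Z → Prop} (hP : ∀ᵐ m, P m) :
    ∀ᵐ n : V × Z, ∀ s : ℝ, 0 < s → ∀ᵐ n' ∂(sphereMeasure V Z), P (𝔫.mul n (-dil s n')) := by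
  set E := toMeasurable volume {m : V × Z | ¬P m} with hE
  have hEm : MeasurableSet E := measurableSet_toMeasurable _ _
  have hE0 : volume E = 0 := by rw [hE, measure_toMeasurable]; exact hP
  have hind : Measurable (E.indicator (1 : V × Z → ℝ≥0∞)) := measurable_one.indicator hEm
  obtain ⟨g, hg, hle, hint⟩ := hb (E.indicator 1) hind
  have h1 : ∫⁻ n, (E.indicator (1 : V × Z → ℝ≥0∞) n) ^ p = 0 := by
    rw [lintegral_eq_zero_iff (hind.pow_const p)]
    have : ∀ᵐ n : V × Z, n ∉ E := measure_eq_zero_iff_ae_notMem.1 hE0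
    filter_upwards [this] with n hn
    simp [hn, hp]
  rw [h1, mul_zero, nonpos_iff_eq_zero, lintegral_eq_zero_iff (hg.pow_const p)] at hint
  filter_upwards [hint] with n hn s hs
  have h2 : g n = 0 := by
    simpa [hp, hp.le, hp.not_gt] using hn
  have h3 : 𝔫.posMean (E.indicator 1) s n = 0 :=
    le_antisymm ((𝔫.posMean_le_posMaximal _ hs n).trans ((hle n).trans h2.le)) zero_le
  rw [posMean, lintegral_eq_zero_iff (𝔫.measurable_comp_mul_neg_dil hind s n)] at h3
  filter_upwards [h3] with n' hn'
  by_contra hcon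
  have : 𝔫.mul n (-dil s n') ∈ E := subset_toMeasurable _ _ hcon
  simp [this] at hn'

variable (𝔫) in
/-- The maximal function over the radii in `I`. -/
def truncMaximal (I : Set ℝ) (f : V × Z → ℂ) (n : V × Z) : ℝ≥0∞ :=
  ⨆ s ∈ I, ‖𝔫.sphericalMean f s n‖ₑ

/-- Each mean is continuous in n, so even an uncountable supremum of their norms is lower
semicontinuous. -/
lemma measurable_truncMaximal_of_continuous (I : Set ℝ) {f : V × Z → ℂ} (hf : Continuous f) :
    Measurable (𝔫.truncMaximal I f) := by
  have hs (s : ℝ) : Continuous fun n => 𝔫.sphericalMean f s n :=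
    continuous_integral_of_continuous (isCompact_closedBall (0 : V × Z) 1)
      ae_mem_closedBall_sphereMeasure (Φ := fun n n' => 𝔫.translate f s n n')
      (hf.comp (𝔫.continuous_mul_neg_dil.comp
        (by fun_prop : Continuous fun q : (V × Z) × (V × Z) => (s, q.1, q.2))))
  refine LowerSemicontinuous.measurable ?_
  exact lowerSemicontinuous_biSup fun s _ => (hs s).enorm.lowerSemicontinuous

lemma truncMaximal_congr {f g : V × Z → ℂ} {I : Set ℝ} {n : V × Z}
    (h : ∀ s ∈ I, 𝔫.translate f s n =ᵐ[sphereMeasure V Z] 𝔫.translate g s n) :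
    𝔫.truncMaximal I f n = 𝔫.truncMaximal I g n :=
  iSup_congr fun s => iSup_congr fun hs => by
    rw [sphericalMean, integral_congr_ae (h s hs), sphericalMean]

lemma truncMaximal_le_add {f g : V × Z → ℂ} {I : Set ℝ} {n : V × Z} {b : ℝ≥0∞}
    (hf : ∀ s ∈ I, Integrable (𝔫.translate f s n) (sphereMeasure V Z))
    (hg : ∀ s ∈ I, Integrable (𝔫.translate g s n) (sphereMeasure V Z))
    (hb : ∀ s ∈ I, 𝔫.posMean (fun m => ‖f m - g m‖ₑ) s n ≤ b) :
    𝔫.truncMaximal I f n ≤ 𝔫.truncMaximal I g n + b := by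
  refine iSup₂_le fun s hs => ?_
  have h1 : 𝔫.sphericalMean f s n = 𝔫.sphericalMean g s n
      + ∫ n', (𝔫.translate f s n n' - 𝔫.translate g s n n') ∂(sphereMeasure V Z) := by
    rw [integral_sub (hf s hs) (hg s hs)]
    simp [sphericalMean]
  rw [h1]
  refine (enorm_add_le _ _).trans (add_le_add ?_ ?_)
  · exact le_iSup₂ (f := fun s (_ : s ∈ I) => ‖𝔫.sphericalMean g s n‖ₑ) s hs
  · exact (enorm_integral_le_lintegral_enorm _).trans (hb s hs)

lemma integrable_translate_of_continuous {f : V × Z → ℂ} (hf : Continuous f) (s : ℝ)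
    (n : V × Z) : Integrable (𝔫.translate f s n) (sphereMeasure V Z) := by
  have hcont : Continuous (𝔫.translate f s n) :=
    hf.comp (𝔫.continuous_mul_neg_dil.comp (by fun_prop : Continuous fun n' => (s, n, n')))
  obtain ⟨B, hB⟩ := (isCompact_closedBall (0 : V × Z) 1).exists_bound_of_continuousOn
    hcont.continuousOn
  refine Integrable.of_bound hcont.aestronglyMeasurable B ?_
  filter_upwards [ae_mem_closedBall_sphereMeasure (V := V) (Z := Z)] with y hy using hB y hy

lemma PosMaximalBound.ae_translate_ae_eq {p : ℝ} (hp : 0 < p) {C : ℝ≥0}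
    (hb : 𝔫.PosMaximalBound p C) {f g : V × Z → ℂ} (hfg : f =ᵐ[volume] g) :
    ∀ᵐ n : V × Z, ∀ s : ℝ, 0 < s →
      𝔫.translate f s n =ᵐ[sphereMeasure V Z] 𝔫.translate g s n :=
  hb.ae_forall_ae hp hfg

lemma lintegral_enorm_rpow_eq {f : V × Z → ℂ} {p : ℝ} (hp : 0 < p) :
    ∫⁻ n, ‖f n‖ₑ ^ p = eLpNorm f (ENNReal.ofReal p) volume ^ p := by
  rw [eLpNorm_eq_lintegral_rpow_enorm_toReal (by simpa using hp) (by simp),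
    ENNReal.toReal_ofReal hp.le, ← ENNReal.rpow_mul, one_div_mul_cancel hp.ne', ENNReal.rpow_one]

/-- For `f ∈ L^p` the means are dominated by a measurable function in `L^p`. -/
lemma PosMaximalBound.exists_majorant {p : ℝ} (hp : 0 < p) {C : ℝ≥0}
    (hb : 𝔫.PosMaximalBound p C) {f : V × Z → ℂ}
    (hf : AEStronglyMeasurable f volume) :
    ∃ g : V × Z → ℝ≥0∞, Measurable g ∧
      (∀ᵐ n, ∀ s, 0 < s → 𝔫.posMean (fun m => ‖f m‖ₑ) s n ≤ g n) ∧
      ∫⁻ n, g n ^ p ≤ C * eLpNorm f (ENNReal.ofReal p) volume ^ p := by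
  obtain ⟨g, hg, hle, hint⟩ := hb (fun m => ‖hf.mk f m‖ₑ) hf.stronglyMeasurable_mk.measurable.enorm
  refine ⟨g, hg, ?_, ?_⟩
  · filter_upwards [hb.ae_translate_ae_eq hp hf.ae_eq_mk] with n hn s hs
    refine le_trans (le_of_eq ?_) ((𝔫.posMean_le_posMaximal _ hs n).trans (hle n))
    refine lintegral_congr_ae ?_
    filter_upwards [hn s hs] with n' hn'
    exact congrArg (‖·‖ₑ) hn'
  · rwa [lintegral_enorm_rpow_eq hp, ← eLpNorm_congr_ae hf.ae_eq_mk] at hint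

lemma PosMaximalBound.ae_integrable {p : ℝ} (hp : 0 < p) {C : ℝ≥0}
    (hb : 𝔫.PosMaximalBound p C) {f : V × Z → ℂ} (hf : MemLp f (ENNReal.ofReal p) volume) :
    ∀ᵐ n : V × Z, ∀ s : ℝ, 0 < s → Integrable (𝔫.translate f s n) (sphereMeasure V Z) := by
  obtain ⟨g, hg, hle, hint⟩ := hb.exists_majorant hp hf.1
  have hfin : ∫⁻ n, g n ^ p ≠ ∞ := (hint.trans_lt (ENNReal.mul_lt_top ENNReal.coe_lt_top
    (ENNReal.rpow_lt_top_of_nonneg hp.le hf.2.ne))).ne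
  filter_upwards [hle, ae_lt_top (hg.pow_const p) hfin,
    hb.ae_translate_ae_eq hp hf.1.ae_eq_mk] with n hn hgn heq s hs
  refine ⟨?_, ?_⟩
  · exact (hf.1.stronglyMeasurable_mk.comp_measurable
      (𝔫.measurable_mul_neg_dil s n)).aestronglyMeasurable.congr (heq s hs).symm
  · exact (hn s hs).trans_lt ((ENNReal.rpow_lt_top_iff_of_pos hp).1 hgn)

/-- Continuous functions within 2^(-j) of f in L^p have measurable maximal functions. The majorants
H_j for the differences have summable p-th power integrals, so they tend to 0 almost everywhere, and
sublinearity yields almost everywhere convergence to the maximal function of f. -/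
lemma PosMaximalBound.aemeasurable_truncMaximal {p : ℝ} (hp : 0 < p) {C : ℝ≥0}
    (hb : 𝔫.PosMaximalBound p C) {I : Set ℝ} (hI : I ⊆ Ioi 0) {f : V × Z → ℂ}
    (hf : MemLp f (ENNReal.ofReal p) volume) :
    AEMeasurable (𝔫.truncMaximal I f) volume := by
  have happ (j : ℕ) : ∃ g : V × Z → ℂ, Continuous g ∧
      eLpNorm (f - g) (ENNReal.ofReal p) volume ≤ (2⁻¹ : ℝ≥0∞) ^ j ∧
      AEStronglyMeasurable (f - g) volume := by
    obtain ⟨g, -, h1, h2, h3⟩ := hf.exists_hasCompactSupport_eLpNorm_sub_le (by simp)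
      (ε := (2⁻¹ : ℝ≥0∞) ^ j) (by simp)
    exact ⟨g, h2, h1, hf.1.sub h3.1⟩
  choose g hgc hgle hgm using happ
  choose H hHm hHle hHint using fun j => hb.exists_majorant hp (hgm j)
  have hsum : ∫⁻ n, ∑' j, H j n ^ p ≠ ∞ := by
    rw [lintegral_tsum fun j => ((hHm j).pow_const p).aemeasurable]
    refine ne_top_of_le_ne_top (b := ∑' j : ℕ, (C : ℝ≥0∞) * ((2⁻¹ : ℝ≥0∞) ^ p) ^ j) ?_
      (ENNReal.tsum_le_tsum fun j => (hHint j).trans ?_)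
    · rw [ENNReal.tsum_mul_left, ENNReal.tsum_geometric]
      refine ENNReal.mul_ne_top (by simp) ?_
      rw [ENNReal.inv_ne_top, ne_eq, tsub_eq_zero_iff_le, not_le]
      exact ENNReal.rpow_lt_one (by norm_num) hp
    · refine mul_le_mul' le_rfl ((ENNReal.rpow_le_rpow (hgle j) hp.le).trans (le_of_eq ?_))
      rw [← ENNReal.rpow_natCast, ← ENNReal.rpow_mul, ← ENNReal.rpow_natCast, ← ENNReal.rpow_mul,
        mul_comm]
  have hH0 : ∀ᵐ n, Tendsto (fun j => H j n) atTop (𝓝 0) := by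
    filter_upwards [ae_lt_top (Measurable.tsum fun j => (hHm j).pow_const p) hsum] with n hn
    have h1 := ENNReal.tendsto_atTop_zero_of_tsum_ne_top hn.ne
    have h2 := (ENNReal.continuous_rpow_const (y := 1 / p)).tendsto (0 : ℝ≥0∞) |>.comp h1
    rw [ENNReal.zero_rpow_of_pos (by positivity)] at h2
    refine h2.congr fun j => ?_
    simp only [Function.comp_apply]
    rw [← ENNReal.rpow_mul, mul_one_div_cancel hp.ne', ENNReal.rpow_one]
  obtain ⟨G, hGm, hGle, hGint⟩ := hb.exists_majorant hp hf.1
  have hGfin : ∫⁻ n, G n ^ p ≠ ∞ := (hGint.trans_lt (ENNReal.mul_lt_top ENNReal.coe_lt_top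
    (ENNReal.rpow_lt_top_of_nonneg hp.le hf.2.ne))).ne
  refine aemeasurable_of_tendsto_metrizable_ae atTop
    (fun j => (measurable_truncMaximal_of_continuous (𝔫 := 𝔫) I (hgc j)).aemeasurable) ?_
  filter_upwards [ae_all_iff.2 hHle, hH0, hb.ae_integrable hp hf, hGle,
    ae_lt_top (hGm.pow_const p) hGfin] with n h1 h2 h3 h4 h5
  have hfin : 𝔫.truncMaximal I f n ≠ ∞ := by
    refine ne_top_of_le_ne_top ((ENNReal.rpow_lt_top_iff_of_pos hp).1 h5).ne
      (iSup₂_le fun s hs => ?_)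
    exact (𝔫.enorm_sphericalMean_le_posMean f s n).trans (h4 s (hI hs))
  rw [ENNReal.tendsto_nhds hfin]
  intro ε hε
  filter_upwards [(ENNReal.tendsto_nhds ENNReal.zero_ne_top).1 h2 ε hε] with j hj
  have hjε : H j n ≤ ε := by simpa using hj.2
  constructor
  · rw [tsub_le_iff_right]
    refine truncMaximal_le_add (fun s hs => h3 s (hI hs))
      (fun s _ => integrable_translate_of_continuous (hgc j) s n) fun s hs => ?_
    exact (h1 j s (hI hs)).trans hjε
  · refine truncMaximal_le_add (fun s _ => integrable_translate_of_continuous (hgc j) s n)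
      (fun s hs => h3 s (hI hs)) fun s hs => ?_
    refine le_trans (le_of_eq ?_) ((h1 j s (hI hs)).trans hjε)
    refine lintegral_congr fun n' => ?_
    exact enorm_sub_rev _ _

/-- For a bounded function the maximal function is an increasing limit of maximal functions of
square integrable functions. -/
lemma PosMaximalBound.aemeasurable_sphericalMaximal_of_memLp_top {C : ℝ≥0}
    (hb : 𝔫.PosMaximalBound 2 C) {f : V × Z → ℂ} (hf : MemLp f ∞ volume) :
    AEMeasurable (𝔫.sphericalMaximal f) volume := by
  -- For n in the ball of radius k and s ≤ k the means see f only on a bounded set, so f can be cut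
  -- off there and becomes square integrable.
  have hR (k : ℕ) : ∃ R : ℝ, ∀ n ∈ Metric.closedBall (0 : V × Z) k, ∀ s ∈ Icc (0 : ℝ) k,
      ∀ n' ∈ Metric.closedBall (0 : V × Z) 1, 𝔫.mul n (-dil s n') ∈ Metric.closedBall 0 R := by
    obtain ⟨R, hR⟩ := ((isCompact_Icc (a := (0 : ℝ)) (b := k)).prod
      ((isCompact_closedBall (0 : V × Z) k).prod
        (isCompact_closedBall (0 : V × Z) 1))).exists_bound_of_continuousOn
      𝔫.continuous_mul_neg_dil.continuousOn
    refine ⟨R, fun n hn s hs n' hn' => ?_⟩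
    rw [mem_closedBall_zero_iff]
    exact hR (s, n, n') ⟨hs, hn, hn'⟩
  choose R hR using hR
  have hmem (k : ℕ) : MemLp ((Metric.closedBall (0 : V × Z) (R k)).indicator f)
      (ENNReal.ofReal 2) volume := by
    rw [memLp_indicator_iff_restrict Metric.isClosed_closedBall.measurableSet]
    have : IsFiniteMeasure (volume.restrict (Metric.closedBall (0 : V × Z) (R k))) :=
      ⟨by simpa using (isCompact_closedBall (0 : V × Z) (R k)).measure_lt_top⟩
    exact (hf.restrict _).mono_exponent le_top
  have heq : 𝔫.sphericalMaximal f = fun n => ⨆ k : ℕ, (Metric.closedBall (0 : V × Z) k).indicator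
      (𝔫.truncMaximal (Ioo 0 (k : ℝ)) ((Metric.closedBall (0 : V × Z) (R k)).indicator f)) n := by
    have hcongr (k : ℕ) (n : V × Z) (hn : n ∈ Metric.closedBall (0 : V × Z) k) :
        𝔫.truncMaximal (Ioo 0 (k : ℝ)) ((Metric.closedBall (0 : V × Z) (R k)).indicator f) n
          = 𝔫.truncMaximal (Ioo 0 (k : ℝ)) f n := by
      refine truncMaximal_congr fun s hs => ?_
      filter_upwards [ae_mem_closedBall_sphereMeasure (V := V) (Z := Z)] with n' hn'
      exact indicator_of_mem (hR k n hn s ⟨hs.1.le, hs.2.le⟩ n' hn') f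
    funext n
    refine le_antisymm (iSup₂_le fun s hs => ?_) (iSup_le fun k => ?_)
    · obtain ⟨k, hk⟩ := exists_nat_gt (max s ‖n‖)
      have hn : n ∈ Metric.closedBall (0 : V × Z) k := by
        rw [mem_closedBall_zero_iff]; exact (le_max_right _ _).trans hk.le
      refine le_iSup_of_le k ?_
      rw [indicator_of_mem hn, hcongr k n hn]
      exact le_iSup₂ (f := fun s (_ : s ∈ Ioo 0 (k : ℝ)) => ‖𝔫.sphericalMean f s n‖ₑ) s
        ⟨hs, (le_max_left _ _).trans_lt hk⟩
    · by_cases hn : n ∈ Metric.closedBall (0 : V × Z) k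
      · rw [indicator_of_mem hn, hcongr k n hn]
        exact iSup₂_le fun s hs =>
          le_iSup₂ (f := fun s (_ : 0 < s) => ‖𝔫.sphericalMean f s n‖ₑ) s hs.1
      · simp [hn]
  rw [heq]
  exact AEMeasurable.iSup fun k => (hb.aemeasurable_truncMaximal (by norm_num)
    (fun s hs => hs.1) (hmem k)).indicator Metric.isClosed_closedBall.measurableSet

variable (𝔫) in
/-- The conclusion of the maximal theorem for the exponent `p` and the constant `C`. -/
def MaximalTheorem (p : ℝ≥0∞) (C : ℝ≥0) : Prop :=
  ∀ f : V × Z → ℂ, MemLp f p volume →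
    (∀ᵐ n : V × Z, ∀ s : ℝ, 0 < s →
      Integrable (𝔫.translate f s n) (sphereMeasure V Z)) ∧
    AEMeasurable (𝔫.sphericalMaximal f) volume ∧
    eLpNorm (𝔫.sphericalMaximal f) p volume ≤ C * eLpNorm f p volume

lemma PosMaximalBound.exists_maximalTheorem {p : ℝ} (hp : 0 < p) {C : ℝ≥0}
    (hb : 𝔫.PosMaximalBound p C) : ∃ C', 𝔫.MaximalTheorem (ENNReal.ofReal p) C' := by
  refine ⟨C ^ (1 / p), fun f hf => ⟨hb.ae_integrable hp hf,
    hb.aemeasurable_truncMaximal hp subset_rfl hf, ?_⟩⟩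
  obtain ⟨g, hg, hle, hint⟩ := hb.exists_majorant hp hf.1
  rw [eLpNorm_eq_lintegral_rpow_enorm_toReal (by simpa using hp) (by simp),
    ENNReal.toReal_ofReal hp.le]
  calc _ ≤ (C * eLpNorm f (ENNReal.ofReal p) volume ^ p) ^ (1 / p) := by
        refine ENNReal.rpow_le_rpow (le_trans (lintegral_mono_ae ?_) hint) (by positivity)
        filter_upwards [hle] with n hn
        refine ENNReal.rpow_le_rpow (iSup₂_le fun s hs => ?_) hp.le
        exact (𝔫.enorm_sphericalMean_le_posMean f s n).trans (hn s hs)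
    _ = _ := by
        rw [ENNReal.mul_rpow_of_nonneg _ _ (by positivity), ← ENNReal.rpow_mul,
          mul_one_div_cancel hp.ne', ENNReal.rpow_one, ENNReal.coe_rpow_of_nonneg _ (by positivity)]

/-- The constant is the mass of μ. The L² bound serves only to ignore null sets on all spheres at
once and to obtain measurability. -/
lemma PosMaximalBound.exists_maximalTheorem_top {C : ℝ≥0} (hb : 𝔫.PosMaximalBound 2 C) :
    ∃ C', 𝔫.MaximalTheorem ∞ C' := by
  refine ⟨(sphereMeasure V Z univ).toNNReal, fun f hf => ?_⟩
  have hB : ((sphereMeasure V Z univ).toNNReal : ℝ≥0∞) = sphereMeasure V Z univ :=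
    ENNReal.coe_toNNReal (measure_ne_top _ _)
  set M := eLpNorm f ∞ volume with hM
  have hMle : ∀ᵐ m, ‖f m‖ₑ ≤ M := by
    rw [hM, eLpNorm_exponent_top]; exact ae_le_eLpNormEssSup
  have hle : ∀ᵐ n, ∀ s, 0 < s →
      𝔫.posMean (fun m => ‖f m‖ₑ) s n ≤ (sphereMeasure V Z univ).toNNReal * M := by
    filter_upwards [hb.ae_forall_ae (by norm_num) hMle] with n hn s hs
    refine (lintegral_mono_ae (hn s hs)).trans (le_of_eq ?_)
    rw [lintegral_const, hB, mul_comm]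
  refine ⟨?_, hb.aemeasurable_sphericalMaximal_of_memLp_top hf, ?_⟩
  · filter_upwards [hle, hb.ae_translate_ae_eq (by norm_num) hf.1.ae_eq_mk] with n hn heq s hs
    refine ⟨?_, ?_⟩
    · exact (hf.1.stronglyMeasurable_mk.comp_measurable
        (𝔫.measurable_mul_neg_dil s n)).aestronglyMeasurable.congr (heq s hs).symm
    · exact (hn s hs).trans_lt (ENNReal.mul_lt_top ENNReal.coe_lt_top hf.2)
  · rw [eLpNorm_exponent_top]
    refine eLpNormEssSup_le_of_ae_enorm_bound ?_
    filter_upwards [hle] with n hn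
    exact iSup₂_le fun s hs => (𝔫.enorm_sphericalMean_le_posMean f s n).trans (hn s hs)

variable (𝔫) in
theorem exists_maximalTheorem (hQ : 0 < homDim V Z) {h : ℕ} (hh : 1 ≤ h)
    {K : ℝ≥0} (hK : ∀ f : 𝓢(V × Z, ℂ),
      eLpNorm (𝔫.areaFunction h f) 2 volume ≤ K * eLpNorm f 2 volume)
    {p : ℝ≥0∞} (hp : ENNReal.ofReal (1 + 1 / (2 * h)) < p) : ∃ C, 𝔫.MaximalTheorem p C := by
  have hh' : (1 : ℝ) ≤ h := by exact_mod_cast hh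
  rcases eq_or_ne p ∞ with rfl | hpt
  · have h2 : (1 + 1 / (2 * h) : ℝ) < 2 := by
      have : (1 / (2 * h) : ℝ) ≤ 1 / 2 := by gcongr; linarith
      linarith
    obtain ⟨C, hC⟩ := 𝔫.exists_posMaximalBound hQ hh hK h2
    exact hC.exists_maximalTheorem_top
  · rw [← ENNReal.ofReal_toReal hpt] at hp ⊢
    have hp' : (1 + 1 / (2 * h) : ℝ) < p.toReal :=
      lt_of_not_ge fun hle => absurd hp (not_lt.2 (ENNReal.ofReal_le_ofReal hle))
    obtain ⟨C, hC⟩ := 𝔫.exists_posMaximalBound hQ hh hK hp'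
    exact hC.exists_maximalTheorem (lt_trans (by positivity) hp')

end TwoStepLieAlgebra

end StrongType

/-! ### Transport of the maximal theorem by isometric isomorphisms. -/

section Isometry

variable {V Z V' Z' : Type*} [NormedAddCommGroup V] [InnerProductSpace ℝ V]
  [FiniteDimensional ℝ V] [MeasurableSpace V] [BorelSpace V]
  [NormedAddCommGroup Z] [InnerProductSpace ℝ Z] [FiniteDimensional ℝ Z]
  [MeasurableSpace Z] [BorelSpace Z]
  [NormedAddCommGroup V'] [InnerProductSpace ℝ V']
  [FiniteDimensional ℝ V'] [MeasurableSpace V'] [BorelSpace V']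
  [NormedAddCommGroup Z'] [InnerProductSpace ℝ Z'] [FiniteDimensional ℝ Z']
  [MeasurableSpace Z'] [BorelSpace Z']

/-- The product of two linear isometries, as a measurable equivalence. -/
def isometryProd (U : V ≃ₗᵢ[ℝ] V') (W : Z ≃ₗᵢ[ℝ] Z') : V × Z ≃ᵐ V' × Z' :=
  MeasurableEquiv.prodCongr U.toMeasurableEquiv W.toMeasurableEquiv

variable (U : V ≃ₗᵢ[ℝ] V') (W : Z ≃ₗᵢ[ℝ] Z')

lemma isometryProd_apply (n : V × Z) : isometryProd U W n = (U n.1, W n.2) := rfl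

lemma measurePreserving_isometryProd :
    MeasurePreserving (isometryProd U W) volume volume :=
  U.measurePreserving.prod W.measurePreserving

lemma koranyiNorm_isometryProd (n : V × Z) :
    koranyiNorm (isometryProd U W n) = koranyiNorm n := by
  simp [koranyiNorm, isometryProd_apply]

lemma isometryProd_dil (s : ℝ) (n : V × Z) :
    isometryProd U W (dil s n) = dil s (isometryProd U W n) := by
  simp [dil, isometryProd_apply]

lemma measurePreserving_isometryProd_sphereMeasure :
    MeasurePreserving (isometryProd U W) (sphereMeasure V Z) (sphereMeasure V' Z') := by
  refine ⟨(isometryProd U W).measurable, ?_⟩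
  have hQ : homDim V Z = homDim V' Z' := by
    rw [homDim, homDim, U.toLinearEquiv.finrank_eq, W.toLinearEquiv.finrank_eq]
  have hproj : Measurable fun n : V × Z => dil (koranyiNorm n)⁻¹ n :=
    measurable_dil.comp (measurable_koranyiNorm.inv.prodMk measurable_id)
  have hproj' : Measurable fun n : V' × Z' => dil (koranyiNorm n)⁻¹ n :=
    measurable_dil.comp (measurable_koranyiNorm.inv.prodMk measurable_id)
  have hB : MeasurableSet {n : V' × Z' | 0 < koranyiNorm n ∧ koranyiNorm n < 1} :=
    (measurableSet_lt measurable_const measurable_koranyiNorm).inter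
      (measurableSet_lt measurable_koranyiNorm measurable_const)
  have hres := ((measurePreserving_isometryProd U W).restrict_preimage hB).map_eq
  have hpre : isometryProd U W ⁻¹' {n : V' × Z' | 0 < koranyiNorm n ∧ koranyiNorm n < 1}
      = {n : V × Z | 0 < koranyiNorm n ∧ koranyiNorm n < 1} := by
    ext n
    simp [koranyiNorm_isometryProd]
  rw [hpre] at hres
  unfold sphereMeasure
  rw [Measure.map_smul, Measure.map_map (isometryProd U W).measurable hproj, ← hres,
    Measure.map_map hproj' (isometryProd U W).measurable, hQ]
  congr 2
  funext n
  simp only [Function.comp_apply, isometryProd_dil, koranyiNorm_isometryProd]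

namespace TwoStepLieAlgebra

variable {U W} {𝔫 : TwoStepLieAlgebra V Z} {𝔫' : TwoStepLieAlgebra V' Z'}

lemma translate_isometryProd
    (hUW : ∀ X Y, 𝔫'.bracket (U X) (U Y) = W (𝔫.bracket X Y))
    (f : V' × Z' → ℂ) (s : ℝ) (n n' : V × Z) :
    𝔫'.translate f s (isometryProd U W n) (isometryProd U W n')
      = 𝔫.translate (f ∘ isometryProd U W) s n n' := by
  unfold translate
  rw [← isometryProd_dil, Function.comp_apply]
  congr 1
  simp only [mul, isometryProd_apply, Prod.fst_neg, Prod.snd_neg, ← map_neg, hUW]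
  simp

lemma sphericalMean_isometryProd
    (hUW : ∀ X Y, 𝔫'.bracket (U X) (U Y) = W (𝔫.bracket X Y))
    (f : V' × Z' → ℂ) (s : ℝ) (n : V × Z) :
    𝔫'.sphericalMean f s (isometryProd U W n)
      = 𝔫.sphericalMean (f ∘ isometryProd U W) s n := by
  unfold sphericalMean
  rw [← (measurePreserving_isometryProd_sphereMeasure U W).integral_comp
    (isometryProd U W).measurableEmbedding]
  simp only [translate_isometryProd hUW]

lemma sphericalMaximal_isometryProd
    (hUW : ∀ X Y, 𝔫'.bracket (U X) (U Y) = W (𝔫.bracket X Y))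
    (f : V' × Z' → ℂ) (n : V × Z) :
    𝔫'.sphericalMaximal f (isometryProd U W n)
      = 𝔫.sphericalMaximal (f ∘ isometryProd U W) n := by
  simp only [sphericalMaximal, sphericalMean_isometryProd hUW]

lemma MaximalTheorem.of_isometry
    (hUW : ∀ X Y, 𝔫'.bracket (U X) (U Y) = W (𝔫.bracket X Y))
    {p : ℝ≥0∞} {C : ℝ≥0} (h : 𝔫.MaximalTheorem p C) :
    𝔫'.MaximalTheorem p C := by
  intro f hf
  have hΦ := measurePreserving_isometryProd U W
  have hΦs : MeasurePreserving (isometryProd U W).symm volume volume :=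
    hΦ.symm (isometryProd U W)
  obtain ⟨h1, h2, h3⟩ := h (f ∘ isometryProd U W) (hf.comp_measurePreserving hΦ)
  have hmax : 𝔫'.sphericalMaximal f
      = 𝔫.sphericalMaximal (f ∘ isometryProd U W) ∘ (isometryProd U W).symm := by
    funext n
    rw [Function.comp_apply, ← sphericalMaximal_isometryProd hUW, MeasurableEquiv.apply_symm_apply]
  refine ⟨?_, ?_, ?_⟩
  · filter_upwards [hΦs.quasiMeasurePreserving.ae h1] with n hn s hs
    have h4 := hn s hs
    rw [← (measurePreserving_isometryProd_sphereMeasure U W).integrable_comp_emb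
      (isometryProd U W).measurableEmbedding]
    refine h4.congr (Filter.Eventually.of_forall fun n' => ?_)
    rw [Function.comp_apply]
    conv_rhs => rw [← (isometryProd U W).apply_symm_apply n]
    rw [translate_isometryProd hUW]
  · rw [hmax]
    exact h2.comp_quasiMeasurePreserving hΦs.quasiMeasurePreserving
  · rw [hmax, eLpNorm_comp_measurePreserving h2.aestronglyMeasurable hΦs]
    refine h3.trans (le_of_eq ?_)
    rw [eLpNorm_comp_measurePreserving hf.1 hΦ]

end TwoStepLieAlgebra

end Isometry

/-! ### Structure constants determine the algebra up to isometry. -/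

section StructureConstants

variable {V Z V' Z' : Type*} [NormedAddCommGroup V] [InnerProductSpace ℝ V]
  [FiniteDimensional ℝ V] [NormedAddCommGroup Z] [InnerProductSpace ℝ Z] [FiniteDimensional ℝ Z]
  [NormedAddCommGroup V'] [InnerProductSpace ℝ V']
  [FiniteDimensional ℝ V'] [NormedAddCommGroup Z'] [InnerProductSpace ℝ Z']
  [FiniteDimensional ℝ Z'] {v z : ℕ}

namespace TwoStepLieAlgebra

/-- `r` are the structure constants of the Lie algebra in suitable orthonormal bases. -/
def HasStructureConstants (𝔫 : TwoStepLieAlgebra V Z)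
    (r : Fin z → Matrix (Fin v) (Fin v) ℝ) : Prop :=
  ∃ (e : OrthonormalBasis (Fin v) ℝ V) (ε : OrthonormalBasis (Fin z) ℝ Z),
    ∀ k i j, inner ℝ (ε k) (𝔫.bracket (e i) (e j)) = r k i j

lemma HasStructureConstants.exists_isometry {𝔫 : TwoStepLieAlgebra V Z}
    {𝔫' : TwoStepLieAlgebra V' Z'} {r : Fin z → Matrix (Fin v) (Fin v) ℝ}
    (h : 𝔫.HasStructureConstants r) (h' : 𝔫'.HasStructureConstants r) :
    ∃ (U : V ≃ₗᵢ[ℝ] V') (W : Z ≃ₗᵢ[ℝ] Z'),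
      ∀ X Y, 𝔫'.bracket (U X) (U Y) = W (𝔫.bracket X Y) := by
  obtain ⟨e, ε, he⟩ := h
  obtain ⟨e', ε', he'⟩ := h'
  set U := e.equiv e' (Equiv.refl _) with hU
  set W := ε.equiv ε' (Equiv.refl _) with hW
  have hUe (i) : U (e i) = e' i := by simp [hU]
  have hWe (i) : W (ε i) = ε' i := by simp [hW]
  refine ⟨U, W, fun X Y => ?_⟩
  have key : 𝔫'.bracket.compl₁₂ U.toLinearEquiv.toLinearMap U.toLinearEquiv.toLinearMap
      = 𝔫.bracket.compr₂ W.toLinearEquiv.toLinearMap := by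
    refine e.toBasis.ext fun i => e.toBasis.ext fun j => ?_
    simp only [OrthonormalBasis.coe_toBasis, LinearMap.compl₁₂_apply, LinearMap.compr₂_apply]
    change 𝔫'.bracket (U (e i)) (U (e j)) = W (𝔫.bracket (e i) (e j))
    rw [hUe, hUe]
    refine ε'.repr.injective (PiLp.ext fun k => ?_)
    rw [OrthonormalBasis.repr_apply_apply, OrthonormalBasis.repr_apply_apply, he', ← hWe k, W.inner_map_map, he]
  exact LinearMap.congr_fun (LinearMap.congr_fun key X) Y

end TwoStepLieAlgebra

end StructureConstants

/-! ### Rigidity and compactness of Clifford tuples. -/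

section CliffordTuples

open Matrix

variable {v z : ℕ}

/-- The tuples of skew-symmetric orthogonal matrices that anticommute pairwise. -/
def cliffordTuples (v z : ℕ) : Set (Fin z → Matrix (Fin v) (Fin v) ℝ) :=
  {R | (∀ k, (R k)ᵀ = -R k) ∧ (∀ k, R k * R k = -1) ∧
    ∀ k l, k ≠ l → R k * R l = -(R l * R k)}

/-- Skew-symmetry and R² = -1 make R orthogonal, so its rows are unit vectors. -/
lemma abs_apply_le_one_of_mem_cliffordTuples {R : Fin z → Matrix (Fin v) (Fin v) ℝ}
    (hR : R ∈ cliffordTuples v z) (k : Fin z) (i j : Fin v) : |R k i j| ≤ 1 := by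
  have h1 : R k * (R k)ᵀ = 1 := by rw [hR.1 k, mul_neg, hR.2.1 k, neg_neg]
  have h2 : ∑ m, R k i m * R k i m = 1 := by
    have := congrFun (congrFun h1 i) i
    simpa [Matrix.mul_apply] using this
  have h3 : R k i j * R k i j ≤ 1 := by
    rw [← h2]
    exact Finset.single_le_sum (f := fun m => R k i m * R k i m)
      (fun m _ => mul_self_nonneg _) (Finset.mem_univ j)
  rw [abs_le]
  constructor <;> nlinarith

lemma isCompact_cliffordTuples : IsCompact (cliffordTuples v z) := by
  have hbox : IsCompact (Set.pi univ fun _ : Fin z => (Set.pi univ fun _ : Fin v =>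
      Set.pi univ fun _ : Fin v => Icc (-1 : ℝ) 1 : Set (Matrix (Fin v) (Fin v) ℝ))) :=
    isCompact_univ_pi fun _ => isCompact_univ_pi fun _ => isCompact_univ_pi fun _ => isCompact_Icc
  refine hbox.of_isClosed_subset ?_ fun R hR k _ i _ j _ => abs_le.1
    (abs_apply_le_one_of_mem_cliffordTuples hR k i j)
  have hk (k : Fin z) : Continuous fun R : Fin z → Matrix (Fin v) (Fin v) ℝ => R k :=
    continuous_apply k
  simp only [cliffordTuples, ofPred_and, ofPred_forall]
  refine (isClosed_iInter fun k => ?_).inter ((isClosed_iInter fun k => ?_).inter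
    (isClosed_iInter fun k => isClosed_iInter fun l => isClosed_iInter fun _ => ?_))
  · exact isClosed_eq (hk k).matrix_transpose (hk k).neg
  · exact isClosed_eq ((hk k).mul (hk k)) continuous_const
  · exact isClosed_eq ((hk k).mul (hk l)) ((hk l).mul (hk k)).neg

/-- An averaged matrix that intertwines two Clifford tuples. -/
def intertwiner (R R' : Fin z → Matrix (Fin v) (Fin v) ℝ) (l : List (Fin z)) :
    Matrix (Fin v) (Fin v) ℝ :=
  l.foldr (fun k T => (2⁻¹ : ℝ) • (T - R' k * T * R k)) 1

lemma intertwiner_cons (R R' : Fin z → Matrix (Fin v) (Fin v) ℝ) (k : Fin z) (l : List (Fin z)) :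
    intertwiner R R' (k :: l)
      = (2⁻¹ : ℝ) • (intertwiner R R' l - R' k * intertwiner R R' l * R k) := rfl

/-- The base point of the rigidity argument: by continuity in R', the averaged matrix remains
invertible for R' close to R. -/
lemma intertwiner_self {R : Fin z → Matrix (Fin v) (Fin v) ℝ} (hR : R ∈ cliffordTuples v z)
    (l : List (Fin z)) : intertwiner R R l = 1 := by
  induction l with
  | nil => rfl
  | cons k l ih =>
    rw [intertwiner_cons, ih, mul_one, hR.2.1 k, sub_neg_eq_add, ← two_smul ℝ, smul_smul]
    norm_num

lemma continuous_intertwiner (R : Fin z → Matrix (Fin v) (Fin v) ℝ) (l : List (Fin z)) :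
    Continuous fun R' => intertwiner R R' l := by
  induction l with
  | nil => exact continuous_const
  | cons k l ih =>
    simp only [intertwiner_cons]
    exact (ih.sub (((continuous_apply k).mul ih).mul continuous_const)).const_smul (2⁻¹ : ℝ)

/-- As R_k⁻¹ = -R_k, each step averages T with R'_k T R_k⁻¹, and this average intertwines the k-th
matrices. Relations already obtained for other indices survive, because the two anticommutation
signs cancel. -/
lemma intertwiner_intertwines {R R' : Fin z → Matrix (Fin v) (Fin v) ℝ}
    (hR : R ∈ cliffordTuples v z) (hR' : R' ∈ cliffordTuples v z) (l : List (Fin z)) :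
    ∀ k ∈ l, R' k * intertwiner R R' l = intertwiner R R' l * R k := by
  induction l with
  | nil => simp
  | cons m l ih =>
    intro k hk
    rw [intertwiner_cons]
    set T := intertwiner R R' l
    rw [mul_smul_comm, smul_mul_assoc, mul_sub, sub_mul]
    congr 1
    by_cases hkm : k = m
    · subst hkm
      have e1 : R' k * (R' k * T * R k) = -(T * R k) := by
        rw [← mul_assoc, ← mul_assoc, hR'.2.1 k, neg_one_mul, neg_mul]
      have e2 : R' k * T * R k * R k = -(R' k * T) := by
        rw [mul_assoc, hR.2.1 k, mul_neg_one]
      rw [e1, e2]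
      abel
    · have hT := ih k ((List.mem_cons.1 hk).resolve_left hkm)
      have e1 : R' k * (R' m * T * R m) = R' m * T * R m * R k := by
        calc R' k * (R' m * T * R m) = (R' k * R' m) * T * R m := by simp only [mul_assoc]
          _ = -(R' m * (R' k * T) * R m) := by
            rw [hR'.2.2 k m hkm]; simp only [neg_mul, mul_assoc]
          _ = R' m * T * -(R k * R m) := by rw [hT]; simp only [mul_neg, mul_assoc]
          _ = R' m * T * R m * R k := by
            rw [hR.2.2 k m hkm, neg_neg]; simp only [mul_assoc]
      rw [e1, hT]

/-- An invertible matrix that intertwines two Clifford tuples can be replaced by an orthogonal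
one, its polar part. -/
lemma exists_orthogonal_intertwiner {R R' : Fin z → Matrix (Fin v) (Fin v) ℝ}
    (hR : R ∈ cliffordTuples v z) (hR' : R' ∈ cliffordTuples v z) {T : Matrix (Fin v) (Fin v) ℝ}
    (hT : T.det ≠ 0) (hTR : ∀ k, R' k * T = T * R k) :
    ∃ U : Matrix (Fin v) (Fin v) ℝ, Uᵀ * U = 1 ∧ ∀ k, R' k * U = U * R k := by
  have hTu : IsUnit T := (Matrix.isUnit_iff_isUnit_det T).2 (isUnit_iff_ne_zero.2 hT)
  -- The orthogonal factor is T P^(-1/2). Transposing the intertwining relation shows that P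
  -- commutes with every R_k, hence so does its inverse square root.
  set P := Tᵀ * T with hP
  have hPpos : P.PosDef := by
    have := Matrix.PosDef.conjTranspose_mul_self T (Matrix.mulVec_injective_of_isUnit hTu)
    rwa [Matrix.conjTranspose_eq_transpose_of_trivial] at this
  have hPsa : IsSelfAdjoint P := hPpos.isHermitian
  have hPR (k : Fin z) : Commute P (R k) := by
    have h1 : Tᵀ * R' k = R k * Tᵀ := by
      have := congrArg Matrix.transpose (hTR k)
      rw [Matrix.transpose_mul, Matrix.transpose_mul, hR.1, hR'.1, mul_neg, neg_mul] at this
      exact neg_injective this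
    change Tᵀ * T * R k = R k * (Tᵀ * T)
    rw [mul_assoc, ← hTR, ← mul_assoc, h1, mul_assoc]
  have hspec : ∀ x ∈ spectrum ℝ P, 0 < x := fun x hx => by
    rw [hPpos.isHermitian.spectrum_real_eq_range_eigenvalues] at hx
    obtain ⟨i, rfl⟩ := hx
    exact hPpos.eigenvalues_pos i
  set φ : ℝ → ℝ := fun x => (Real.sqrt x)⁻¹ with hφ
  have hφc : ContinuousOn φ (spectrum ℝ P) := fun x hx =>
    (Real.continuous_sqrt.continuousAt.inv₀
      (Real.sqrt_pos.2 (hspec x hx)).ne').continuousWithinAt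
  set S := cfc φ P with hS
  have hSsa : Sᵀ = S := by
    have : IsSelfAdjoint S := cfc_predicate φ P
    have h1 : star S = S := this
    rwa [Matrix.star_eq_conjTranspose, Matrix.conjTranspose_eq_transpose_of_trivial] at h1
  have hSPS : S * P * S = 1 := by
    have h1 : S * P = cfc (fun x => φ x * x) P := by
      conv_lhs => rw [hS, ← cfc_id' ℝ P]
      rw [cfc_id' ℝ P]
      rw [cfc_mul φ (fun x => x) P hφc continuousOn_id, cfc_id' ℝ P]
    rw [h1, hS, ← cfc_mul (fun x => φ x * x) φ P (hφc.mul continuousOn_id) hφc, ← cfc_one ℝ P]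
    refine cfc_congr fun x hx => ?_
    have hx0 := hspec x hx
    simp only [hφ, Pi.one_apply]
    rw [mul_right_comm, ← mul_inv, Real.mul_self_sqrt hx0.le, inv_mul_cancel₀ hx0.ne']
  have hSR (k : Fin z) : Commute S (R k) := (hPR k).cfc (by rw [hPsa.star_eq]; exact hPR k) φ
  refine ⟨T * S, ?_, fun k => ?_⟩
  · rw [Matrix.transpose_mul, hSsa, ← mul_assoc, mul_assoc S, ← hP, hSPS]
  · rw [← mul_assoc, hTR, mul_assoc, mul_assoc, (hSR k).eq]

/-- Up to orthogonal equivalence there are only finitely many Clifford tuples. -/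
lemma exists_finset_cliffordTuples (v z : ℕ) :
    ∃ t : Finset (Fin z → Matrix (Fin v) (Fin v) ℝ), ∀ R' ∈ cliffordTuples v z, ∃ R ∈ t,
      ∃ U : Matrix (Fin v) (Fin v) ℝ, Uᵀ * U = 1 ∧ ∀ k, R' k * U = U * R k := by
  -- Around each R the tuples R' with invertible averaged intertwiner form a neighbourhood; finitely
  -- many of these cover the compact set.
  obtain ⟨t, ht, hcov⟩ := (isCompact_cliffordTuples (v := v) (z := z)).elim_nhds_subcover
    (fun R => {R' | (intertwiner R R' (List.finRange z)).det ≠ 0}) fun R hR => by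
      refine (isOpen_ne_fun (continuous_intertwiner R _).matrix_det continuous_const).mem_nhds ?_
      change (intertwiner R R (List.finRange z)).det ≠ 0
      rw [intertwiner_self hR]
      simp
  refine ⟨t, fun R' hR' => ?_⟩
  obtain ⟨R, hRt, hdet⟩ := mem_iUnion₂.1 (hcov hR')
  exact ⟨R, hRt, exists_orthogonal_intertwiner (ht R hRt) hR' hdet
    fun k => intertwiner_intertwines (ht R hRt) hR' _ k (List.mem_finRange k)⟩

end CliffordTuples

/-! ### Finitely many isometry classes for given dimensions. -/

section Classification

open Matrix

variable {V Z : Type*} [NormedAddCommGroup V] [InnerProductSpace ℝ V]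
  [FiniteDimensional ℝ V] [NormedAddCommGroup Z] [InnerProductSpace ℝ Z] [FiniteDimensional ℝ Z]
  {v z : ℕ}

namespace TwoStepLieAlgebra

lemma inner_J_comm (𝔫 : TwoStepLieAlgebra V Z) (A : Z) (X Y : V) :
    inner ℝ (𝔫.J A X) Y = -inner ℝ X (𝔫.J A Y) := by
  rw [inner_J, bracket_swap, inner_neg_right, ← inner_J, real_inner_comm]

lemma J_add (𝔫 : TwoStepLieAlgebra V Z) (A B : Z) (X : V) :
    𝔫.J (A + B) X = 𝔫.J A X + 𝔫.J B X :=
  map_add (LinearMap.adjoint (𝔫.bracket X)) A B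

lemma IsHType.J_J {𝔫 : TwoStepLieAlgebra V Z} (h : 𝔫.IsHType) (A : Z) (X : V) :
    𝔫.J A (𝔫.J A X) = -(‖A‖ ^ 2) • X := by
  simpa using LinearMap.congr_fun (h.2.2 A) X

/-- Polarization of J(A)² = -|A|² Id. -/
lemma IsHType.J_anticomm {𝔫 : TwoStepLieAlgebra V Z} (h : 𝔫.IsHType) {A B : Z}
    (hAB : inner ℝ A B = 0) (X : V) : 𝔫.J A (𝔫.J B X) = -𝔫.J B (𝔫.J A X) := by
  have h1 := h.J_J (A + B) X
  rw [J_add, J_add, map_add, map_add, h.J_J, h.J_J, norm_add_sq_real, hAB] at h1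
  have h2 : 𝔫.J A (𝔫.J B X) + 𝔫.J B (𝔫.J A X) = 0 := by
    have e : -(‖A‖ ^ 2 + 2 * 0 + ‖B‖ ^ 2) • X = -(‖A‖ ^ 2) • X + -(‖B‖ ^ 2) • X := by
      rw [← add_smul]; congr 1; ring
    rw [e] at h1
    have h3 := sub_eq_zero.2 h1
    rw [← h3]
    abel
  exact eq_neg_of_add_eq_zero_left h2

/-- The matrices of the structure constants in given orthonormal bases. -/
def structureMatrix (𝔫 : TwoStepLieAlgebra V Z) (e : OrthonormalBasis (Fin v) ℝ V)
    (ε : OrthonormalBasis (Fin z) ℝ Z) (k : Fin z) : Matrix (Fin v) (Fin v) ℝ :=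
  Matrix.of fun i j => inner ℝ (ε k) (𝔫.bracket (e i) (e j))

/-- Row i of the k-th matrix holds the coordinates of J(ε_k)e_i, so matrix multiplication composes
the maps J in the opposite order. -/
lemma structureMatrix_mul_apply (𝔫 : TwoStepLieAlgebra V Z) (e : OrthonormalBasis (Fin v) ℝ V)
    (ε : OrthonormalBasis (Fin z) ℝ Z) (k l : Fin z) (i j : Fin v) :
    (𝔫.structureMatrix e ε k * 𝔫.structureMatrix e ε l) i j
      = inner ℝ (𝔫.J (ε l) (𝔫.J (ε k) (e i))) (e j) := by
  rw [inner_J_comm, ← OrthonormalBasis.sum_inner_mul_inner e, Matrix.mul_apply,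
    ← Finset.sum_neg_distrib]
  refine Finset.sum_congr rfl fun m _ => ?_
  simp only [structureMatrix, Matrix.of_apply, ← inner_J]
  rw [inner_J_comm 𝔫 (ε l)]
  ring

lemma IsHType.structureMatrix_mem {𝔫 : TwoStepLieAlgebra V Z} (h : 𝔫.IsHType)
    (e : OrthonormalBasis (Fin v) ℝ V) (ε : OrthonormalBasis (Fin z) ℝ Z) :
    𝔫.structureMatrix e ε ∈ cliffordTuples v z := by
  refine ⟨fun k => ?_, fun k => ?_, fun k l hkl => ?_⟩
  · ext i j
    simp only [structureMatrix, Matrix.transpose_apply, Matrix.of_apply, Matrix.neg_apply]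
    rw [bracket_swap, inner_neg_right]
  · ext i j
    rw [structureMatrix_mul_apply, h.J_J, ε.norm_eq_one]
    simp [orthonormal_iff_ite.1 e.orthonormal, Matrix.one_apply]
  · ext i j
    rw [structureMatrix_mul_apply, Matrix.neg_apply, structureMatrix_mul_apply,
      h.J_anticomm (ε.orthonormal.2 hkl.symm), inner_neg_left]

/-- Changing the basis of `V` by an orthogonal matrix. -/
lemma hasStructureConstants_of_orthogonal (𝔫 : TwoStepLieAlgebra V Z)
    (e : OrthonormalBasis (Fin v) ℝ V) (ε : OrthonormalBasis (Fin z) ℝ Z)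
    {R : Fin z → Matrix (Fin v) (Fin v) ℝ} {U : Matrix (Fin v) (Fin v) ℝ} (hU : Uᵀ * U = 1)
    (hUR : ∀ k, 𝔫.structureMatrix e ε k * U = U * R k) : 𝔫.HasStructureConstants R := by
  set f : Fin v → V := fun i => ∑ m, U m i • e m with hf
  have hon : Orthonormal ℝ f := by
    rw [orthonormal_iff_ite]
    intro i j
    have h1 := congrFun (congrFun hU i) j
    rw [Matrix.mul_apply, Matrix.one_apply] at h1
    rw [← h1, hf]
    simp only [sum_inner, inner_sum, inner_smul_left, inner_smul_right,
      orthonormal_iff_ite.1 e.orthonormal, Matrix.transpose_apply]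
    simp [mul_comm]
  have hcard : Fintype.card (Fin v) = Module.finrank ℝ V := by
    rw [Module.finrank_eq_card_basis e.toBasis]
  obtain ⟨b, hb⟩ : ∃ b : OrthonormalBasis (Fin v) ℝ V, ⇑b = f := by
    refine ⟨OrthonormalBasis.mk hon ?_, OrthonormalBasis.coe_mk _ _⟩
    rw [hon.linearIndependent.span_eq_top_of_card_eq_finrank' hcard]
  refine ⟨b, ε, fun k i j => ?_⟩
  have h2 : Uᵀ * (𝔫.structureMatrix e ε k * U) = R k := by
    rw [hUR, ← mul_assoc, hU, one_mul]
  rw [← h2, hb, hf]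
  simp only [map_sum, map_smul, LinearMap.sum_apply, LinearMap.smul_apply, inner_sum,
    inner_smul_right, Matrix.mul_apply, Matrix.transpose_apply, structureMatrix, Matrix.of_apply,
    Finset.mul_sum]
  rw [Finset.sum_comm]
  refine Finset.sum_congr rfl fun m _ => Finset.sum_congr rfl fun n _ => ?_
  ring

/-- The structure constants of the free two-step nilpotent Lie algebra. -/
def freeConstants (σ : Fin z ≃ {ij : Fin v × Fin v // ij.1 < ij.2}) (k : Fin z) :
    Matrix (Fin v) (Fin v) ℝ :=
  Matrix.of fun i j =>
    (if (σ k).1 = (i, j) then 1 else 0) - if (σ k).1 = (j, i) then 1 else 0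

/-- Every enumeration σ of the pairs i < j is allowed, since σ merely reorders the orthonormal basis
of Z. One fixed σ therefore serves all free algebras of the given dimensions. -/
lemma hasStructureConstants_free {𝔫 : TwoStepLieAlgebra V Z} (h : 𝔫.IsFree)
    (hv : Module.finrank ℝ V = v) (σ : Fin z ≃ {ij : Fin v × Fin v // ij.1 < ij.2}) :
    𝔫.HasStructureConstants (freeConstants σ) := by
  subst hv
  obtain ⟨e, E, hE⟩ := h
  refine ⟨e, E.reindex σ.symm, fun k i j => ?_⟩
  have hlt {i j : Fin (Module.finrank ℝ V)} (hij : i < j) :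
      inner ℝ (E.reindex σ.symm k) (𝔫.bracket (e i) (e j)) = if (σ k).1 = (i, j) then 1 else 0 := by
    rw [← hE ⟨(i, j), hij⟩, OrthonormalBasis.reindex_apply, Equiv.symm_symm,
      orthonormal_iff_ite.1 E.orthonormal]
    simp [Subtype.ext_iff]
  have hne {i j : Fin (Module.finrank ℝ V)} (hij : j ≤ i) : (σ k).1 ≠ (i, j) := fun heq => by
    have := (σ k).2
    rw [heq] at this
    exact absurd this (not_lt.2 hij)
  simp only [freeConstants, Matrix.of_apply]
  rcases lt_trichotomy i j with hij | rfl | hij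
  · rw [hlt hij, if_neg (hne hij.le), sub_zero]
  · rw [𝔫.bracket_self, inner_zero_right, sub_self]
  · rw [bracket_swap, inner_neg_right, hlt hij, if_neg (hne hij.le), zero_sub]

lemma card_eq_of_isFree {𝔫 : TwoStepLieAlgebra V Z} (h : 𝔫.IsFree)
    (hv : Module.finrank ℝ V = v) (hz : Module.finrank ℝ Z = z) :
    Nonempty (Fin z ≃ {ij : Fin v × Fin v // ij.1 < ij.2}) := by
  subst hv
  obtain ⟨_, E, _⟩ := h
  refine Fintype.card_eq.1 ?_
  rw [Fintype.card_fin, ← hz, Module.finrank_eq_card_basis E.toBasis]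

end TwoStepLieAlgebra

/-- Up to isometric isomorphism there are only finitely many H-type and free two-step nilpotent
Lie algebras of given dimensions. -/
theorem exists_finset_structureConstants (v z : ℕ) :
    ∃ t : Finset (Fin z → Matrix (Fin v) (Fin v) ℝ), ∀ (V Z : Type*)
      [NormedAddCommGroup V] [InnerProductSpace ℝ V] [FiniteDimensional ℝ V]
      [NormedAddCommGroup Z] [InnerProductSpace ℝ Z] [FiniteDimensional ℝ Z]
      (𝔫 : TwoStepLieAlgebra V Z),
      Module.finrank ℝ V = v → Module.finrank ℝ Z = z → (𝔫.IsHType ∨ 𝔫.IsFree) →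
      ∃ r ∈ t, 𝔫.HasStructureConstants r := by
  classical
  obtain ⟨t, ht⟩ := exists_finset_cliffordTuples v z
  let u : Finset (Fin z → Matrix (Fin v) (Fin v) ℝ) :=
    if h : Nonempty (Fin z ≃ {ij : Fin v × Fin v // ij.1 < ij.2}) then
      {TwoStepLieAlgebra.freeConstants h.some} else ∅
  refine ⟨t ∪ u, ?_⟩
  intro V Z _ _ _ _ _ _ 𝔫 hv hz h𝔫
  rcases h𝔫 with h | h
  · let e : OrthonormalBasis (Fin v) ℝ V := (stdOrthonormalBasis ℝ V).reindex (finCongr hv)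
    let ε : OrthonormalBasis (Fin z) ℝ Z := (stdOrthonormalBasis ℝ Z).reindex (finCongr hz)
    obtain ⟨R, hRt, U, hU, hUR⟩ := ht _ (h.structureMatrix_mem e ε)
    exact ⟨R, Finset.mem_union_left _ hRt, 𝔫.hasStructureConstants_of_orthogonal e ε hU hUR⟩
  · have hne := TwoStepLieAlgebra.card_eq_of_isFree h hv hz
    refine ⟨TwoStepLieAlgebra.freeConstants hne.some, Finset.mem_union_right _ ?_,
      TwoStepLieAlgebra.hasStructureConstants_free h hv hne.some⟩
    simp only [u, dif_pos hne, Finset.mem_singleton]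

end Classification

/-! ### A constant independent of the algebra. -/

section Uniformity

universe u w

/-- For Lie algebras with given structure constants the constant in the maximal theorem is
uniform. -/
lemma exists_maximalTheorem_of_structureConstants {v z h : ℕ} (hv : 0 < v) (hh : 1 ≤ h)
    {p : ℝ≥0∞} (hp : ENNReal.ofReal (1 + 1 / (2 * h)) < p)
    (r : Fin z → Matrix (Fin v) (Fin v) ℝ) :
    ∃ C : ℝ≥0, ∀ (V : Type u) (Z : Type w)
      [NormedAddCommGroup V] [InnerProductSpace ℝ V] [FiniteDimensional ℝ V]
      [MeasurableSpace V] [BorelSpace V]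
      [NormedAddCommGroup Z] [InnerProductSpace ℝ Z] [FiniteDimensional ℝ Z]
      [MeasurableSpace Z] [BorelSpace Z] (𝔫 : TwoStepLieAlgebra V Z),
      𝔫.HasStructureConstants r →
      (∃ K : ℝ≥0, ∀ f : 𝓢(V × Z, ℂ),
        eLpNorm (𝔫.areaFunction h f) 2 volume ≤ K * eLpNorm f 2 volume) →
      𝔫.MaximalTheorem p C := by
  -- The bound K is not controlled uniformly. If no algebra with these constants had a bounded area
  -- function, any C would do; otherwise the constant of one such algebra works for all others by
  -- isometry. The contradiction hypothesis supplies that algebra (with C = 0) and then a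
  -- counterexample to its constant.
  by_contra hcon
  have hcon' : ∀ C : ℝ≥0, ∃ (V : Type u) (Z : Type w)
      (_ : NormedAddCommGroup V) (_ : InnerProductSpace ℝ V) (_ : FiniteDimensional ℝ V)
      (_ : MeasurableSpace V) (_ : BorelSpace V)
      (_ : NormedAddCommGroup Z) (_ : InnerProductSpace ℝ Z) (_ : FiniteDimensional ℝ Z)
      (_ : MeasurableSpace Z) (_ : BorelSpace Z) (𝔫 : TwoStepLieAlgebra V Z),
      𝔫.HasStructureConstants r ∧
      (∃ K : ℝ≥0, ∀ f : 𝓢(V × Z, ℂ),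
        eLpNorm (𝔫.areaFunction h f) 2 volume ≤ K * eLpNorm f 2 volume) ∧
      ¬𝔫.MaximalTheorem p C := by
    intro C
    by_contra hC
    refine hcon ⟨C, ?_⟩
    intro V Z i1 i2 i3 i4 i5 i6 i7 i8 i9 i10 𝔫 h1 h2
    by_contra h3
    exact hC ⟨V, Z, i1, i2, i3, i4, i5, i6, i7, i8, i9, i10, 𝔫, h1, h2, h3⟩
  obtain ⟨V₀, Z₀, _, _, _, _, _, _, _, _, _, _, 𝔫₀, h₀, ⟨K, hK⟩, -⟩ := hcon' 0
  have hQ : 0 < homDim V₀ Z₀ := by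
    obtain ⟨e, -, -⟩ := h₀
    have : Module.finrank ℝ V₀ = v := by
      rw [Module.finrank_eq_card_basis e.toBasis, Fintype.card_fin]
    unfold homDim
    omega
  obtain ⟨C, hC⟩ := 𝔫₀.exists_maximalTheorem hQ hh hK hp
  obtain ⟨V₁, Z₁, _, _, _, _, _, _, _, _, _, _, 𝔫₁, h₁, -, hnot⟩ := hcon' C
  obtain ⟨U, W, hUW⟩ := h₀.exists_isometry h₁
  exact hnot (hC.of_isometry hUW)

end Uniformity

end

theorem mainTheorem6 (v z h : ℕ) (p : ℝ≥0∞) (hv : 2 ≤ v / 2) (hh : 1 ≤ h)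
    (hhQ : (h : ℝ) < ((v + 2 * z : ℝ) - 2) / 2)
    (hp : (h = 1 ∧ 2 ≤ p) ∨
      (1 < h ∧ ENNReal.ofReal (2 * (h : ℝ) / (2 * (h : ℝ) - 1)) < p)) :
    ∃ C : ℝ≥0, ∀ (V Z : Type*)
      [NormedAddCommGroup V] [InnerProductSpace ℝ V] [FiniteDimensional ℝ V]
      [MeasurableSpace V] [BorelSpace V]
      [NormedAddCommGroup Z] [InnerProductSpace ℝ Z] [FiniteDimensional ℝ Z]
      [MeasurableSpace Z] [BorelSpace Z] (𝔫 : TwoStepLieAlgebra V Z),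
      Module.finrank ℝ V = v → Module.finrank ℝ Z = z →
      (𝔫.IsHType ∨ 𝔫.IsFree) →
      (∀ j : ℕ, 1 ≤ j → j ≤ h → ∃ K : ℝ≥0, ∀ f : 𝓢(V × Z, ℂ),
        eLpNorm (𝔫.areaFunction j f) 2 volume ≤ K * eLpNorm f 2 volume) →
      ∀ f : V × Z → ℂ, MemLp f p volume →
        (∀ᵐ n : V × Z, ∀ s : ℝ, 0 < s →
          Integrable (𝔫.translate f s n) (sphereMeasure V Z)) ∧
        AEMeasurable (𝔫.sphericalMaximal f) volume ∧
        eLpNorm (𝔫.sphericalMaximal f) p volume ≤ C * eLpNorm f p volume := by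
  -- For h = 1 the critical exponent is 3/2 < 2; for h > 1 it lies below 2h/(2h-1), because (1 +
  -- 1/(2h))(2h - 1) = 2h - 1/(2h).
  have hp' : ENNReal.ofReal (1 + 1 / (2 * h)) < p := by
    rcases hp with ⟨rfl, hp⟩ | ⟨h1, hp⟩
    · refine lt_of_lt_of_le ?_ hp
      rw [← ENNReal.ofReal_ofNat]
      exact (ENNReal.ofReal_lt_ofReal_iff (by norm_num)).2 (by norm_num)
    · refine lt_of_le_of_lt (ENNReal.ofReal_le_ofReal ?_) hp
      have h2 : (1 : ℝ) < h := by exact_mod_cast h1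
      rw [le_div_iff₀ (by linarith)]
      have : (1 + 1 / (2 * h) : ℝ) * (2 * h - 1) = 2 * h - 1 / (2 * h) := by
        field_simp
        ring
      rw [this]
      have : (0 : ℝ) < 1 / (2 * h) := by positivity
      linarith
  obtain ⟨t, ht⟩ := exists_finset_structureConstants v z
  choose C hC using exists_maximalTheorem_of_structureConstants (v := v) (z := z) (by omega) hh hp'
  -- The sum over the finitely many classes dominates each of their constants.
  refine ⟨∑ r ∈ t, C r, ?_⟩
  intro V Z _ _ _ _ _ _ _ _ _ _ 𝔫 hV hZ h𝔫 harea f hf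
  obtain ⟨r, hrt, hr⟩ := ht V Z 𝔫 hV hZ h𝔫
  obtain ⟨h1, h2, h3⟩ := hC r V Z 𝔫 hr (harea h hh le_rfl) f hf
  refine ⟨h1, h2, h3.trans (mul_le_mul' ?_ le_rfl)⟩
  exact_mod_cast Finset.single_le_sum (fun _ _ => zero_le) hrt
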